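/- **Theorem (Desynchronisation bifurcation, even particle number).** Let $N\ge 4$ be even and, for $x=(x_i)_{i\in\mathbb Z/N\mathbb Z}\in\mathbb R^{\mathbb Z/N\mathbb Z}$ and $\gamma\in\mathbb R$, let $$V_\gamma(x)=\sum_{i\in\mathbb Z/N\mathbb Z}\Bigl(\tfrac14x_i^4-\tfrac12x_i^2\Bigr)+\frac\gamma4\sum_{i\in\mathbb Z/N\mathbb Z}(x_{i+1}-x_i)^2,\qquad \gamma_1=\frac1{1-\cos(2\pi/N)} .$$ Let $\mathcal S(\gamma)=\{x:\nabla V_\gamma(x)=0\}$ and let $\mathcal S_k(\gamma)$ be the set of $x\in\mathcal S(\gamma)$ at which the Hessian matrix of $V_\gamma$ has exactly $k$ negative and $N-k$ positive eigenvalues, counted with multiplicity ($k$-saddles; strict local minima for $k=0$). Let $G$ be the group of linear transformations generated by $R(x_1,\dots,x_N)=(x_2,\dots,x_N,x_1)$, $S(x_1,\dots,x_N)=(x_N,\dots,x_1)$ and $Cx=-x$, and let $O_x=\{gx:g\in G\}$. Put $O=(0,\dots,0)$ and $I^\pm=\pm(1,\dots,1)$. Then there exist $\delta=\delta(N)>0$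 and points $A=A(\gamma)$, $B=B(\gamma)$ in $\mathbb R^{\mathbb Z/N\mathbb Z}$ such that for $\gamma_1-\delta<\gamma<\gamma_1$ the set $\mathcal S(\gamma)$ has exactly $2N+3$ elements and $\mathcal S=\mathcal S_0\cup\mathcal S_1\cup\mathcal S_2\cup\mathcal S_3$, where $$\mathcal S_0=O_{I^+}=\{I^+,I^-\},\quad \mathcal S_1=O_A=\{A,RA,\dots,R^{N-1}A\},\quad \mathcal S_2=O_B=\{B,RB,\dots,R^{N-1}B\},\quad \mathcal S_3=O_O=\{O\},$$ and $\mathcal S_1$ and $\mathcal S_2$ have exactly $N$ elements each. Furthermore, $V_\gamma$ takes the same value $V_\gamma(A)$ at all $1$-saddles. If $N=4$, then $$\frac{V_\gamma(A)}N=-\frac14(1-\gamma)^2\qquad\text{for }\gamma_1-\delta<\gamma<\gamma_1,$$ and if $N\ge6$, then, as $\gamma\nearrow\gamma_1$, $$\frac{V_\gamma(A)}N=-\frac16\Bigl(1-\frac\gamma{\gamma_1}\Bigr)^2+\mathcal O\bigl((1-\gamma/\gamma_1)^3\bigr),$$ where the constant in the error term may depend on $N$. -/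

import Mathlib

open Filter Topology Asymptotics

noncomputable section

namespace CoupledChain

/-- Configuration space: one real coordinate for each site of the periodic lattice `ℤ/Nℤ`. -/
abbrev Config (N : ℕ) : Type := ZMod N → ℝ

/-- The local double-well potential. -/
def localPotential (ξ : ℝ) : ℝ := ξ ^ 4 / 4 - ξ ^ 2 / 2

/-- The potential of the periodic chain with nearest-neighbour coupling `γ`. -/
def potential (N : ℕ) [NeZero N] (γ : ℝ) (x : Config N) : ℝ :=
  ∑ i : ZMod N, localPotential (x i) + γ / 4 * ∑ i : ZMod N, (x (i + 1) - x i) ^ 2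

/-- The gradient of the potential, as the vector of its first partial derivatives. -/
def potentialGrad (N : ℕ) [NeZero N] (γ : ℝ) (x : Config N) : Config N :=
  fun i => fderiv ℝ (potential N γ) x (Pi.single i 1)

/-- The Hessian matrix of the potential, i.e. the matrix of its second partial derivatives. -/
def potentialHess (N : ℕ) [NeZero N] (γ : ℝ) (x : Config N) : Matrix (ZMod N) (ZMod N) ℝ :=
  Matrix.of fun i j => fderiv ℝ (fun y => potentialGrad N γ y j) x (Pi.single i 1)

/-- The set of stationary points of the potential. -/
def stationary (N : ℕ) [NeZero N] (γ : ℝ) : Set (Config N) :=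
  {x | potentialGrad N γ x = 0}

/-- Number of negative eigenvalues of the Hessian at `x`, with multiplicity
(the eigenvalues of this symmetric matrix are the roots of its characteristic polynomial). -/
def numNeg (N : ℕ) [NeZero N] (γ : ℝ) (x : Config N) : ℕ :=
  (potentialHess N γ x).charpoly.roots.countP (fun μ => μ < 0)

/-- Number of positive eigenvalues of the Hessian at `x`, with multiplicity. -/
def numPos (N : ℕ) [NeZero N] (γ : ℝ) (x : Config N) : ℕ :=
  (potentialHess N γ x).charpoly.roots.countP (fun μ => 0 < μ)

/-- The saddles of index `k`: stationary points at which the Hessian has `k` negative,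
no vanishing and `N - k` positive eigenvalues. For `k = 0` these are strict local minima. -/
def saddles (N : ℕ) [NeZero N] (γ : ℝ) (k : ℕ) : Set (Config N) :=
  {x | x ∈ stationary N γ ∧ numNeg N γ x = k ∧ numNeg N γ x + numPos N γ x = N}

/-- Cyclic permutation, `(x₁, …, x_N) ↦ (x₂, …, x_N, x₁)`. -/
def symR (N : ℕ) : Config N ≃ₗ[ℝ] Config N :=
  LinearEquiv.funCongrLeft ℝ ℝ (Equiv.addRight (1 : ZMod N))

/-- Reflection, `(x₁, …, x_N) ↦ (x_N, …, x₁)`, i.e. site `i` receives the value at `N + 1 - i`. -/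
def symS (N : ℕ) : Config N ≃ₗ[ℝ] Config N :=
  LinearEquiv.funCongrLeft ℝ ℝ (Equiv.subLeft (1 : ZMod N))

/-- Inversion, `x ↦ -x`. -/
def symC (N : ℕ) : Config N ≃ₗ[ℝ] Config N :=
  LinearEquiv.neg ℝ

/-- The symmetry group generated by `R`, `S` and `C`, acting on the configuration space. -/
def symGroup (N : ℕ) : Subgroup (Config N ≃ₗ[ℝ] Config N) :=
  Subgroup.closure {symR N, symS N, symC N}

/-- The orbit of `x` under the symmetry group. -/
def symOrbit (N : ℕ) (x : Config N) : Set (Config N) :=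
  MulAction.orbit (symGroup N) x

/-- The set `{x, R x, …, R^(N-1) x}`. -/
def cyclicTranslates (N : ℕ) (x : Config N) : Set (Config N) :=
  {y | ∃ k : ℕ, k < N ∧ y = (symR N ^ k) x}

/-- The configuration `(1, …, 1)`; its opposite is `-syncPlus N`. -/
def syncPlus (N : ℕ) : Config N := fun _ => 1

/-- The synchronisation threshold `1 / (1 - cos (2π/N))`. -/
def gammaOne (N : ℕ) : ℝ := 1 / (1 - Real.cos (2 * Real.pi / N))

end CoupledChain

end

/-! The proof is a Lyapunov–Schmidt reduction at the threshold, where the pair of first Fourier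
modes becomes unstable. The gradient is x³ + Lx, and L acts on mode k as γ(1 − cos(2πk/N)) − 1: this
is −1 on constants, −η := γ/γ₁ − 1 on the critical pair, and at least 1/2 on every other mode once γ
≥ 3γ₁/4.

A priori bound. The increments of a stationary point solve a linear equation of the same type;
pairing it with the increments and using the Poincaré inequality forces every non-synchronised
stationary point to have size O(√η) (`sq_le_of_force_eq_zero`).

Complement. Among small configurations, the equations off the critical modes have exactly one
solution with given critical component N r z̄ (`SolvesComplement.eq_of_firstMode_eq`). It is the sum
`branch` of a power series in r whose coefficients are Laurent polynomials in the phase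
(`solvesComplement_branch`). Two real equations remain, one angular and one radial.

Angular equation. The lattice sees exponents only modulo N, so the phase is first felt at degree N −
1: the angular force is N c r^(N−1) Im zᴺ, up to a smaller error which also carries the factor |Im
zᴺ| (`abs_angularForce_sub_le`). For even N the signs in the recursion alternate, so no cancellation
occurs and c ≠ 0 (`angularCoeff_bound`). Hence zᴺ = ±1, which gives two families of N phases.

Radial equation. A cubic term balances ηr. The intermediate value theorem gives an amplitude
(`Regime.exists_radialForce_eq_zero`), and pairing two solutions on one ray shows that it is unique
(`Regime.radius_unique_aux`).

Signature. On the branch the Hessian is negative on constants and positive on the amplitude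
direction together with the higher modes. On the phase direction its sign is that of minus the slope
of the angular force, hence is governed by zᴺ = ±1 (`Regime.angularSlope_pos`). This separates index
1 from index 2.

Values. At stationary points V = −¼ Σ x⁴. For N ≥ 6 the expansion in r gives η = 3r² + O(r⁴) and V/N
= −η²/6 + O(η³); for N = 4 the equations decouple and are solved exactly. -/

noncomputable section

/-! ### Explicit gradient and Hessian. -/

namespace CoupledChain

/-- The nearest-neighbour part of the force. -/
def linForce (N : ℕ) (γ : ℝ) (x : Config N) : Config N :=
  fun i => -x i - γ / 2 * (x (i + 1) + x (i - 1) - 2 * x i)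

/-- Explicit form of the gradient of the potential. -/
def force (N : ℕ) (γ : ℝ) (x : Config N) : Config N :=
  fun i => x i ^ 3 + linForce N γ x i

/-- Explicit form of the Hessian of the potential, as an operator. -/
def hessOp (N : ℕ) (γ : ℝ) (x v : Config N) : Config N :=
  fun i => 3 * x i ^ 2 * v i + linForce N γ v i

section
variable {N : ℕ} [NeZero N]

lemma sum_shift (f : ZMod N → ℝ) : ∑ i, f (i + 1) = ∑ i, f i :=
  Equiv.sum_comp (Equiv.addRight (1 : ZMod N)) f

lemma sum_mul_shift_sub (x v : Config N) :
    ∑ i, (x (i + 1) - x i) * (v (i + 1) - v i)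
      = -∑ i, (x (i + 1) + x (i - 1) - 2 * x i) * v i := by
  have h1 := sum_shift (fun i => x i * v i)
  have h2 := sum_shift (fun i => x (i - 1) * v i)
  simp only [add_sub_cancel_right] at h2
  have : ∑ i, (x (i + 1) - x i) * (v (i + 1) - v i)
      = ∑ i, x (i + 1) * v (i + 1) - ∑ i, x (i + 1) * v i - ∑ i, x i * v (i + 1)
        + ∑ i, x i * v i := by
    rw [← Finset.sum_sub_distrib, ← Finset.sum_sub_distrib, ← Finset.sum_add_distrib]
    exact Finset.sum_congr rfl fun i _ => by ring
  rw [this, h1, h2, ← Finset.sum_sub_distrib, ← Finset.sum_sub_distrib,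
    ← Finset.sum_add_distrib, ← Finset.sum_neg_distrib]
  exact Finset.sum_congr rfl fun i _ => by ring

lemma sum_linForce_mul (γ : ℝ) (x v : Config N) :
    ∑ i, linForce N γ x i * v i
      = -∑ i, x i * v i + γ / 2 * ∑ i, (x (i + 1) - x i) * (v (i + 1) - v i) := by
  rw [sum_mul_shift_sub, ← Finset.sum_neg_distrib, ← Finset.sum_neg_distrib, Finset.mul_sum,
    ← Finset.sum_add_distrib]
  exact Finset.sum_congr rfl fun i _ => by simp only [linForce]; ring

lemma sum_linForce_mul_comm (γ : ℝ) (x v : Config N) :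
    ∑ i, linForce N γ x i * v i = ∑ i, x i * linForce N γ v i := by
  rw [sum_linForce_mul, Finset.sum_congr rfl fun i _ => mul_comm (x i) (linForce N γ v i),
    sum_linForce_mul]
  congr 2
  · exact Finset.sum_congr rfl fun i _ => mul_comm _ _
  · exact Finset.sum_congr rfl fun i _ => mul_comm _ _

lemma sum_hessOp_mul_comm (γ : ℝ) (x v w : Config N) :
    ∑ i, hessOp N γ x v i * w i = ∑ i, v i * hessOp N γ x w i := by
  simp only [hessOp, add_mul, mul_add, Finset.sum_add_distrib, sum_linForce_mul_comm]
  congr 1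
  exact Finset.sum_congr rfl fun i _ => by ring

lemma hasFDerivAt_potential (γ : ℝ) (x : Config N) :
    HasFDerivAt (potential N γ)
      (∑ i, (x i ^ 3 - x i) • ContinuousLinearMap.proj (R := ℝ) (φ := fun _ : ZMod N => ℝ) i
        + (γ / 4) • ∑ i, (2 * (x (i + 1) - x i)) •
          (ContinuousLinearMap.proj (R := ℝ) (φ := fun _ : ZMod N => ℝ) (i + 1) -
            ContinuousLinearMap.proj (R := ℝ) (φ := fun _ : ZMod N => ℝ) i)) x := by
  unfold potential localPotential
  have hp : ∀ i : ZMod N, HasFDerivAt (fun y : Config N => y i)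
      (ContinuousLinearMap.proj (R := ℝ) (φ := fun _ : ZMod N => ℝ) i) x :=
    fun i => hasFDerivAt_apply i x
  refine HasFDerivAt.add ?_ (HasFDerivAt.const_mul ?_ _)
  · refine HasFDerivAt.fun_sum fun i _ => ?_
    have := (((hp i).pow 4).mul_const (1 / 4 : ℝ)).sub (((hp i).pow 2).mul_const (1 / 2 : ℝ))
    convert! this using 1
    · funext y; simp; ring
    · ext v; simp; ring
  · refine HasFDerivAt.fun_sum fun i _ => ?_
    have := ((hp (i + 1)).sub (hp i)).pow 2
    convert! this using 1
    ext v; simp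

lemma fderiv_potential_apply (γ : ℝ) (x v : Config N) :
    fderiv ℝ (potential N γ) x v = ∑ i, force N γ x i * v i := by
  rw [(hasFDerivAt_potential γ x).fderiv]
  simp only [force, add_mul, Finset.sum_add_distrib, sum_linForce_mul]
  simp only [add_apply, sum_apply, smul_apply, smul_eq_mul,
    sub_apply, ContinuousLinearMap.proj_apply, sub_mul,
    Finset.sum_sub_distrib]
  rw [sub_eq_add_neg, add_assoc, ← Finset.sum_sub_distrib, Finset.mul_sum, Finset.mul_sum]
  congr 2
  exact Finset.sum_congr rfl fun i _ => by ring

lemma potentialGrad_eq (γ : ℝ) (x : Config N) : potentialGrad N γ x = force N γ x := by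
  funext i
  simp [potentialGrad, fderiv_potential_apply, Pi.single_apply]

lemma mem_stationary_iff {γ : ℝ} {x : Config N} : x ∈ stationary N γ ↔ force N γ x = 0 := by
  rw [stationary, Set.mem_ofPred_eq, potentialGrad_eq]

lemma potentialHess_apply (γ : ℝ) (x : Config N) (i j : ZMod N) :
    potentialHess N γ x i j = hessOp N γ x (Pi.single i 1) j := by
  have hp : ∀ i : ZMod N, HasFDerivAt (fun y : Config N => y i)
      (ContinuousLinearMap.proj (R := ℝ) (φ := fun _ : ZMod N => ℝ) i) x :=
    fun i => hasFDerivAt_apply i x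
  have h := ((hp j).pow 3).add (((hp j).neg).sub
    ((((hp (j + 1)).add (hp (j - 1))).sub ((hp j).const_mul 2)).const_mul (γ / 2)))
  have h2 : (fun y => potentialGrad N γ y j) = fun y : Config N =>
      y j ^ 3 + (-y j - γ / 2 * (y (j + 1) + y (j - 1) - 2 * y j)) := by
    funext y; rw [potentialGrad_eq]; rfl
  rw [potentialHess, Matrix.of_apply, h2]
  refine (congrArg (fun L => L (Pi.single i 1)) h.fderiv).trans ?_
  simp [hessOp, linForce]

lemma hessOp_eq_sum (γ : ℝ) (x v : Config N) (j : ZMod N) :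
    hessOp N γ x v j = ∑ i, v i * hessOp N γ x (Pi.single i 1) j := by
  have := sum_hessOp_mul_comm γ x v (Pi.single j 1)
  simp only [Pi.single_apply, mul_ite, mul_one, mul_zero, Finset.sum_ite_eq', Finset.mem_univ,
    if_true] at this
  rw [this]
  refine Finset.sum_congr rfl fun i _ => ?_
  have := sum_hessOp_mul_comm γ x (Pi.single j 1) (Pi.single i 1)
  simp only [Pi.single_apply, mul_ite, mul_one, mul_zero, Finset.sum_ite_eq', Finset.mem_univ,
    if_true, ite_mul, one_mul, zero_mul] at this
  rw [← this]

lemma potentialHess_isHermitian (γ : ℝ) (x : Config N) : (potentialHess N γ x).IsHermitian := by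
  ext i j
  have := sum_hessOp_mul_comm γ x (Pi.single j 1) (Pi.single i 1)
  simp only [Pi.single_apply, mul_ite, mul_one, mul_zero, Finset.sum_ite_eq', Finset.mem_univ,
    if_true, ite_mul, one_mul, zero_mul] at this
  simp [potentialHess_apply, this]

lemma potentialHess_mulVec (γ : ℝ) (x v : Config N) :
    (potentialHess N γ x).mulVec v = hessOp N γ x v := by
  funext j
  rw [hessOp_eq_sum, Matrix.mulVec, dotProduct]
  refine Finset.sum_congr rfl fun i _ => ?_
  have h := (potentialHess_isHermitian γ x).apply i j
  rw [star_trivial] at h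
  rw [h, potentialHess_apply, mul_comm]

end

/-! ### Signature of a symmetric matrix from test subspaces. -/

section Signature

variable {n : Type*} [Fintype n] [DecidableEq n]

lemma _root_.Matrix.IsHermitian.dotProduct_mulVec_eq_sum_eigenvalues {M : Matrix n n ℝ}
    (hM : M.IsHermitian) (w : n → ℝ) :
    w ⬝ᵥ M.mulVec w
      = ∑ i, hM.eigenvalues i * (w ⬝ᵥ ⇑(hM.eigenvectorBasis i)) ^ 2 := by
  have hw : w = ∑ i, (w ⬝ᵥ ⇑(hM.eigenvectorBasis i)) • ⇑(hM.eigenvectorBasis i) := by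
    have := hM.eigenvectorBasis.sum_repr (WithLp.toLp 2 w)
    have h2 := congrArg (WithLp.ofLp) this
    rw [WithLp.ofLp_sum] at h2
    conv_lhs => rw [show w = WithLp.ofLp (WithLp.toLp 2 w) from rfl, ← h2]
    refine Finset.sum_congr rfl fun i _ => ?_
    rw [OrthonormalBasis.repr_apply_apply, EuclideanSpace.inner_eq_star_dotProduct]
    simp
  have hMw : M.mulVec w = ∑ i, M.mulVec
      ((w ⬝ᵥ ⇑(hM.eigenvectorBasis i)) • ⇑(hM.eigenvectorBasis i)) := by
    conv_lhs => rw [hw, Matrix.mulVec_sum]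
  rw [hMw, dotProduct_sum]
  refine Finset.sum_congr rfl fun i _ => ?_
  rw [Matrix.mulVec_smul, hM.mulVec_eigenvectorBasis, dotProduct_smul, dotProduct_smul,
    smul_eq_mul, smul_eq_mul]
  ring

/-- The coordinates along the selected eigenvectors determine an element of `W`, so `W` embeds into
a space whose dimension is the number of selected eigenvalues. -/
lemma _root_.Matrix.IsHermitian.finrank_le_card_eigenvalues {M : Matrix n n ℝ}
    (hM : M.IsHermitian) (p : ℝ → Prop) [DecidablePred p] (W : Submodule ℝ (n → ℝ))
    (hW : ∀ w ∈ W, (∀ i, p (hM.eigenvalues i) → w ⬝ᵥ ⇑(hM.eigenvectorBasis i) = 0) → w = 0) :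
    Module.finrank ℝ W ≤ M.charpoly.roots.countP p := by
  have hc : M.charpoly.roots.countP p
      = Fintype.card {i // p (hM.eigenvalues i)} := by
    rw [hM.roots_charpoly_eq_eigenvalues, Multiset.countP_map, Fintype.card_subtype]
    rfl
  let f : W →ₗ[ℝ] ({i // p (hM.eigenvalues i)} → ℝ) :=
    LinearMap.pi fun i =>
      { toFun := fun w => (w : n → ℝ) ⬝ᵥ ⇑(hM.eigenvectorBasis i)
        map_add' := fun a b => by simp [add_dotProduct]
        map_smul' := fun a b => by simp [smul_dotProduct] }
  have hf : Function.Injective f := by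
    rw [← LinearMap.ker_eq_bot, LinearMap.ker_eq_bot']
    intro w hw
    exact Subtype.ext (hW w w.2 fun i hi => congrFun hw ⟨i, hi⟩)
  rw [hc]
  simpa using LinearMap.finrank_le_finrank_of_injective hf

lemma _root_.Matrix.IsHermitian.finrank_le_countP_pos {M : Matrix n n ℝ} (hM : M.IsHermitian)
    (W : Submodule ℝ (n → ℝ)) (hW : ∀ w ∈ W, w ≠ 0 → 0 < w ⬝ᵥ M.mulVec w) :
    Module.finrank ℝ W ≤ M.charpoly.roots.countP (fun μ => 0 < μ) := by
  refine hM.finrank_le_card_eigenvalues _ W fun w hw h => ?_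
  by_contra hne
  refine (hW w hw hne).not_ge ?_
  rw [hM.dotProduct_mulVec_eq_sum_eigenvalues]
  refine Finset.sum_nonpos fun i _ => ?_
  by_cases hi : 0 < hM.eigenvalues i
  · simp [h i hi]
  · exact mul_nonpos_of_nonpos_of_nonneg (not_lt.1 hi) (sq_nonneg _)

lemma _root_.Matrix.IsHermitian.finrank_le_countP_neg {M : Matrix n n ℝ} (hM : M.IsHermitian)
    (W : Submodule ℝ (n → ℝ)) (hW : ∀ w ∈ W, w ≠ 0 → w ⬝ᵥ M.mulVec w < 0) :
    Module.finrank ℝ W ≤ M.charpoly.roots.countP (fun μ => μ < 0) := by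
  refine hM.finrank_le_card_eigenvalues _ W fun w hw h => ?_
  by_contra hne
  refine (hW w hw hne).not_ge ?_
  rw [hM.dotProduct_mulVec_eq_sum_eigenvalues]
  refine Finset.sum_nonneg fun i _ => ?_
  by_cases hi : hM.eigenvalues i < 0
  · simp [h i hi]
  · exact mul_nonneg (not_lt.1 hi) (sq_nonneg _)

lemma countP_neg_add_countP_pos_le (s : Multiset ℝ) :
    s.countP (fun μ => μ < 0) + s.countP (fun μ => 0 < μ) ≤ s.card := by
  induction s using Multiset.induction with
  | empty => simp
  | cons a s ih =>
    rw [Multiset.countP_cons, Multiset.countP_cons, Multiset.card_cons]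
    by_cases h1 : a < 0
    · simp [h1, h1.le.not_gt]; omega
    · split_ifs <;> omega

end Signature

section
variable {N : ℕ} [NeZero N]

/-- The quadratic form of the Hessian. -/
def hessForm (N : ℕ) [NeZero N] (γ : ℝ) (x v : Config N) : ℝ := ∑ i, v i * hessOp N γ x v i

/-- The subspaces give at least k negative and N − k positive eigenvalues. Since the characteristic
polynomial has at most N roots, both bounds are equalities. -/
lemma hessian_index_of_subspaces {γ : ℝ} {x : Config N} {k : ℕ} (U W : Submodule ℝ (Config N))
    (hU : k ≤ Module.finrank ℝ U) (hW : N ≤ Module.finrank ℝ W + k)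
    (hUneg : ∀ v ∈ U, v ≠ 0 → hessForm N γ x v < 0)
    (hWpos : ∀ v ∈ W, v ≠ 0 → 0 < hessForm N γ x v) :
    numNeg N γ x = k ∧ numNeg N γ x + numPos N γ x = N := by
  have key : ∀ v : Config N, v ⬝ᵥ (potentialHess N γ x).mulVec v = hessForm N γ x v := by
    intro v; rw [potentialHess_mulVec]; rfl
  have h1 : Module.finrank ℝ U ≤ numNeg N γ x := (potentialHess_isHermitian γ x).finrank_le_countP_neg U
    (fun v hv hne => by rw [key]; exact hUneg v hv hne)
  have h2 : Module.finrank ℝ W ≤ numPos N γ x := (potentialHess_isHermitian γ x).finrank_le_countP_pos W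
    (fun v hv hne => by rw [key]; exact hWpos v hv hne)
  have h3 : numNeg N γ x + numPos N γ x ≤ _ := countP_neg_add_countP_pos_le (potentialHess N γ x).charpoly.roots
  have h4 : (potentialHess N γ x).charpoly.roots.card ≤ N :=
    (Polynomial.card_roots' _).trans
      (by rw [Matrix.charpoly_natDegree_eq_dim, ZMod.card])
  omega

end

/-! ### Discrete Fourier analysis and spectral gaps. -/

open ZMod (toCircle)

section
set_option linter.unusedSectionVars false
variable {N : ℕ} [NeZero N]

/-- The component of a configuration along the first Fourier mode. -/
def firstMode (N : ℕ) [NeZero N] : Config N →ₗ[ℝ] ℂ where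
  toFun x := ∑ j, (x j : ℂ) * (toCircle j : ℂ)
  map_add' x y := by simp [add_mul, Finset.sum_add_distrib]
  map_smul' a x := by simp [Finset.mul_sum, mul_assoc]

lemma firstMode_apply (x : Config N) : firstMode N x = ∑ j, (x j : ℂ) * (toCircle j : ℂ) := rfl

lemma sum_toCircle_mul (b : ZMod N) :
    ∑ k : ZMod N, (toCircle (k * b) : ℂ) = if b = 0 then (N : ℂ) else 0 := by
  have := AddChar.sum_mulShift b (ZMod.isPrimitive_stdAddChar N)
  simpa [ZMod.stdAddChar_apply, ZMod.card] using this

lemma conj_toCircle (k : ZMod N) : (starRingEnd ℂ) (toCircle k : ℂ) = (toCircle (-k) : ℂ) := by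
  rw [AddChar.map_neg_eq_inv, Circle.coe_inv_eq_conj]

lemma toCircle_add (i j : ZMod N) : (toCircle (i + j) : ℂ) = toCircle i * toCircle j := by
  rw [AddChar.map_add_eq_mul, Circle.coe_mul]

lemma norm_toCircle (k : ZMod N) : ‖(toCircle k : ℂ)‖ = 1 := Circle.norm_coe _

/-- Discrete Fourier coefficients. -/
def fourierCoeffs (w : Config N) (k : ZMod N) : ℂ := ∑ j, (w j : ℂ) * (toCircle (j * k) : ℂ)

lemma fourierCoeffs_zero (w : Config N) : fourierCoeffs w 0 = ((∑ j, w j : ℝ) : ℂ) := by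
  simp [fourierCoeffs]

lemma fourierCoeffs_one (w : Config N) : fourierCoeffs w 1 = firstMode N w := by
  simp [fourierCoeffs, firstMode_apply]

lemma fourierCoeffs_neg (w : Config N) (k : ZMod N) :
    fourierCoeffs w (-k) = (starRingEnd ℂ) (fourierCoeffs w k) := by
  simp [fourierCoeffs, conj_toCircle]

lemma parseval (w : Config N) : ∑ k, ‖fourierCoeffs w k‖ ^ 2 = N * ∑ j, w j ^ 2 := by
  have h : (∑ k, fourierCoeffs w k * (starRingEnd ℂ) (fourierCoeffs w k) : ℂ)
      = N * ∑ j, (w j : ℂ) ^ 2 := by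
    simp only [fourierCoeffs, map_sum, map_mul, Complex.conj_ofReal, conj_toCircle,
      Finset.sum_mul_sum]
    rw [Finset.sum_comm]
    rw [Finset.mul_sum]
    refine Finset.sum_congr rfl fun i _ => ?_
    rw [Finset.sum_comm]
    have : ∀ j, ∑ k, (w i : ℂ) * (toCircle (i * k) : ℂ) * ((w j : ℂ) * (toCircle (-(j * k)) : ℂ))
        = (w i : ℂ) * w j * if i - j = 0 then (N : ℂ) else 0 := by
      intro j
      rw [← sum_toCircle_mul, Finset.mul_sum]
      refine Finset.sum_congr rfl fun k _ => ?_
      rw [show k * (i - j) = i * k + -(j * k) by ring, toCircle_add]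
      ring
    simp only [this, sub_eq_zero]
    simp
    ring
  have h2 : ((∑ k, ‖fourierCoeffs w k‖ ^ 2 : ℝ) : ℂ) = ((N * ∑ j, w j ^ 2 : ℝ) : ℂ) := by
    push_cast
    rw [← h]
    exact Finset.sum_congr rfl fun k _ => by rw [Complex.mul_conj, Complex.normSq_eq_norm_sq]; simp
  exact_mod_cast h2

lemma fourierCoeffs_diff (w : Config N) (k : ZMod N) :
    fourierCoeffs (fun j => w (j + 1) - w j) k
      = ((starRingEnd ℂ) (toCircle k : ℂ) - 1) * fourierCoeffs w k := by
  have h : fourierCoeffs (fun j => w (j + 1)) k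
      = (starRingEnd ℂ) (toCircle k : ℂ) * fourierCoeffs w k := by
    unfold fourierCoeffs
    rw [← Equiv.sum_comp (Equiv.addRight (1 : ZMod N)) (fun j => (w j : ℂ) * _), Finset.mul_sum]
    refine Finset.sum_congr rfl fun j _ => ?_
    have h1 : (starRingEnd ℂ) (toCircle k : ℂ) * (toCircle k : ℂ) = 1 := by
      rw [mul_comm, Complex.mul_conj, Complex.normSq_eq_norm_sq, norm_toCircle]; simp
    simp only [Equiv.coe_addRight]
    rw [add_mul, one_mul, toCircle_add]
    linear_combination -(w (j + 1) : ℂ) * (toCircle (j * k) : ℂ) * h1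
  rw [sub_mul, one_mul, ← h]
  simp [fourierCoeffs, sub_mul, Finset.sum_sub_distrib]

lemma norm_conj_toCircle_sub_one_sq (k : ZMod N) :
    ‖(starRingEnd ℂ) (toCircle k : ℂ) - 1‖ ^ 2 = 2 - 2 * (toCircle k : ℂ).re := by
  have h : Complex.normSq (toCircle k : ℂ) = 1 := by
    rw [Complex.normSq_eq_norm_sq, norm_toCircle, one_pow]
  rw [← Complex.normSq_eq_norm_sq, Complex.normSq_apply]
  rw [Complex.normSq_apply] at h
  simp
  linarith

/-- By Parseval, since taking increments multiplies the k-th coefficient by a factor of squared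
modulus 2 − 2 cos(2πk/N). Only modes present in `w` need to satisfy the gap. -/
lemma gap_mul_sum_sq_le {w : Config N} {g : ℝ}
    (h : ∀ k, fourierCoeffs w k = 0 ∨ g ≤ 2 - 2 * (toCircle k : ℂ).re) :
    g * ∑ j, w j ^ 2 ≤ ∑ j, (w (j + 1) - w j) ^ 2 := by
  have hN : (0 : ℝ) < N := by exact_mod_cast Nat.pos_of_ne_zero (NeZero.ne N)
  refine le_of_mul_le_mul_left ?_ hN
  have h1 := parseval (fun j => w (j + 1) - w j)
  have h2 := parseval w
  rw [← h1, mul_left_comm, ← h2, Finset.mul_sum]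
  refine Finset.sum_le_sum fun k _ => ?_
  rw [fourierCoeffs_diff, norm_mul, mul_pow, norm_conj_toCircle_sub_one_sq]
  rcases h k with h | h
  · simp [h]
  · exact mul_le_mul_of_nonneg_right h (sq_nonneg _)

lemma toCircle_re (k : ZMod N) : (toCircle k : ℂ).re = Real.cos (2 * Real.pi * (k.val / N)) := by
  rw [ZMod.toCircle_eq_circleExp, Circle.coe_exp, Complex.exp_ofReal_mul_I_re]

lemma cos_le_cos_of_index {N m v : ℕ} (h1 : m ≤ v) (h2 : v + m ≤ N) (hN : 0 < N) :
    Real.cos (2 * Real.pi * (v / N)) ≤ Real.cos (2 * Real.pi * (m / N)) := by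
  have hN' : (0 : ℝ) < N := by exact_mod_cast hN
  have key : ∀ v : ℕ, m ≤ v → 2 * v ≤ N →
      Real.cos (2 * Real.pi * (v / N)) ≤ Real.cos (2 * Real.pi * (m / N)) := by
    intro v h1 h2
    have h3 : (m : ℝ) ≤ v := by exact_mod_cast h1
    have h4 : 2 * (v : ℝ) ≤ N := by exact_mod_cast h2
    have h5 : (v : ℝ) / N ≤ 1 / 2 := by rw [div_le_iff₀ hN']; linarith
    refine Real.cos_le_cos_of_nonneg_of_le_pi (by positivity) ?_ ?_
    · nlinarith [Real.pi_pos]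
    · gcongr
  by_cases hv : 2 * v ≤ N
  · exact key v h1 hv
  · have h3 := key (N - v) (by omega) (by omega)
    have h4 : 2 * Real.pi * ((N - v : ℕ) / N : ℝ) = 2 * Real.pi - 2 * Real.pi * (v / N) := by
      rw [Nat.cast_sub (by omega)]; field_simp
    rwa [h4, Real.cos_two_pi_sub] at h3

lemma toCircle_re_le_of_ne_zero {k : ZMod N} (hk : k ≠ 0) :
    (toCircle k : ℂ).re ≤ Real.cos (2 * Real.pi / N) := by
  have h0 : k.val ≠ 0 := by rwa [Ne, ZMod.val_eq_zero]
  have h1 := ZMod.val_lt k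
  rw [toCircle_re]
  convert cos_le_cos_of_index (N := N) (m := 1) (v := k.val) (by omega) (by omega) (by omega)
    using 2
  simp [div_eq_mul_inv]

lemma toCircle_re_le_of_ne {k : ZMod N} (hk : k ≠ 0) (hk1 : k ≠ 1) (hk2 : k ≠ -1) :
    (toCircle k : ℂ).re ≤ Real.cos (2 * (2 * Real.pi / N)) := by
  have h0 : k.val ≠ 0 := by rwa [Ne, ZMod.val_eq_zero]
  have h1 := ZMod.val_lt k
  have h2 : k.val ≠ 1 := by
    intro h
    exact hk1 (by rw [← ZMod.natCast_zmod_val k, h, Nat.cast_one])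
  have h3 : k.val + 1 ≠ N := by
    intro h
    refine hk2 (eq_neg_of_add_eq_zero_left ?_)
    rw [← ZMod.natCast_zmod_val k]
    rw [← Nat.cast_succ, Nat.succ_eq_add_one, h, ZMod.natCast_self]
  rw [toCircle_re]
  convert cos_le_cos_of_index (N := N) (m := 2) (v := k.val) (by omega) (by omega) (by omega)
    using 2
  push_cast
  ring

lemma gap_one_le {w : Config N} (hw : ∑ j, w j = 0) :
    (2 - 2 * Real.cos (2 * Real.pi / N)) * ∑ j, w j ^ 2 ≤ ∑ j, (w (j + 1) - w j) ^ 2 := by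
  refine gap_mul_sum_sq_le fun k => ?_
  by_cases hk : k = 0
  · left; rw [hk, fourierCoeffs_zero, hw]; simp
  · right; linarith [toCircle_re_le_of_ne_zero hk]

lemma gap_two_le {w : Config N} (hw : ∑ j, w j = 0) (hw1 : firstMode N w = 0) :
    (2 - 2 * Real.cos (2 * (2 * Real.pi / N))) * ∑ j, w j ^ 2
      ≤ ∑ j, (w (j + 1) - w j) ^ 2 := by
  refine gap_mul_sum_sq_le fun k => ?_
  by_cases hk : k = 0
  · left; rw [hk, fourierCoeffs_zero, hw]; simp
  by_cases hk1 : k = 1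
  · left; rw [hk1, fourierCoeffs_one, hw1]
  by_cases hk2 : k = -1
  · left; rw [hk2, fourierCoeffs_neg, fourierCoeffs_one, hw1]; simp
  · right; linarith [toCircle_re_le_of_ne hk hk1 hk2]

lemma angle_bounds (hN : 4 ≤ N) : 0 < 2 * Real.pi / N ∧ 2 * Real.pi / N ≤ Real.pi / 2 := by
  have h : (4 : ℝ) ≤ N := by exact_mod_cast hN
  refine ⟨by positivity, ?_⟩
  rw [div_le_div_iff₀ (by linarith) (by norm_num)]
  nlinarith [Real.pi_pos]

lemma cos_angle_bounds (hN : 4 ≤ N) :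
    0 ≤ Real.cos (2 * Real.pi / N) ∧ Real.cos (2 * Real.pi / N) < 1 := by
  obtain ⟨h1, h2⟩ := angle_bounds hN
  refine ⟨Real.cos_nonneg_of_neg_pi_div_two_le_of_le (by linarith) h2, ?_⟩
  have := Real.cos_lt_cos_of_nonneg_of_le_pi le_rfl (by linarith [Real.pi_pos]) h1
  simpa using this

lemma gammaOne_mul (hN : 4 ≤ N) : gammaOne N * (1 - Real.cos (2 * Real.pi / N)) = 1 := by
  have := (cos_angle_bounds hN).2
  rw [gammaOne, one_div, inv_mul_cancel₀ (by linarith)]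

lemma one_le_gammaOne (hN : 4 ≤ N) : 1 ≤ gammaOne N := by
  obtain ⟨h1, h2⟩ := cos_angle_bounds hN
  rw [gammaOne, le_div_iff₀ (by linarith)]
  linarith

/-- From 1 − cos 2θ = 2(1 − cos θ)(1 + cos θ), with cos θ ≥ 0 because N ≥ 4. -/
lemma gammaOne_mul_gap (hN : 4 ≤ N) :
    2 ≤ gammaOne N * (1 - Real.cos (2 * (2 * Real.pi / N))) := by
  have h0 := gammaOne_mul hN
  obtain ⟨h1, h2⟩ := cos_angle_bounds hN
  rw [Real.cos_two_mul]
  have : gammaOne N * (1 - (2 * Real.cos (2 * Real.pi / N) ^ 2 - 1))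
      = 2 * (gammaOne N * (1 - Real.cos (2 * Real.pi / N))) * (1 + Real.cos (2 * Real.pi / N)) := by
    ring
  rw [this, h0]
  linarith

/-- This is where 3/4 comes from: it keeps the eigenvalues of the linear part on the modes beyond
the first at least 3/2 − 1 = 1/2. -/
lemma half_le_gap {γ : ℝ} (hN : 4 ≤ N) (hγ : 3 / 4 * gammaOne N ≤ γ) :
    3 / 2 ≤ γ * (1 - Real.cos (2 * (2 * Real.pi / N))) := by
  have h1 := gammaOne_mul_gap hN
  have h2 : 0 ≤ 1 - Real.cos (2 * (2 * Real.pi / N)) := by linarith [Real.cos_le_one (2 * (2 * Real.pi / N))]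
  nlinarith [mul_le_mul_of_nonneg_right hγ h2]

lemma half_sum_sq_le {γ : ℝ} (hN : 4 ≤ N) (hγ : 3 / 4 * gammaOne N ≤ γ) {w : Config N}
    (hw : ∑ j, w j = 0) (hw1 : firstMode N w = 0) :
    1 / 2 * ∑ j, w j ^ 2 ≤ ∑ j, linForce N γ w j * w j := by
  have h1 := gap_two_le hw hw1
  have h2 := half_le_gap hN hγ
  have h0 : 0 ≤ γ := by linarith [one_le_gammaOne hN]
  rw [sum_linForce_mul]
  have h3 : 0 ≤ ∑ j, w j ^ 2 := Finset.sum_nonneg fun i _ => sq_nonneg _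
  simp only [← pow_two]
  have h4 := mul_le_mul_of_nonneg_left h1 (by linarith : 0 ≤ γ / 2)
  nlinarith [mul_le_mul_of_nonneg_right h2 h3]

/-! ### Inverting the linear part off the critical modes; uniqueness on the complement. -/

lemma firstMode_const (hN : 4 ≤ N) (a : ℝ) : firstMode N (fun _ => a) = 0 := by
  have h := sum_toCircle_mul (N := N) 1
  have : Fact (1 < N) := ⟨by omega⟩
  rw [if_neg one_ne_zero] at h
  simp only [mul_one] at h
  rw [firstMode_apply, ← Finset.mul_sum, h, mul_zero]

lemma linForce_const (γ a : ℝ) (i : ZMod N) : linForce N γ (fun _ => a) i = -a := by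
  simp only [linForce]; ring

lemma linForce_add (γ : ℝ) (x y : Config N) :
    linForce N γ (x + y) = linForce N γ x + linForce N γ y := by
  funext i; simp only [linForce, Pi.add_apply]; ring

lemma linForce_sub (γ : ℝ) (x y : Config N) :
    linForce N γ (x - y) = linForce N γ x - linForce N γ y := by
  funext i; simp only [linForce, Pi.sub_apply]; ring

lemma linForce_smul (γ a : ℝ) (x : Config N) :
    linForce N γ (a • x) = a • linForce N γ x := by
  funext i; simp only [linForce, Pi.smul_apply, smul_eq_mul]; ring

lemma linForce_neg (γ : ℝ) (x : Config N) : linForce N γ (-x) = -linForce N γ x := by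
  funext i; simp only [linForce, Pi.neg_apply]; ring

lemma sum_linForce (γ : ℝ) (x : Config N) : ∑ i, linForce N γ x i = -∑ i, x i := by
  have := sum_linForce_mul γ x (fun _ => 1)
  simpa using this

/-- Off the critical modes the linear part is indefinite: −1 on constants, at least 1/2 elsewhere.
Reversing the sign of the mean of `w` gives a test configuration of the same norm against which the
form is coercive. -/
lemma exists_coercive_test {γ : ℝ} (hN : 4 ≤ N) (hγ : 3 / 4 * gammaOne N ≤ γ) {w : Config N}
    (hw1 : firstMode N w = 0) :
    ∃ g : Config N, firstMode N g = 0 ∧ ∑ j, g j ^ 2 = ∑ j, w j ^ 2 ∧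
      1 / 2 * ∑ j, w j ^ 2 ≤ ∑ j, g j * linForce N γ w j := by
  have hN0 : (N : ℝ) ≠ 0 := by exact_mod_cast NeZero.ne N
  set m : ℝ := (∑ j, w j) / N with hm
  set w' : Config N := w - fun _ => m with hw'
  have hww : w = w' + fun _ => m := by rw [hw']; simp
  have hsum : ∑ j, w' j = 0 := by
    simp [hw', Finset.sum_sub_distrib, ZMod.card, hm]; field_simp; simp
  have hfirst : firstMode N w' = 0 := by rw [hw', map_sub, hw1, firstMode_const hN, sub_zero]
  have hsq : ∑ j, w j ^ 2 = ∑ j, w' j ^ 2 + N * m ^ 2 := by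
    have : ∑ j, w j ^ 2 = ∑ j, (w' j ^ 2 + 2 * m * w' j + m ^ 2) :=
      Finset.sum_congr rfl fun j _ => by rw [hww]; simp only [Pi.add_apply]; ring
    rw [this, Finset.sum_add_distrib, Finset.sum_add_distrib, ← Finset.mul_sum, hsum]
    simp [ZMod.card]
  refine ⟨w' - fun _ => m, by rw [map_sub, hfirst, firstMode_const hN, sub_zero], ?_, ?_⟩
  · have : ∑ j, (w' j - m) ^ 2 = ∑ j, (w' j ^ 2 - 2 * m * w' j + m ^ 2) :=
      Finset.sum_congr rfl fun j _ => by ring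
    simp only [Pi.sub_apply]
    rw [this, Finset.sum_add_distrib, Finset.sum_sub_distrib, ← Finset.mul_sum, hsum, hsq]
    simp [ZMod.card]
  · have h1 := half_sum_sq_le hN hγ hsum hfirst
    have h2 : ∑ j, (w' j - m) * linForce N γ w j
        = ∑ j, linForce N γ w' j * w' j - m * ∑ j, w' j - m * ∑ j, linForce N γ w' j
          + N * m ^ 2 := by
      have : ∑ j, (w' j - m) * linForce N γ w j
        = ∑ j, (linForce N γ w' j * w' j - m * w' j - m * linForce N γ w' j + m ^ 2) := by
        refine Finset.sum_congr rfl fun j _ => ?_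
        rw [hww, linForce_add, Pi.add_apply, linForce_const]
        ring
      rw [this, Finset.sum_add_distrib, Finset.sum_sub_distrib, Finset.sum_sub_distrib,
        ← Finset.mul_sum, ← Finset.mul_sum]
      simp [ZMod.card]
    simp only [Pi.sub_apply]
    rw [h2, sum_linForce, hsum, hsq]
    nlinarith [sq_nonneg m, (by positivity : (0 : ℝ) ≤ N * m ^ 2)]

/-- Testing with the coercive partner and using Cauchy–Schwarz gives ‖w‖²/2 ≤ ‖w‖ ‖f‖, so the
inverse of the linear part has norm at most 2; the constant 4 is its square. -/
lemma sum_sq_le_of_range_eq {γ : ℝ} (hN : 4 ≤ N) (hγ : 3 / 4 * gammaOne N ≤ γ)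
    {w f : Config N} (hw1 : firstMode N w = 0)
    (h : ∀ g : Config N, firstMode N g = 0 → ∑ j, g j * (f j + linForce N γ w j) = 0) :
    ∑ j, w j ^ 2 ≤ 4 * ∑ j, f j ^ 2 := by
  obtain ⟨g, hg1, hg2, hg3⟩ := exists_coercive_test hN hγ hw1
  have h1 := h g hg1
  simp only [mul_add, Finset.sum_add_distrib] at h1
  have hcs := Finset.sum_mul_sq_le_sq_mul_sq Finset.univ g f
  rw [hg2] at hcs
  have hw0 : 0 ≤ ∑ j, w j ^ 2 := Finset.sum_nonneg fun i _ => sq_nonneg _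
  rcases hw0.eq_or_lt with h0 | h0
  · rw [← h0]; exact mul_nonneg (by norm_num) (Finset.sum_nonneg fun i _ => sq_nonneg _)
  · have h3 : 1 / 2 * ∑ j, w j ^ 2 ≤ -∑ j, g j * f j := by linarith
    have h4 : (1 / 2 * ∑ j, w j ^ 2) ^ 2 ≤ (∑ j, g j * f j) ^ 2 := by
      rw [← neg_sq (∑ j, g j * f j)]
      exact pow_le_pow_left₀ (by linarith) h3 2
    nlinarith

/-- The equation of the chain holds up to the first Fourier mode. -/
def SolvesComplement (N : ℕ) [NeZero N] (γ : ℝ) (x : Config N) : Prop :=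
  ∀ g : Config N, firstMode N g = 0 → ∑ j, g j * force N γ x j = 0

/-- Here `a` absorbs the critical part of the difference. It is invisible to the tested linear
equation, so what is left is controlled by the cubes alone. -/
lemma SolvesComplement.sub_bound {γ : ℝ} (hN : 4 ≤ N) (hγ : 3 / 4 * gammaOne N ≤ γ)
    {x y : Config N} (hx : SolvesComplement N γ x) (hy : SolvesComplement N γ y)
    {a : Config N} (hL : ∀ g : Config N, firstMode N g = 0 → ∑ j, g j * linForce N γ a j = 0)
    (hmode : firstMode N (x - y - a) = 0) :
    ∑ j, (x j - y j - a j) ^ 2 ≤ 4 * ∑ j, (x j ^ 3 - y j ^ 3) ^ 2 := by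
  refine sum_sq_le_of_range_eq (w := x - y - a) (f := fun j => x j ^ 3 - y j ^ 3) hN hγ hmode fun g hg => ?_
  have h1 := hx g hg
  have h2 := hy g hg
  have h3 := hL g hg
  have h4 : ∑ j, g j * (x j ^ 3 - y j ^ 3 + linForce N γ (x - y - a) j)
      = ∑ j, g j * force N γ x j - ∑ j, g j * force N γ y j - ∑ j, g j * linForce N γ a j := by
    rw [← Finset.sum_sub_distrib, ← Finset.sum_sub_distrib]
    refine Finset.sum_congr rfl fun j _ => ?_
    simp only [force, linForce_sub, Pi.sub_apply]
    ring
  rw [h1, h2, h3, sub_zero, sub_zero] at h4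
  exact h4

lemma sq_cube_sub_cube_le {a b e : ℝ} (ha : |a| ≤ e) (hb : |b| ≤ e) :
    (a ^ 3 - b ^ 3) ^ 2 ≤ (3 * e ^ 2) ^ 2 * (a - b) ^ 2 := by
  have h1 : a ^ 2 ≤ e ^ 2 := sq_le_sq' (by linarith [abs_le.1 ha]) (abs_le.1 ha).2
  have h2 : b ^ 2 ≤ e ^ 2 := sq_le_sq' (by linarith [abs_le.1 hb]) (abs_le.1 hb).2
  have h3 : (a ^ 2 + a * b + b ^ 2) ^ 2 ≤ (3 * e ^ 2) ^ 2 := by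
    refine sq_le_sq' ?_ ?_ <;> nlinarith [sq_nonneg (a - b), sq_nonneg (a + b)]
  calc (a ^ 3 - b ^ 3) ^ 2 = (a ^ 2 + a * b + b ^ 2) ^ 2 * (a - b) ^ 2 := by ring
    _ ≤ _ := mul_le_mul_of_nonneg_right h3 (sq_nonneg _)

lemma SolvesComplement.eq_of_firstMode_eq {γ : ℝ} (hN : 4 ≤ N) (hγ : 3 / 4 * gammaOne N ≤ γ)
    {x y : Config N} (hx : SolvesComplement N γ x) (hy : SolvesComplement N γ y)
    (hxe : ∀ j, |x j| ≤ 1 / 4) (hye : ∀ j, |y j| ≤ 1 / 4)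
    (hmode : firstMode N x = firstMode N y) : x = y := by
  have h := hx.sub_bound hN hγ hy (a := 0) (fun g _ => by simp [linForce])
    (by rw [sub_zero, map_sub, hmode, sub_self])
  -- On |ξ| ≤ 1/4 the cube has Lipschitz constant 3/16. Together with the factor 4 this contracts,
  -- as 4 · 9/256 < 1.
  have h2 : ∑ j, (x j ^ 3 - y j ^ 3) ^ 2 ≤ 9 / 256 * ∑ j, (x j - y j) ^ 2 := by
    rw [Finset.mul_sum]
    refine Finset.sum_le_sum fun j _ => (sq_cube_sub_cube_le (hxe j) (hye j)).trans_eq ?_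
    norm_num
  simp only [Pi.zero_apply, sub_zero] at h
  have h0 : 0 ≤ ∑ j, (x j - y j) ^ 2 := Finset.sum_nonneg fun i _ => sq_nonneg _
  have h3 : ∑ j, (x j - y j) ^ 2 = 0 := by linarith
  rw [Finset.sum_eq_zero_iff_of_nonneg fun i _ => sq_nonneg _] at h3
  funext j
  have := h3 j (Finset.mem_univ j)
  nlinarith [pow_eq_zero_iff (two_ne_zero) |>.1 this]

end

/-! ### A priori bound on non-synchronised stationary points. -/

section
set_option linter.unusedSectionVars false
variable {N : ℕ} [NeZero N]

lemma gamma_mul_half_gap {γ : ℝ} (hN : 4 ≤ N) :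
    γ / 2 * (2 - 2 * Real.cos (2 * Real.pi / N)) = γ / gammaOne N := by
  have h := gammaOne_mul hN
  have h1 := one_le_gammaOne hN
  rw [eq_div_iff (by linarith)]
  linear_combination γ * h

/-- Subtracting the equations at neighbouring sites gives Ly = −qy for the increments y, with q the
quotient of the difference of cubes. As y has mean zero, the Poincaré inequality bounds ⟨Ly, y⟩
below by (γ/γ₁ − 1)‖y‖². -/
lemma sum_diff_sq_le_of_force_eq_zero {γ : ℝ} (hN : 4 ≤ N) (hγ : 0 ≤ γ) {x : Config N}
    (hx : force N γ x = 0) :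
    ∑ i, (x (i + 1) ^ 2 + x (i + 1) * x i + x i ^ 2) * (x (i + 1) - x i) ^ 2
      ≤ (1 - γ / gammaOne N) * ∑ i, (x (i + 1) - x i) ^ 2 := by
  set y : Config N := fun i => x (i + 1) - x i with hy
  have hLy : ∀ i, linForce N γ y i
      = -((x (i + 1) ^ 2 + x (i + 1) * x i + x i ^ 2) * y i) := by
    intro i
    have h1 := congrFun hx (i + 1)
    have h2 := congrFun hx i
    simp only [force, linForce, Pi.zero_apply, add_sub_cancel_right] at h1 h2
    simp only [hy, linForce, sub_add_cancel]
    linear_combination h1 - h2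
  have hsum : ∑ i, y i = 0 := by simp [hy, Finset.sum_sub_distrib, sum_shift]
  have h1 := sum_linForce_mul γ y y
  have h2 := mul_le_mul_of_nonneg_left (gap_one_le hsum) (by linarith : 0 ≤ γ / 2)
  rw [← mul_assoc, gamma_mul_half_gap hN] at h2
  have h3 : ∑ i, linForce N γ y i * y i
      = -∑ i, (x (i + 1) ^ 2 + x (i + 1) * x i + x i ^ 2) * y i ^ 2 := by
    rw [← Finset.sum_neg_distrib]
    exact Finset.sum_congr rfl fun i _ => by rw [hLy]; ring
  simp only [← pow_two] at h1
  show ∑ i, (x (i + 1) ^ 2 + x (i + 1) * x i + x i ^ 2) * y i ^ 2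
      ≤ (1 - γ / gammaOne N) * ∑ i, y i ^ 2
  nlinarith

lemma abs_sub_le_of_abs_diff_le {x : Config N} {M : ℝ} (h : ∀ i, |x (i + 1) - x i| ≤ M)
    (i j : ZMod N) : |x j - x i| ≤ N * M := by
  have h0 : 0 ≤ M := (abs_nonneg _).trans (h 0)
  have key : ∀ k : ℕ, |x (i + k) - x i| ≤ k * M := by
    intro k
    induction k with
    | zero => simp
    | succ k ih =>
      have := abs_sub_le (x (i + (k + 1 : ℕ))) (x (i + k)) (x i)
      have h2 := h (i + k)
      rw [Nat.cast_succ, ← add_assoc] at this ⊢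
      push_cast
      linarith
  have h2 := key (j - i).val
  rw [ZMod.natCast_zmod_val, add_sub_cancel] at h2
  refine h2.trans ?_
  gcongr
  exact (ZMod.val_lt _).le

/-- The average of q with weights y² is at most η. At the site of the largest increment q ≥ y²/4,
which bounds all increments by O(√η). At some site q ≤ η, so x itself is O(√η) there, and walking at
most N steps reaches every other site. -/
lemma sq_le_of_force_eq_zero {γ : ℝ} (hN : 4 ≤ N) (hγ : 0 ≤ γ) (hγ1 : γ ≤ gammaOne N)
    {x : Config N} (hx : force N γ x = 0) (h0 : x ≠ 0) (h1 : x ≠ syncPlus N)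
    (h2 : x ≠ -syncPlus N) (j : ZMod N) :
    x j ^ 2 ≤ (4 + 8 * N ^ 3) * (1 - γ / gammaOne N) := by
  have hg1 := one_le_gammaOne hN
  set η := 1 - γ / gammaOne N with hη
  have hη0 : 0 ≤ η := by
    rw [hη, sub_nonneg, div_le_one (by linarith)]; exact hγ1
  have hmain := sum_diff_sq_le_of_force_eq_zero hN hγ hx
  rw [← hη] at hmain
  set q : ZMod N → ℝ := fun i => x (i + 1) ^ 2 + x (i + 1) * x i + x i ^ 2 with hq
  have hqy : ∀ i, (x (i + 1) - x i) ^ 2 / 4 ≤ q i := fun i => by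
    simp only [hq]; nlinarith [sq_nonneg (x (i + 1) + x i)]
  obtain ⟨m, -, hm⟩ := Finset.exists_max_image Finset.univ (fun i => |x (i + 1) - x i|)
    ⟨0, Finset.mem_univ _⟩
  set M := |x (m + 1) - x m| with hM
  have hyM : ∀ i, |x (i + 1) - x i| ≤ M := fun i => hm i (Finset.mem_univ i)
  have hM0 : 0 ≤ M := abs_nonneg _
  have hMsq : M ^ 2 = (x (m + 1) - x m) ^ 2 := sq_abs _
  have hclose := abs_sub_le_of_abs_diff_le hyM
  rcases hM0.eq_or_lt with hM0 | hM0
  · exfalso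
    have hconst : ∀ i, x i = x 0 := fun i => by
      have := hclose 0 i
      rw [← hM0, mul_zero] at this
      linarith [abs_nonpos_iff.1 this]
    have hF := congrFun hx 0
    simp only [force, linForce, hconst, Pi.zero_apply] at hF
    have : x 0 * ((x 0 - 1) * (x 0 + 1)) = 0 := by
      have h3 := hconst (0 + 1)
      have h4 := hconst (0 - 1)
      linear_combination hF
    rcases mul_eq_zero.1 this with h | h
    · exact h0 (funext fun i => by rw [hconst, h]; rfl)
    rcases mul_eq_zero.1 h with h | h
    · exact h1 (funext fun i => by rw [hconst, sub_eq_zero.1 h]; rfl)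
    · exact h2 (funext fun i => by rw [hconst, eq_neg_of_add_eq_zero_left h]; rfl)
  · have hle1 : q m * (x (m + 1) - x m) ^ 2 ≤ ∑ i, q i * (x (i + 1) - x i) ^ 2 :=
      Finset.single_le_sum (f := fun i => q i * (x (i + 1) - x i) ^ 2)
        (fun i _ => mul_nonneg ((by positivity : (0:ℝ) ≤ _).trans (hqy i)) (sq_nonneg _))
        (Finset.mem_univ m)
    have hle2 : ∑ i, (x (i + 1) - x i) ^ 2 ≤ N * M ^ 2 := by
      refine (Finset.sum_le_sum fun i _ => ?_).trans_eq
        (by rw [Finset.sum_const, Finset.card_univ, ZMod.card, nsmul_eq_mul])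
      rw [← sq_abs (x (i + 1) - x i)]
      exact pow_le_pow_left₀ (abs_nonneg _) (hyM i) 2
    have hM2 : M ^ 2 ≤ 4 * N * η := by
      have h5 : M ^ 2 / 4 * M ^ 2 ≤ (N * η) * M ^ 2 := by
        have h6 := mul_le_mul_of_nonneg_right (hqy m) (sq_nonneg (x (m + 1) - x m))
        rw [hMsq]
        rw [hMsq] at hle2
        nlinarith [mul_le_mul_of_nonneg_left hle2 hη0]
      have := le_of_mul_le_mul_right h5 (by positivity)
      linarith
    have hi : ∃ i, q i ≤ η := by
      by_contra! hcon
      have : η * ∑ i, (x (i + 1) - x i) ^ 2 < ∑ i, q i * (x (i + 1) - x i) ^ 2 := by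
        rw [Finset.mul_sum]
        refine Finset.sum_lt_sum
          (fun i _ => mul_le_mul_of_nonneg_right (hcon i).le (sq_nonneg _))
          ⟨m, Finset.mem_univ m, mul_lt_mul_of_pos_right (hcon m) ?_⟩
        rw [← hMsq]; positivity
      linarith
    obtain ⟨i, hi⟩ := hi
    have hxi : x i ^ 2 ≤ 2 * η := by
      simp only [hq] at hi
      nlinarith [sq_nonneg (x (i + 1) + x i), sq_nonneg (x (i + 1))]
    have hji : (x j - x i) ^ 2 ≤ N ^ 2 * M ^ 2 := by
      rw [← sq_abs, ← mul_pow]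
      exact pow_le_pow_left₀ (abs_nonneg _) (hclose i j) 2
    have hN2 : (N : ℝ) ^ 2 * M ^ 2 ≤ N ^ 2 * (4 * N * η) :=
      mul_le_mul_of_nonneg_left hM2 (by positivity)
    -- Uses xⱼ² ≤ 2xᵢ² + 2(xⱼ − xᵢ)², so the constant is 2 · 2 + 2 · 4N³.
    nlinarith [sq_nonneg (x j - 2 * x i)]

end

/-! ### Laurent polynomials in the phase, with the ℓ¹ norm of coefficients. -/

open LaurentPolynomial
open Finset.HasAntidiagonal (antidiagonal)

section LaurentNorm

/-- Sum of the absolute values of the coefficients of a Laurent polynomial. -/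
def coeffNorm (p : ℝ[T;T⁻¹]) : ℝ := ∑ k ∈ p.coeff.support, |p.coeff k|

lemma coeffNorm_nonneg (p : ℝ[T;T⁻¹]) : 0 ≤ coeffNorm p :=
  Finset.sum_nonneg fun _ _ => abs_nonneg _

lemma coeffNorm_eq_sum {p : ℝ[T;T⁻¹]} {s : Finset ℤ} (h : p.coeff.support ⊆ s) :
    coeffNorm p = ∑ k ∈ s, |p.coeff k| :=
  Finset.sum_subset h fun k _ hk => by rw [Finsupp.notMem_support_iff.1 hk, abs_zero]

lemma coeffNorm_zero : coeffNorm 0 = 0 := by simp [coeffNorm]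

lemma coeffNorm_neg (p : ℝ[T;T⁻¹]) : coeffNorm (-p) = coeffNorm p := by
  simp [coeffNorm]

lemma coeffNorm_add_le (p q : ℝ[T;T⁻¹]) : coeffNorm (p + q) ≤ coeffNorm p + coeffNorm q := by
  classical
  rw [coeffNorm_eq_sum (p := p) (s := p.coeff.support ∪ q.coeff.support) Finset.subset_union_left,
    coeffNorm_eq_sum (p := q) (s := p.coeff.support ∪ q.coeff.support) Finset.subset_union_right,
    coeffNorm_eq_sum (p := p + q) (s := p.coeff.support ∪ q.coeff.support)
      (by rw [AddMonoidAlgebra.coeff_add]; exact Finsupp.support_add), ← Finset.sum_add_distrib]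
  refine Finset.sum_le_sum fun k _ => ?_
  rw [AddMonoidAlgebra.coeff_add, Finsupp.add_apply]
  exact abs_add_le _ _

lemma coeffNorm_sum_le {ι : Type*} (s : Finset ι) (f : ι → ℝ[T;T⁻¹]) :
    coeffNorm (∑ i ∈ s, f i) ≤ ∑ i ∈ s, coeffNorm (f i) := by
  classical
  induction s using Finset.induction_on with
  | empty => simp [coeffNorm_zero]
  | insert a s ha ih =>
    rw [Finset.sum_insert ha, Finset.sum_insert ha]
    exact (coeffNorm_add_le _ _).trans (by gcongr)

lemma coeffNorm_C_mul_T (a : ℝ) (n : ℤ) : coeffNorm (C a * T n) = |a| := by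
  have h : (AddMonoidAlgebra.single n a : ℝ[T;T⁻¹]).coeff.support ⊆ {n} := by
    rw [AddMonoidAlgebra.coeff_single]; exact Finsupp.support_single_subset
  rw [← single_eq_C_mul_T, coeffNorm_eq_sum h, Finset.sum_singleton,
    AddMonoidAlgebra.coeff_single, Finsupp.single_eq_same]

lemma eq_sum_C_mul_T (p : ℝ[T;T⁻¹]) :
    p = ∑ k ∈ p.coeff.support, C (p.coeff k) * T k := by
  ext n
  rw [AddMonoidAlgebra.coeff_sum, Finsupp.finsetSum_apply]
  simp only [← single_eq_C_mul_T, AddMonoidAlgebra.coeff_single, Finsupp.single_apply]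
  rw [Finset.sum_ite_eq']
  split_ifs with h
  · rfl
  · exact Finsupp.notMem_support_iff.1 h

lemma coeffNorm_mul_le (p q : ℝ[T;T⁻¹]) : coeffNorm (p * q) ≤ coeffNorm p * coeffNorm q := by
  have h : p * q = ∑ k ∈ p.coeff.support, ∑ m ∈ q.coeff.support,
      C (p.coeff k * q.coeff m) * T (k + m) := by
    conv_lhs => rw [eq_sum_C_mul_T p, eq_sum_C_mul_T q]
    rw [Finset.sum_mul_sum]
    refine Finset.sum_congr rfl fun k _ => Finset.sum_congr rfl fun m _ => ?_
    rw [T_add, map_mul]; ring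
  rw [h]
  refine (coeffNorm_sum_le _ _).trans ?_
  rw [coeffNorm, Finset.sum_mul]
  refine Finset.sum_le_sum fun k _ => (coeffNorm_sum_le _ _).trans_eq ?_
  rw [coeffNorm, Finset.mul_sum]
  exact Finset.sum_congr rfl fun m _ => by rw [coeffNorm_C_mul_T, abs_mul]

lemma coeff_mul_eq_sum (p q : ℝ[T;T⁻¹]) (n : ℤ) :
    (p * q).coeff n = ∑ i ∈ p.coeff.support, p.coeff i * q.coeff (n - i) := by
  rw [AddMonoidAlgebra.coeff_mul, Finsupp.sum]
  refine Finset.sum_congr rfl fun i _ => ?_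
  rw [Finsupp.sum]
  have : ∀ j, (i + j = n) = (j = n - i) := fun j => by rw [eq_sub_iff_add_eq', eq_iff_iff]
  simp only [this]
  rw [Finset.sum_ite_eq']
  split_ifs with h
  · rfl
  · rw [Finsupp.notMem_support_iff.1 h, mul_zero]

/-- All exponents of the Laurent polynomial are at most `d` in absolute value. -/
def DegLE (p : ℝ[T;T⁻¹]) (d : ℕ) : Prop := ∀ k : ℤ, (d : ℤ) < |k| → p.coeff k = 0

lemma DegLE.mul {p q : ℝ[T;T⁻¹]} {a b : ℕ} (hp : DegLE p a) (hq : DegLE q b) :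
    DegLE (p * q) (a + b) := by
  intro n hn
  rw [coeff_mul_eq_sum]
  refine Finset.sum_eq_zero fun i _ => ?_
  by_cases hi : (a : ℤ) < |i|
  · rw [hp i hi, zero_mul]
  · rw [hq (n - i), mul_zero]
    have := abs_sub_abs_le_abs_sub n i
    push_cast at hn
    omega

lemma DegLE.add {p q : ℝ[T;T⁻¹]} {a : ℕ} (hp : DegLE p a) (hq : DegLE q a) :
    DegLE (p + q) a := fun n hn => by
  rw [AddMonoidAlgebra.coeff_add, Finsupp.add_apply, hp n hn, hq n hn, add_zero]

lemma DegLE.sum {ι : Type*} {s : Finset ι} {f : ι → ℝ[T;T⁻¹]} {a : ℕ}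
    (h : ∀ i ∈ s, DegLE (f i) a) : DegLE (∑ i ∈ s, f i) a := fun n hn => by
  rw [AddMonoidAlgebra.coeff_sum, Finsupp.finsetSum_apply]
  exact Finset.sum_eq_zero fun i hi => h i hi n hn

lemma DegLE.coeff_mul_top {p q : ℝ[T;T⁻¹]} {a b : ℕ} (hp : DegLE p a) (hq : DegLE q b) :
    (p * q).coeff ((a + b : ℕ) : ℤ) = p.coeff a * q.coeff b := by
  rw [coeff_mul_eq_sum, Finset.sum_eq_single (a : ℤ)]
  · push_cast; rw [add_sub_cancel_left]
  · intro i _ hi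
    rcases lt_or_gt_of_ne hi with h | h
    · rw [hq, mul_zero]
      rw [abs_of_pos] <;> push_cast <;> omega
    · rw [hp i (h.trans_le (le_abs_self i)), zero_mul]
  · intro h
    rw [Finsupp.notMem_support_iff.1 h, zero_mul]

/-- Multiplication of the coefficients by a sequence. -/
def diag (m : ℤ → ℝ) (p : ℝ[T;T⁻¹]) : ℝ[T;T⁻¹] :=
  .ofCoeff (Finsupp.onFinset p.coeff.support (fun k => m k * p.coeff k) fun _ hk =>
    Finsupp.mem_support_iff.2 (right_ne_zero_of_mul hk))

lemma diag_coeff (m : ℤ → ℝ) (p : ℝ[T;T⁻¹]) (k : ℤ) :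
    (diag m p).coeff k = m k * p.coeff k := rfl

lemma diag_support_subset (m : ℤ → ℝ) (p : ℝ[T;T⁻¹]) :
    (diag m p).coeff.support ⊆ p.coeff.support := fun k hk => by
  rw [Finsupp.mem_support_iff, diag_coeff] at hk
  exact Finsupp.mem_support_iff.2 (right_ne_zero_of_mul hk)

lemma DegLE.diag {p : ℝ[T;T⁻¹]} {d : ℕ} (hp : DegLE p d) (m : ℤ → ℝ) :
    DegLE (CoupledChain.diag m p) d := fun k hk => by rw [diag_coeff, hp k hk, mul_zero]

lemma coeffNorm_diag_le {m : ℤ → ℝ} {b : ℝ} (hm : ∀ k, |m k| ≤ b) (p : ℝ[T;T⁻¹]) :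
    coeffNorm (diag m p) ≤ b * coeffNorm p := by
  rw [coeffNorm_eq_sum (diag_support_subset m p), coeffNorm, Finset.mul_sum]
  refine Finset.sum_le_sum fun k _ => ?_
  rw [diag_coeff, abs_mul]
  exact mul_le_mul_of_nonneg_right (hm k) (abs_nonneg _)

lemma invert_diag {m : ℤ → ℝ} (hm : ∀ k, m (-k) = m k) (p : ℝ[T;T⁻¹]) :
    invert (diag m p) = diag m (invert p) := by
  ext k
  rw [invert_apply, diag_coeff, diag_coeff, invert_apply, hm]

/-- Evaluation of a real Laurent polynomial on the unit circle. -/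
def circleEval (z : Circle) : ℝ[T;T⁻¹] →+* ℂ := eval₂ (algebraMap ℝ ℂ) (Circle.toUnits z)

lemma circleEval_C_mul_T (z : Circle) (a : ℝ) (k : ℤ) :
    circleEval z (C a * T k) = a * (z : ℂ) ^ k := by
  rw [circleEval, eval₂_C_mul_T]
  simp

lemma circleEval_eq_sum {p : ℝ[T;T⁻¹]} {s : Finset ℤ} (h : p.coeff.support ⊆ s) (z : Circle) :
    circleEval z p = ∑ k ∈ s, p.coeff k * (z : ℂ) ^ k := by
  conv_lhs => rw [eq_sum_C_mul_T p]
  rw [map_sum]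
  simp only [circleEval_C_mul_T]
  exact Finset.sum_subset h fun k _ hk => by
    rw [Finsupp.notMem_support_iff.1 hk]; simp

lemma norm_circleEval_le (z : Circle) (p : ℝ[T;T⁻¹]) : ‖circleEval z p‖ ≤ coeffNorm p := by
  rw [circleEval_eq_sum subset_rfl]
  refine norm_sum_le_of_le _ fun k _ => ?_
  rw [norm_mul, norm_zpow, Circle.norm_coe, one_zpow, mul_one, Complex.norm_real, Real.norm_eq_abs]

lemma circleEval_inv (z : Circle) (p : ℝ[T;T⁻¹]) :
    circleEval z⁻¹ p = (starRingEnd ℂ) (circleEval z p) := by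
  rw [circleEval_eq_sum subset_rfl, circleEval_eq_sum subset_rfl, map_sum]
  refine Finset.sum_congr rfl fun k _ => ?_
  rw [Circle.coe_inv_eq_conj, map_mul, map_zpow₀, Complex.conj_ofReal]

lemma circleEval_invert (z : Circle) (p : ℝ[T;T⁻¹]) :
    circleEval z (invert p) = circleEval z⁻¹ p := by
  conv_rhs => rw [eq_sum_C_mul_T p]
  conv_lhs => rw [eq_sum_C_mul_T p]
  rw [map_sum, map_sum, map_sum]
  refine Finset.sum_congr rfl fun k _ => ?_
  rw [map_mul, invert_C, invert_T, circleEval_C_mul_T, circleEval_C_mul_T, Circle.coe_inv,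
    zpow_neg, inv_zpow]

/-- On the circle inverting z is conjugation, so invariance under inversion makes the value real. -/
lemma circleEval_im_of_invert {p : ℝ[T;T⁻¹]} (h : invert p = p) (z : Circle) :
    (circleEval z p).im = 0 := by
  rw [← Complex.conj_eq_iff_im, ← circleEval_inv, ← circleEval_invert, h]

end LaurentNorm

/-! ### Cubes of power series. -/

section CubeCoeff

variable {R : Type*} [CommSemiring R]

/-- The coefficients of the cube of a power series. -/
def cubeCoeff (f : ℕ → R) (d : ℕ) : R :=
  ∑ p ∈ antidiagonal d, (∑ q ∈ antidiagonal p.1, f q.1 * f q.2) * f p.2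

/-- Without a constant term, only indices below d contribute to degree d of the cube. The sum over
`Fin d` makes the recursion of `branchCoeff` well founded; the nested antidiagonals match the Cauchy
product. -/
lemma sum_fin_eq_cubeCoeff {f : ℕ → R} (hf : f 0 = 0) (d : ℕ) :
    ∑ i : Fin d, ∑ j : Fin d, ∑ l : Fin d,
      (if (i : ℕ) + j + l = d then f i * f j * f l else 0) = cubeCoeff f d := by
  have h1 : ∑ i : Fin d, ∑ j : Fin d, ∑ l : Fin d,
      (if (i : ℕ) + j + l = d then f i * f j * f l else 0)
      = ∑ t ∈ (Finset.range d ×ˢ Finset.range d ×ˢ Finset.range d).filter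
          (fun t => t.1 + t.2.1 + t.2.2 = d), f t.1 * f t.2.1 * f t.2.2 := by
    rw [Finset.sum_filter, Finset.sum_product, ← Fin.sum_univ_eq_sum_range
      (fun i => ∑ y ∈ Finset.range d ×ˢ Finset.range d,
        if i + y.1 + y.2 = d then f i * f y.1 * f y.2 else 0)]
    refine Finset.sum_congr rfl fun i _ => ?_
    rw [Finset.sum_product, ← Fin.sum_univ_eq_sum_range
      (fun j => ∑ y ∈ Finset.range d, if (i : ℕ) + j + y = d then f i * f j * f y else 0)]
    refine Finset.sum_congr rfl fun j _ => ?_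
    rw [← Fin.sum_univ_eq_sum_range
      (fun y => if (i : ℕ) + j + y = d then f i * f j * f y else 0)]
  have h2 : cubeCoeff f d = ∑ t ∈ (antidiagonal d).sigma
      (fun p => antidiagonal p.1), f t.2.1 * f t.2.2 * f t.1.2 := by
    rw [cubeCoeff, Finset.sum_sigma]
    exact Finset.sum_congr rfl fun p _ => Finset.sum_mul ..
  rw [h1, h2]
  refine Finset.sum_bij_ne_zero
    (fun t _ _ => ⟨(t.1 + t.2.1, t.2.2), (t.1, t.2.1)⟩) ?_ ?_ ?_ ?_
  · rintro ⟨a, b, c⟩ h _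
    simp at h ⊢
    omega
  · rintro ⟨a, b, c⟩ h _ ⟨a', b', c'⟩ h' _ heq
    simp at heq
    obtain ⟨⟨_, h3⟩, h4⟩ := heq
    simp_all
  · rintro ⟨⟨a, b⟩, ⟨c, e⟩⟩ h hne
    simp at h
    have hb : b ≠ 0 := by rintro rfl; simp [hf] at hne
    have hc : c ≠ 0 := by rintro rfl; simp [hf] at hne
    have he : e ≠ 0 := by rintro rfl; simp [hf] at hne
    obtain ⟨h1, h2⟩ := h
    subst h2
    refine ⟨(c, e, b), ?_, hne, rfl⟩
    simp
    omega
  · rintro ⟨a, b, c⟩ h _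
    rfl

lemma map_cubeCoeff {S : Type*} [CommSemiring S] (φ : R →+* S) (f : ℕ → R) (d : ℕ) :
    φ (cubeCoeff f d) = cubeCoeff (fun i => φ (f i)) d := by
  simp [cubeCoeff]

lemma cubeCoeff_mul_pow (f : ℕ → R) (r : R) (d : ℕ) :
    cubeCoeff (fun i => f i * r ^ i) d = cubeCoeff f d * r ^ d := by
  rw [cubeCoeff, cubeCoeff, Finset.sum_mul]
  refine Finset.sum_congr rfl fun p hp => ?_
  rw [← Finset.HasAntidiagonal.mem_antidiagonal.1 hp, Finset.sum_mul, Finset.sum_mul, Finset.sum_mul]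
  refine Finset.sum_congr rfl fun q hq => ?_
  rw [← Finset.HasAntidiagonal.mem_antidiagonal.1 hq]
  ring

end CubeCoeff

section CubeSeries

variable {R : Type*} [NormedCommRing R]

lemma summable_norm_cubeCoeff {f : ℕ → R} (hf : Summable fun i => ‖f i‖) :
    Summable fun d => ‖cubeCoeff f d‖ := by
  have h := summable_norm_sum_mul_antidiagonal_of_summable_norm hf hf
  exact summable_norm_sum_mul_antidiagonal_of_summable_norm
    (f := fun n => ∑ q ∈ antidiagonal n, f q.1 * f q.2) h hf

lemma tsum_cubeCoeff [CompleteSpace R] {f : ℕ → R} (hf : Summable fun i => ‖f i‖) :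
    ∑' d, cubeCoeff f d = (∑' d, f d) ^ 3 := by
  rw [pow_succ, pow_two, tsum_mul_tsum_eq_tsum_sum_antidiagonal_of_summable_norm hf hf,
    tsum_mul_tsum_eq_tsum_sum_antidiagonal_of_summable_norm
      (summable_norm_sum_mul_antidiagonal_of_summable_norm hf hf) hf]
  rfl

end CubeSeries

/-! ### The power series of the branch: recursion, degrees, convergence. -/

section
set_option linter.unusedSectionVars false
variable {N : ℕ} [NeZero N]

/-- Eigenvalue of the linear part of the force on the `k`-th Fourier mode. -/
def dispersion (N : ℕ) [NeZero N] (γ : ℝ) (k : ℤ) : ℝ :=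
  γ * (1 - (toCircle (k : ZMod N) : ℂ).re) - 1

/-- The modes which agree on the lattice with one of the two critical modes. -/
def Resonant (N : ℕ) (k : ℤ) : Prop := (k : ZMod N) = 1 ∨ (k : ZMod N) = -1

open Classical in
/-- Multiplier inverting the linear part of the force away from the critical modes. -/
def resolvent (N : ℕ) [NeZero N] (γ : ℝ) (k : ℤ) : ℝ :=
  if Resonant N k then 0 else (dispersion N γ k)⁻¹

/-- Coefficients, as trigonometric polynomials in the phase, of the expansion in the amplitude
of the solution of the equations on the complement of the critical modes. -/
def branchCoeff (N : ℕ) [NeZero N] (γ : ℝ) (d : ℕ) : ℝ[T;T⁻¹] :=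
  (if d = 1 then T 1 + T (-1) else 0) -
    diag (resolvent N γ) (∑ i : Fin d, ∑ j : Fin d, ∑ l : Fin d,
      if (i : ℕ) + j + l = d then
        branchCoeff N γ i * branchCoeff N γ j * branchCoeff N γ l else 0)
termination_by d

lemma diag_zero (m : ℤ → ℝ) : diag m 0 = 0 := by
  ext k; rw [diag_coeff]; simp

lemma branchCoeff_zero (γ : ℝ) : branchCoeff N γ 0 = 0 := by
  rw [branchCoeff]
  simp [diag_zero]

/-- This is the degree-d part of the fixed-point equation x = r(T + T⁻¹) − L⁻¹x³ on the complement.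
The resolvent vanishes on resonant modes, so the critical component never changes beyond degree one.
-/
lemma branchCoeff_eq (γ : ℝ) (d : ℕ) :
    branchCoeff N γ d = (if d = 1 then T 1 + T (-1) else 0) -
      diag (resolvent N γ) (cubeCoeff (branchCoeff N γ) d) := by
  rw [← sum_fin_eq_cubeCoeff (branchCoeff_zero γ)]
  conv_lhs => rw [branchCoeff]

lemma resonant_neg {k : ℤ} : Resonant N (-k) ↔ Resonant N k := by
  simp only [Resonant, Int.cast_neg, neg_eq_iff_eq_neg, neg_neg]
  exact or_comm

lemma dispersion_neg (γ : ℝ) (k : ℤ) : dispersion N γ (-k) = dispersion N γ k := by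
  simp only [dispersion, Int.cast_neg, ← conj_toCircle, Complex.conj_re]

lemma resolvent_neg (γ : ℝ) (k : ℤ) : resolvent N γ (-k) = resolvent N γ k := by
  by_cases h : Resonant N k
  · rw [resolvent, resolvent, if_pos h, if_pos (resonant_neg.2 h)]
  · rw [resolvent, resolvent, if_neg h, if_neg (mt resonant_neg.1 h), dispersion_neg]

lemma half_le_dispersion {γ : ℝ} (hN : 4 ≤ N) (hγ : 3 / 4 * gammaOne N ≤ γ) {k : ℤ}
    (hk : ¬ Resonant N k) (hk0 : (k : ZMod N) ≠ 0) : 1 / 2 ≤ dispersion N γ k := by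
  simp only [Resonant, not_or] at hk
  have h1 := toCircle_re_le_of_ne hk0 hk.1 hk.2
  have h2 := half_le_gap hN hγ
  have h3 : 0 ≤ γ := by linarith [one_le_gammaOne hN]
  have h4 := mul_le_mul_of_nonneg_left h1 h3
  simp only [dispersion]
  linarith

lemma dispersion_of_cast_eq_zero (γ : ℝ) {k : ℤ} (hk : (k : ZMod N) = 0) :
    dispersion N γ k = -1 := by
  simp [dispersion, hk]

lemma dispersion_ne_zero {γ : ℝ} (hN : 4 ≤ N) (hγ : 3 / 4 * gammaOne N ≤ γ) {k : ℤ}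
    (hk : ¬ Resonant N k) : dispersion N γ k ≠ 0 := by
  by_cases hk0 : (k : ZMod N) = 0
  · rw [dispersion_of_cast_eq_zero γ hk0]; norm_num
  · have := half_le_dispersion hN hγ hk hk0
    linarith

lemma abs_resolvent_le {γ : ℝ} (hN : 4 ≤ N) (hγ : 3 / 4 * gammaOne N ≤ γ) (k : ℤ) :
    |resolvent N γ k| ≤ 2 := by
  rw [resolvent]
  split_ifs with h
  · simp
  by_cases hk0 : (k : ZMod N) = 0
  · rw [dispersion_of_cast_eq_zero γ hk0]; norm_num
  · have h1 := half_le_dispersion hN hγ h hk0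
    rw [abs_of_pos (by positivity), inv_le_comm₀ (by linarith) (by norm_num)]
    linarith

lemma branchCoeff_one (γ : ℝ) : branchCoeff N γ 1 = T 1 + T (-1) := by
  rw [branchCoeff_eq, if_pos rfl]
  have : cubeCoeff (branchCoeff N γ) 1 = 0 := by
    refine Finset.sum_eq_zero fun p hp => ?_
    rw [Finset.HasAntidiagonal.mem_antidiagonal] at hp
    by_cases h2 : p.2 = 0
    · rw [h2, branchCoeff_zero, mul_zero]
    · rw [Finset.sum_eq_zero, zero_mul]
      intro q hq
      rw [Finset.HasAntidiagonal.mem_antidiagonal] at hq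
      rw [show q.1 = 0 by omega, branchCoeff_zero, zero_mul]
  rw [this, diag_zero, sub_zero]

lemma cubeCoeff_mem_of_lt {P : ℕ → ℝ[T;T⁻¹] → Prop} {f : ℕ → ℝ[T;T⁻¹]} (hf : f 0 = 0)
    {d : ℕ} (h0 : P d 0) (hadd : ∀ p q, P d p → P d q → P d (p + q))
    (hmul : ∀ i < d, ∀ j < d, ∀ l < d, i + j + l = d → P d (f i * f j * f l)) :
    P d (cubeCoeff f d) := by
  rw [← sum_fin_eq_cubeCoeff hf]
  refine Finset.sum_induction _ _ hadd h0 fun i _ => ?_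
  refine Finset.sum_induction _ _ hadd h0 fun j _ => ?_
  refine Finset.sum_induction _ _ hadd h0 fun l _ => ?_
  split_ifs with h
  · exact hmul i i.2 j j.2 l l.2 h
  · exact h0

lemma degLE_zero (d : ℕ) : DegLE 0 d := fun _ _ => rfl

lemma DegLE.neg {p : ℝ[T;T⁻¹]} {d : ℕ} (hp : DegLE p d) : DegLE (-p) d := fun n hn => by
  rw [AddMonoidAlgebra.coeff_neg, Finsupp.neg_apply, hp n hn, neg_zero]

lemma branchCoeff_degLE (γ : ℝ) (d : ℕ) : DegLE (branchCoeff N γ d) d := by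
  induction d using Nat.strong_induction_on with
  | _ d ih =>
    rw [branchCoeff_eq, sub_eq_add_neg]
    refine DegLE.add ?_ (DegLE.neg (DegLE.diag ?_ _))
    · split_ifs with h
      · subst h
        intro k hk
        rw [AddMonoidAlgebra.coeff_add, Finsupp.add_apply, T_apply, T_apply, if_neg, if_neg,
          add_zero]
        · rintro rfl; simp at hk
        · rintro rfl; simp at hk
      · exact degLE_zero d
    · refine cubeCoeff_mem_of_lt (P := fun d p => DegLE p d) (branchCoeff_zero γ) (degLE_zero d)
        (fun p q => DegLE.add) fun i hi j hj l hl h => ?_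
      have := ((ih i hi).mul (ih j hj)).mul (ih l hl)
      rwa [h] at this

lemma cubeCoeff_branchCoeff_degLE (γ : ℝ) (d : ℕ) :
    DegLE (cubeCoeff (branchCoeff N γ) d) d :=
  cubeCoeff_mem_of_lt (P := fun d p => DegLE p d) (branchCoeff_zero γ) (degLE_zero d)
    (fun p q => DegLE.add) fun i _ j _ l _ h => by
      have := ((branchCoeff_degLE (N := N) γ i).mul (branchCoeff_degLE (N := N) γ j)).mul
        (branchCoeff_degLE (N := N) γ l)
      rwa [h] at this

lemma invert_branchCoeff (γ : ℝ) (d : ℕ) : invert (branchCoeff N γ d) = branchCoeff N γ d := by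
  induction d using Nat.strong_induction_on with
  | _ d ih =>
    have h : invert (cubeCoeff (branchCoeff N γ) d) = cubeCoeff (branchCoeff N γ) d := by
      refine cubeCoeff_mem_of_lt (P := fun _ p => invert p = p) (branchCoeff_zero γ) (map_zero _)
        (fun p q hp hq => by rw [map_add, hp, hq]) fun i hi j hj l hl _ => ?_
      rw [map_mul, map_mul, ih i hi, ih j hj, ih l hl]
    rw [branchCoeff_eq, map_sub, invert_diag (resolvent_neg γ), h]
    congr 1
    split_ifs
    · rw [map_add, invert_T, invert_T, neg_neg, add_comm]
    · exact map_zero _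

lemma coeff_branchCoeff_of_resonant (γ : ℝ) {d : ℕ} (hd : d ≠ 1) {k : ℤ} (hk : Resonant N k) :
    (branchCoeff N γ d).coeff k = 0 := by
  rw [branchCoeff_eq, if_neg hd, zero_sub, AddMonoidAlgebra.coeff_neg, Finsupp.neg_apply,
    diag_coeff, resolvent, if_pos hk, zero_mul, neg_zero]

/-- A majorant argument: as the resolvent is at most 2, the partial sums satisfy S(D+1) ≤ 2r + 2
S(D)³. The bound 4r reproduces itself because (4r)³ ≤ r for r ≤ 1/8. -/
lemma coeffNorm_sum_range_le {γ r : ℝ} (hN : 4 ≤ N) (hγ : 3 / 4 * gammaOne N ≤ γ) (hr : 0 ≤ r)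
    (hr1 : r ≤ 1 / 8) (D : ℕ) :
    ∑ d ∈ Finset.range D, coeffNorm (branchCoeff N γ d) * r ^ d ≤ 4 * r := by
  induction D with
  | zero => simpa using hr
  | succ D ih =>
    set n : ℕ → ℝ := fun d => coeffNorm (branchCoeff N γ d) * r ^ d with hn
    have hn0 : ∀ d, 0 ≤ n d := fun d => mul_nonneg (coeffNorm_nonneg _) (pow_nonneg hr d)
    have h1 : ∀ d ∈ Finset.range (D + 1), n d ≤ (if d = 1 then 2 * r else 0) +
        2 * ∑ i ∈ Finset.range D, ∑ j ∈ Finset.range D, ∑ l ∈ Finset.range D,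
          if i + j + l = d then n i * n j * n l else 0 := by
      intro d hd
      have hd' : d ≤ D := Nat.lt_succ_iff.1 (Finset.mem_range.1 hd)
      have e1 : coeffNorm (branchCoeff N γ d) ≤ (if d = 1 then 2 else 0) +
          2 * ∑ i ∈ Finset.range d, ∑ j ∈ Finset.range d, ∑ l ∈ Finset.range d,
            if i + j + l = d then coeffNorm (branchCoeff N γ i) * coeffNorm (branchCoeff N γ j)
              * coeffNorm (branchCoeff N γ l) else 0 := by
        rw [branchCoeff, sub_eq_add_neg]
        refine (coeffNorm_add_le _ _).trans (add_le_add ?_ ?_)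
        · split_ifs
          · refine (coeffNorm_add_le _ _).trans_eq ?_
            have h3 := coeffNorm_C_mul_T 1 1
            have h4 := coeffNorm_C_mul_T 1 (-1)
            rw [map_one, one_mul] at h3 h4
            rw [h3, h4]; norm_num
          · rw [coeffNorm_zero]
        · rw [coeffNorm_neg]
          refine (coeffNorm_diag_le (abs_resolvent_le hN hγ) _).trans ?_
          refine mul_le_mul_of_nonneg_left ?_ zero_le_two
          rw [← Fin.sum_univ_eq_sum_range]
          refine (coeffNorm_sum_le _ _).trans (Finset.sum_le_sum fun i _ => ?_)
          rw [← Fin.sum_univ_eq_sum_range]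
          refine (coeffNorm_sum_le _ _).trans (Finset.sum_le_sum fun j _ => ?_)
          rw [← Fin.sum_univ_eq_sum_range]
          refine (coeffNorm_sum_le _ _).trans (Finset.sum_le_sum fun l _ => ?_)
          split_ifs
          · exact (coeffNorm_mul_le _ _).trans
              (mul_le_mul_of_nonneg_right (coeffNorm_mul_le _ _) (coeffNorm_nonneg _))
          · rw [coeffNorm_zero]
      have e2 := mul_le_mul_of_nonneg_right e1 (pow_nonneg hr d)
      refine e2.trans ?_
      rw [add_mul]
      refine add_le_add ?_ ?_
      · split_ifs with h
        · rw [h, pow_one]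
        · rw [zero_mul]
      · rw [mul_assoc]
        refine mul_le_mul_of_nonneg_left ?_ zero_le_two
        have hsub : Finset.range d ⊆ Finset.range D := Finset.range_mono hd'
        have hnn : ∀ i j l, 0 ≤ if i + j + l = d then n i * n j * n l else 0 := by
          intro i j l
          split_ifs
          · exact mul_nonneg (mul_nonneg (hn0 i) (hn0 j)) (hn0 l)
          · exact le_rfl
        rw [Finset.sum_mul]
        refine (Finset.sum_le_sum fun i _ => ?_).trans (Finset.sum_le_sum_of_subset_of_nonneg hsub
          fun i _ _ => Finset.sum_nonneg fun j _ => Finset.sum_nonneg fun l _ => hnn i j l)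
        rw [Finset.sum_mul]
        refine (Finset.sum_le_sum fun j _ => ?_).trans (Finset.sum_le_sum_of_subset_of_nonneg hsub
          fun j _ _ => Finset.sum_nonneg fun l _ => hnn i j l)
        rw [Finset.sum_mul]
        refine (Finset.sum_le_sum fun l _ => ?_).trans (Finset.sum_le_sum_of_subset_of_nonneg hsub
          fun l _ _ => hnn i j l)
        split_ifs with h
        · refine le_of_eq ?_
          simp only [hn, ← h, pow_add]; ring
        · rw [zero_mul]
    -- Each triple (i, j, l) is counted for at most one d, so the sum over d is dominated by the
    -- full cube.
    have h2 : ∑ d ∈ Finset.range (D + 1), ∑ i ∈ Finset.range D, ∑ j ∈ Finset.range D,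
        ∑ l ∈ Finset.range D, (if i + j + l = d then n i * n j * n l else 0)
        ≤ (∑ i ∈ Finset.range D, n i) ^ 3 := by
      rw [Finset.sum_comm, pow_succ, pow_two, Finset.sum_mul, Finset.sum_mul]
      refine Finset.sum_le_sum fun i _ => ?_
      rw [Finset.sum_comm, mul_assoc, Finset.sum_mul, Finset.mul_sum]
      refine Finset.sum_le_sum fun j _ => ?_
      rw [Finset.sum_comm, Finset.mul_sum, Finset.mul_sum]
      refine Finset.sum_le_sum fun l _ => ?_
      rw [Finset.sum_ite_eq]
      split_ifs
      · exact (mul_assoc _ _ _).le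
      · exact mul_nonneg (hn0 i) (mul_nonneg (hn0 j) (hn0 l))
    have h3 : ∑ d ∈ Finset.range (D + 1), (if d = 1 then 2 * r else 0) ≤ 2 * r := by
      rw [Finset.sum_ite_eq']
      split_ifs <;> linarith
    refine (Finset.sum_le_sum h1).trans ?_
    rw [Finset.sum_add_distrib, ← Finset.mul_sum]
    have h4 : (∑ i ∈ Finset.range D, n i) ^ 3 ≤ (4 * r) ^ 3 :=
      pow_le_pow_left₀ (Finset.sum_nonneg fun i _ => hn0 i) ih 3
    have h5 : (4 * r) ^ 3 ≤ r := by
      have : r ^ 2 ≤ (1 / 8) ^ 2 := pow_le_pow_left₀ hr hr1 2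
      nlinarith
    linarith

lemma summable_coeffNorm {γ r : ℝ} (hN : 4 ≤ N) (hγ : 3 / 4 * gammaOne N ≤ γ) (hr : 0 ≤ r)
    (hr1 : r ≤ 1 / 8) : Summable fun d => coeffNorm (branchCoeff N γ d) * r ^ d :=
  summable_of_sum_range_le (fun d => mul_nonneg (coeffNorm_nonneg _) (pow_nonneg hr d))
    (coeffNorm_sum_range_le hN hγ hr hr1)

lemma tsum_coeffNorm_le {γ r : ℝ} (hN : 4 ≤ N) (hγ : 3 / 4 * gammaOne N ≤ γ) (hr : 0 ≤ r)
    (hr1 : r ≤ 1 / 8) : ∑' d, coeffNorm (branchCoeff N γ d) * r ^ d ≤ 4 * r :=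
  Real.tsum_le_of_sum_range_le (fun d => mul_nonneg (coeffNorm_nonneg _) (pow_nonneg hr d))
    (coeffNorm_sum_range_le hN hγ hr hr1)

lemma coeffNorm_cubeCoeff_le (f : ℕ → ℝ[T;T⁻¹]) (d : ℕ) :
    coeffNorm (cubeCoeff f d) ≤ cubeCoeff (fun i => coeffNorm (f i)) d := by
  refine (coeffNorm_sum_le _ _).trans (Finset.sum_le_sum fun p _ => ?_)
  refine (coeffNorm_mul_le _ _).trans
    (mul_le_mul_of_nonneg_right ?_ (coeffNorm_nonneg _))
  exact (coeffNorm_sum_le _ _).trans (Finset.sum_le_sum fun q _ => coeffNorm_mul_le _ _)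

lemma summable_coeffNorm_cube {γ r : ℝ} (hN : 4 ≤ N) (hγ : 3 / 4 * gammaOne N ≤ γ) (hr : 0 ≤ r)
    (hr1 : r ≤ 1 / 8) :
    Summable fun d => coeffNorm (cubeCoeff (branchCoeff N γ) d) * r ^ d := by
  have h := (summable_coeffNorm hN hγ hr hr1).norm
  refine (summable_norm_cubeCoeff h).of_nonneg_of_le
    (fun d => mul_nonneg (coeffNorm_nonneg _) (pow_nonneg hr d)) fun d => ?_
  rw [cubeCoeff_mul_pow]
  exact (mul_le_mul_of_nonneg_right (coeffNorm_cubeCoeff_le _ d) (pow_nonneg hr d)).trans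
    (Real.le_norm_self _)

lemma tsum_coeffNorm_cube_le {γ r : ℝ} (hN : 4 ≤ N) (hγ : 3 / 4 * gammaOne N ≤ γ) (hr : 0 ≤ r)
    (hr1 : r ≤ 1 / 8) :
    ∑' d, coeffNorm (cubeCoeff (branchCoeff N γ) d) * r ^ d ≤ (4 * r) ^ 3 := by
  have h := (summable_coeffNorm hN hγ hr hr1).norm
  have h0 : 0 ≤ ∑' d, coeffNorm (branchCoeff N γ d) * r ^ d :=
    tsum_nonneg fun d => mul_nonneg (coeffNorm_nonneg _) (pow_nonneg hr d)
  refine le_trans ?_ (pow_le_pow_left₀ h0 (tsum_coeffNorm_le hN hγ hr hr1) 3)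
  rw [← tsum_cubeCoeff h]
  refine (summable_coeffNorm_cube hN hγ hr hr1).tsum_le_tsum (fun d => ?_)
    (summable_norm_cubeCoeff h).of_norm
  rw [cubeCoeff_mul_pow]
  exact mul_le_mul_of_nonneg_right (coeffNorm_cubeCoeff_le _ d) (pow_nonneg hr d)

end

/-! ### The branch solves the equations on the complement. -/

section
set_option linter.unusedSectionVars false
variable {N : ℕ} [NeZero N]

/-- The configuration with amplitude `r` and phase `z` along the critical modes which solves
the equations on the complement of the critical modes. -/
def branch (N : ℕ) [NeZero N] (γ r : ℝ) (z : Circle) : Config N :=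
  fun j => (∑' d, circleEval (z * toCircle j) (branchCoeff N γ d) * (r : ℂ) ^ d).re

lemma norm_circleEval_mul_pow_le {r : ℝ} (hr : 0 ≤ r) (z : Circle) (p : ℝ[T;T⁻¹]) (d : ℕ) :
    ‖circleEval z p * (r : ℂ) ^ d‖ ≤ coeffNorm p * r ^ d := by
  rw [norm_mul, norm_pow, Complex.norm_real, Real.norm_of_nonneg hr]
  exact mul_le_mul_of_nonneg_right (norm_circleEval_le z p) (pow_nonneg hr d)

variable {γ r : ℝ}

lemma summable_norm_branch (hN : 4 ≤ N) (hγ : 3 / 4 * gammaOne N ≤ γ) (hr : 0 ≤ r)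
    (hr1 : r ≤ 1 / 8) (z : Circle) :
    Summable fun d => ‖circleEval z (branchCoeff N γ d) * (r : ℂ) ^ d‖ :=
  (summable_coeffNorm hN hγ hr hr1).of_nonneg_of_le (fun _ => norm_nonneg _)
    fun d => norm_circleEval_mul_pow_le hr z _ d

/-- The real part in the definition of `branch` loses nothing: all coefficients are invariant under
inversion, so every term is already real. -/
lemma hasSum_branch (hN : 4 ≤ N) (hγ : 3 / 4 * gammaOne N ≤ γ) (hr : 0 ≤ r)
    (hr1 : r ≤ 1 / 8) (z : Circle) (j : ZMod N) :
    HasSum (fun d => circleEval (z * toCircle j) (branchCoeff N γ d) * (r : ℂ) ^ d)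
      (branch N γ r z j : ℂ) := by
  have h := (summable_norm_branch hN hγ hr hr1 (z * toCircle j)).of_norm.hasSum
  have h0 : ∀ d, (circleEval (z * toCircle j) (branchCoeff N γ d) * (r : ℂ) ^ d).im = 0 := by
    intro d
    rw [← Complex.ofReal_pow, Complex.im_mul_ofReal,
      circleEval_im_of_invert (invert_branchCoeff γ d), zero_mul]
  have h2 := Complex.hasSum_im h
  simp only [h0] at h2
  have h3 : (branch N γ r z j : ℂ)
      = ∑' d, circleEval (z * toCircle j) (branchCoeff N γ d) * (r : ℂ) ^ d :=
    Complex.ext rfl ((Complex.ofReal_im _).trans (hasSum_zero.unique h2))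
  rw [h3]
  exact h

lemma hasSum_branch_cube (hN : 4 ≤ N) (hγ : 3 / 4 * gammaOne N ≤ γ) (hr : 0 ≤ r)
    (hr1 : r ≤ 1 / 8) (z : Circle) (j : ZMod N) :
    HasSum (fun d => circleEval (z * toCircle j) (cubeCoeff (branchCoeff N γ) d) * (r : ℂ) ^ d)
      ((branch N γ r z j : ℂ) ^ 3) := by
  have h := summable_norm_branch hN hγ hr hr1 (z * toCircle j)
  rw [← (hasSum_branch hN hγ hr hr1 z j).tsum_eq, ← tsum_cubeCoeff h]
  have h2 : HasSum (fun d => cubeCoeff (fun i =>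
      circleEval (z * toCircle j) (branchCoeff N γ i) * (r : ℂ) ^ i) d) _ :=
    (summable_norm_cubeCoeff h).of_norm.hasSum
  simp only [cubeCoeff_mul_pow] at h2 ⊢
  simp only [map_cubeCoeff]
  exact h2

lemma abs_branch_le (hN : 4 ≤ N) (hγ : 3 / 4 * gammaOne N ≤ γ) (hr : 0 ≤ r)
    (hr1 : r ≤ 1 / 8) (z : Circle) (j : ZMod N) : |branch N γ r z j| ≤ 4 * r := by
  have h := hasSum_branch hN hγ hr hr1 z j
  rw [← Real.norm_eq_abs, ← Complex.norm_real, ← h.tsum_eq]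
  refine (tsum_of_norm_bounded (summable_coeffNorm hN hγ hr hr1).hasSum
    fun d => norm_circleEval_mul_pow_le hr _ _ d).trans (tsum_coeffNorm_le hN hγ hr hr1)

lemma toCircle_zsmul (j : ZMod N) (k : ℤ) :
    (toCircle j : ℂ) ^ k = (toCircle (j * (k : ZMod N)) : ℂ) := by
  rw [← Circle.coe_zpow, ← AddChar.map_zsmul_eq_zpow, zsmul_eq_mul, mul_comm]

/-- Aliasing: summation over the lattice keeps every exponent congruent to −m modulo N, with the
phase z remembering by how much it was aliased. -/
lemma sum_toCircle_mul_circleEval (z : Circle) (m : ℤ) (p : ℝ[T;T⁻¹]) :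
    ∑ j : ZMod N, ((z * toCircle j : Circle) : ℂ) ^ m * circleEval (z * toCircle j) p
      = ∑ k ∈ p.coeff.support, p.coeff k *
        (if ((k + m : ℤ) : ZMod N) = 0 then N * (z : ℂ) ^ (k + m) else 0) := by
  simp only [circleEval_eq_sum (subset_refl p.coeff.support), Finset.mul_sum]
  rw [Finset.sum_comm]
  refine Finset.sum_congr rfl fun k _ => ?_
  have : ∀ j : ZMod N, ((z * toCircle j : Circle) : ℂ) ^ m *
      (p.coeff k * ((z * toCircle j : Circle) : ℂ) ^ k)
      = p.coeff k * (z : ℂ) ^ (k + m) * (toCircle (j * ((k + m : ℤ) : ZMod N)) : ℂ) := by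
    intro j
    rw [← toCircle_zsmul, Circle.coe_mul, mul_zpow, mul_zpow,
      zpow_add₀ (Circle.coe_ne_zero z), zpow_add₀ (Circle.coe_ne_zero _)]
    ring
  simp only [this]
  rw [← Finset.mul_sum, sum_toCircle_mul]
  split_ifs <;> ring

lemma two_ne_zero_zmod (hN : 4 ≤ N) : (2 : ZMod N) ≠ 0 := by
  intro h
  have : ((2 : ℕ) : ZMod N) = 0 := by exact_mod_cast h
  rw [ZMod.natCast_eq_zero_iff] at this
  have := Nat.le_of_dvd (by norm_num) this
  omega

lemma hasSum_sum_branch (hN : 4 ≤ N) (hγ : 3 / 4 * gammaOne N ≤ γ) (hr : 0 ≤ r)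
    (hr1 : r ≤ 1 / 8) (z : Circle) (a : ZMod N → ℂ) :
    HasSum (fun d => (∑ j, a j * circleEval (z * toCircle j) (branchCoeff N γ d)) * (r : ℂ) ^ d)
      (∑ j, a j * (branch N γ r z j : ℂ)) := by
  simp only [Finset.sum_mul, mul_assoc]
  exact hasSum_sum fun j _ => (hasSum_branch hN hγ hr hr1 z j).mul_left _

lemma hasSum_sum_branch_cube (hN : 4 ≤ N) (hγ : 3 / 4 * gammaOne N ≤ γ) (hr : 0 ≤ r)
    (hr1 : r ≤ 1 / 8) (z : Circle) (a : ZMod N → ℂ) :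
    HasSum (fun d => (∑ j, a j *
      circleEval (z * toCircle j) (cubeCoeff (branchCoeff N γ) d)) * (r : ℂ) ^ d)
      (∑ j, a j * (branch N γ r z j : ℂ) ^ 3) := by
  simp only [Finset.sum_mul, mul_assoc]
  exact hasSum_sum fun j _ => (hasSum_branch_cube hN hγ hr hr1 z j).mul_left _

/-- Only degree one has resonant exponents. There T⁻¹ contributes, and T does not because 2 ≠ 0
modulo N. Thus r and z are polar coordinates on the critical modes. -/
lemma firstMode_branch (hN : 4 ≤ N) (hγ : 3 / 4 * gammaOne N ≤ γ) (hr : 0 ≤ r)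
    (hr1 : r ≤ 1 / 8) (z : Circle) :
    firstMode N (branch N γ r z) = N * r * (starRingEnd ℂ) (z : ℂ) := by
  have h := hasSum_sum_branch hN hγ hr hr1 z (fun j => ((z * toCircle j : Circle) : ℂ) ^ (1 : ℤ))
  have h1 : ∑ j, ((z * toCircle j : Circle) : ℂ) ^ (1 : ℤ) * (branch N γ r z j : ℂ)
      = z * firstMode N (branch N γ r z) := by
    rw [firstMode_apply, Finset.mul_sum]
    exact Finset.sum_congr rfl fun j _ => by rw [zpow_one, Circle.coe_mul]; ring
  have h2 : ∀ d, (∑ j : ZMod N, ((z * toCircle j : Circle) : ℂ) ^ (1 : ℤ) *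
      circleEval (z * toCircle j) (branchCoeff N γ d)) * (r : ℂ) ^ d
      = if d = 1 then (N : ℂ) * r else 0 := by
    intro d
    rw [sum_toCircle_mul_circleEval]
    split_ifs with hd
    · subst hd
      rw [Finset.sum_eq_single (-1 : ℤ)]
      · rw [branchCoeff_one, AddMonoidAlgebra.coeff_add, Finsupp.add_apply, T_apply, T_apply]
        simp
      · intro k hk hk1
        rw [if_neg, mul_zero]
        intro h0
        rw [Finsupp.mem_support_iff, branchCoeff_one, AddMonoidAlgebra.coeff_add,
          Finsupp.add_apply, T_apply, T_apply, if_neg (Ne.symm hk1), add_zero] at hk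
        have hk2 : k = 1 := by by_contra hne; exact hk (if_neg (Ne.symm hne))
        rw [hk2] at h0
        exact two_ne_zero_zmod hN (by rw [← h0]; push_cast; norm_num)
      · intro hk
        rw [Finsupp.notMem_support_iff.1 hk]; simp
    · rw [Finset.sum_eq_zero, zero_mul]
      intro k _
      split_ifs with h0
      · rw [coeff_branchCoeff_of_resonant γ hd, Complex.ofReal_zero, zero_mul]
        right
        push_cast at h0
        exact eq_neg_of_add_eq_zero_left h0
      · rw [mul_zero]
  rw [h1] at h
  simp only [h2] at h
  have h3 := h.unique (hasSum_ite_eq 1 ((N : ℂ) * r))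
  have h4 : (starRingEnd ℂ) (z : ℂ) * z = 1 := by
    rw [mul_comm, Complex.mul_conj, Complex.normSq_eq_norm_sq, Circle.norm_coe]; simp
  linear_combination (starRingEnd ℂ) (z : ℂ) * h3 - h4 * firstMode N (branch N γ r z)

lemma circleEval_neighbours (z : Circle) (j : ZMod N) (p : ℝ[T;T⁻¹]) :
    -circleEval (z * toCircle j) p - γ / 2 * (circleEval (z * toCircle (j + 1)) p +
      circleEval (z * toCircle (j - 1)) p - 2 * circleEval (z * toCircle j) p)
      = circleEval (z * toCircle j) (diag (dispersion N γ) p) := by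
  rw [circleEval_eq_sum (diag_support_subset (dispersion N γ) p)]
  simp only [circleEval_eq_sum (subset_refl p.coeff.support)]
  rw [← Finset.sum_add_distrib, Finset.mul_sum, ← Finset.sum_sub_distrib, Finset.mul_sum,
    ← Finset.sum_neg_distrib, ← Finset.sum_sub_distrib]
  refine Finset.sum_congr rfl fun k _ => ?_
  have h1 : ((z * toCircle (j + 1) : Circle) : ℂ) ^ k
      = ((z * toCircle j : Circle) : ℂ) ^ k * (toCircle (k : ZMod N) : ℂ) := by
    rw [AddChar.map_add_eq_mul, ← mul_assoc, Circle.coe_mul, mul_zpow, toCircle_zsmul 1 k, one_mul]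
  have h2 : ((z * toCircle (j - 1) : Circle) : ℂ) ^ k
      = ((z * toCircle j : Circle) : ℂ) ^ k * (toCircle (-(k : ZMod N)) : ℂ) := by
    rw [sub_eq_add_neg, AddChar.map_add_eq_mul, ← mul_assoc, Circle.coe_mul, mul_zpow,
      toCircle_zsmul (-1) k, neg_one_mul]
  have h3 : (toCircle (k : ZMod N) : ℂ) + (toCircle (-(k : ZMod N)) : ℂ)
      = ((2 * (toCircle (k : ZMod N) : ℂ).re : ℝ) : ℂ) := by
    rw [← conj_toCircle, Complex.add_conj]
  rw [h1, h2, diag_coeff, dispersion]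
  simp only [Complex.ofReal_mul, Complex.ofReal_sub, Complex.ofReal_one,
    Complex.ofReal_ofNat] at h3 ⊢
  linear_combination -(γ : ℂ) / 2 * p.coeff k * ((z * toCircle j : Circle) : ℂ) ^ k * h3

lemma residual_coeff_eq_zero (hN : 4 ≤ N) (hγ : 3 / 4 * gammaOne N ≤ γ) (d : ℕ) {k : ℤ}
    (hk : ¬ Resonant N k) :
    (diag (dispersion N γ) (branchCoeff N γ d) + cubeCoeff (branchCoeff N γ) d).coeff k = 0 := by
  have h : (if d = 1 then T 1 + T (-1) else (0 : ℝ[T;T⁻¹])).coeff k = 0 := by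
    split_ifs
    · rw [AddMonoidAlgebra.coeff_add, Finsupp.add_apply, T_apply, T_apply, if_neg, if_neg,
        add_zero]
      · rintro rfl; exact hk (Or.inr (by simp))
      · rintro rfl; exact hk (Or.inl (by simp))
    · rfl
  rw [AddMonoidAlgebra.coeff_add, Finsupp.add_apply, diag_coeff]
  conv_lhs => rw [branchCoeff_eq]
  rw [AddMonoidAlgebra.coeff_sub, Finsupp.sub_apply, h, diag_coeff, resolvent, if_neg hk]
  field_simp [dispersion_ne_zero hN hγ hk]
  ring

lemma hasSum_force_branch (hN : 4 ≤ N) (hγ : 3 / 4 * gammaOne N ≤ γ) (hr : 0 ≤ r)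
    (hr1 : r ≤ 1 / 8) (z : Circle) (j : ZMod N) :
    HasSum (fun d => circleEval (z * toCircle j) (diag (dispersion N γ) (branchCoeff N γ d) +
      cubeCoeff (branchCoeff N γ) d) * (r : ℂ) ^ d) (force N γ (branch N γ r z) j : ℂ) := by
  have h := hasSum_branch hN hγ hr hr1 z
  have h1 := ((h j).neg.sub ((((h (j + 1)).add (h (j - 1))).sub
    ((h j).mul_left 2)).mul_left (γ / 2 : ℂ))).add (hasSum_branch_cube hN hγ hr hr1 z j)
  have e1 : (force N γ (branch N γ r z) j : ℂ) = -(branch N γ r z j : ℂ) - γ / 2 *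
      (branch N γ r z (j + 1) + branch N γ r z (j - 1) - 2 * branch N γ r z j)
      + (branch N γ r z j : ℂ) ^ 3 := by
    simp only [force, linForce]
    push_cast
    exact add_comm _ _
  have e2 : (fun d => circleEval (z * toCircle j) (diag (dispersion N γ) (branchCoeff N γ d) +
      cubeCoeff (branchCoeff N γ) d) * (r : ℂ) ^ d) = _ :=
    funext fun d => by rw [map_add, ← circleEval_neighbours]
  rw [e1, e2]
  convert! h1 using 1
  funext d
  ring

/-- In each degree the recursion cancels every non-resonant coefficient of the force. On the lattice
the resonant ones coincide with the critical modes, to which `g` is orthogonal. -/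
lemma solvesComplement_branch (hN : 4 ≤ N) (hγ : 3 / 4 * gammaOne N ≤ γ) (hr : 0 ≤ r)
    (hr1 : r ≤ 1 / 8) (z : Circle) : SolvesComplement N γ (branch N γ r z) := by
  intro g hg
  have h : HasSum (fun d => ∑ j, (g j : ℂ) * (circleEval (z * toCircle j)
      (diag (dispersion N γ) (branchCoeff N γ d) + cubeCoeff (branchCoeff N γ) d) * (r : ℂ) ^ d))
      (∑ j, (g j : ℂ) * (force N γ (branch N γ r z) j : ℂ)) :=
    hasSum_sum fun j _ => (hasSum_force_branch hN hγ hr hr1 z j).mul_left _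
  have h0 : ∀ d, ∑ j, (g j : ℂ) * (circleEval (z * toCircle j)
      (diag (dispersion N γ) (branchCoeff N γ d) + cubeCoeff (branchCoeff N γ) d) * (r : ℂ) ^ d)
      = 0 := by
    intro d
    set p := diag (dispersion N γ) (branchCoeff N γ d) + cubeCoeff (branchCoeff N γ) d with hp
    simp only [circleEval_eq_sum (subset_refl p.coeff.support), Finset.mul_sum, Finset.sum_mul]
    rw [Finset.sum_comm]
    refine Finset.sum_eq_zero fun k _ => ?_
    by_cases hk : Resonant N k
    · have h1 : ∑ j, (g j : ℂ) * (toCircle (j * (k : ZMod N)) : ℂ) = 0 := by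
        have h2 : fourierCoeffs g (k : ZMod N) = 0 := by
          rcases hk with hk | hk
          · rw [hk, fourierCoeffs_one, hg]
          · rw [hk, fourierCoeffs_neg, fourierCoeffs_one, hg, map_zero]
        exact h2
      have h2 : ∀ j : ZMod N, (g j : ℂ) * (p.coeff k * ((z * toCircle j : Circle) : ℂ) ^ k
          * (r : ℂ) ^ d) = (p.coeff k * (z : ℂ) ^ k * (r : ℂ) ^ d) *
          ((g j : ℂ) * (toCircle (j * (k : ZMod N)) : ℂ)) := by
        intro j
        rw [← toCircle_zsmul, Circle.coe_mul, mul_zpow]; ring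
      simp only [h2]
      rw [← Finset.mul_sum, h1, mul_zero]
    · refine Finset.sum_eq_zero fun j _ => ?_
      rw [hp, residual_coeff_eq_zero hN hγ d hk]
      simp
  simp only [h0] at h
  have := h.unique hasSum_zero
  exact_mod_cast this

end

/-! ### The reduced equation and its angular component. -/

section
set_option linter.unusedSectionVars false
variable {N : ℕ} [NeZero N]

/-- The critical modes, parametrized by a complex amplitude. -/
def wave (N : ℕ) [NeZero N] (w : ℂ) : Config N := fun j => (w * toCircle j).re

lemma sum_mul_wave (x : Config N) (w : ℂ) : ∑ j, x j * wave N w j = (w * firstMode N x).re := by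
  rw [firstMode_apply, Finset.mul_sum, Complex.re_sum]
  refine Finset.sum_congr rfl fun j _ => ?_
  rw [mul_left_comm, Complex.re_ofReal_mul, wave]

lemma toCircle_one_re : (toCircle (1 : ZMod N) : ℂ).re = Real.cos (2 * Real.pi / N) := by
  have h := ZMod.toCircle_natCast (N := N) 1
  have h2 : (2 * Real.pi * Complex.I * ((1 : ℕ) : ℂ) / N : ℂ)
      = ((2 * Real.pi / N : ℝ) : ℂ) * Complex.I := by push_cast; ring
  rw [Nat.cast_one] at h
  rw [h, h2, Complex.exp_ofReal_mul_I_re]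

lemma linForce_wave (hN : 4 ≤ N) (γ : ℝ) (w : ℂ) (j : ZMod N) :
    linForce N γ (wave N w) j = (γ / gammaOne N - 1) * wave N w j := by
  have h1 : wave N w (j + 1) + wave N w (j - 1)
      = 2 * Real.cos (2 * Real.pi / N) * wave N w j := by
    simp only [wave]
    rw [← Complex.add_re, sub_eq_add_neg, toCircle_add, toCircle_add, ← conj_toCircle]
    have : w * (toCircle j * toCircle (1 : ZMod N))
        + w * (toCircle j * (starRingEnd ℂ) (toCircle (1 : ZMod N) : ℂ))
        = (w * toCircle j)
          * (toCircle (1 : ZMod N) + (starRingEnd ℂ) (toCircle (1 : ZMod N) : ℂ)) := by ring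
    rw [this, Complex.add_conj, Complex.re_mul_ofReal, toCircle_one_re]
    ring
  rw [linForce, h1, ← gamma_mul_half_gap hN]
  ring

lemma complex_ext_of_re_mul {a b : ℂ} (h : ∀ w : ℂ, (w * a).re = (w * b).re) : a = b := by
  refine Complex.ext (by simpa using h 1) ?_
  have := h Complex.I
  simpa using this

lemma firstMode_linForce (hN : 4 ≤ N) (γ : ℝ) (x : Config N) :
    firstMode N (linForce N γ x) = ((γ / gammaOne N - 1 : ℝ) : ℂ) * firstMode N x := by
  refine complex_ext_of_re_mul fun w => ?_
  rw [← sum_mul_wave, sum_linForce_mul_comm, mul_left_comm, Complex.re_ofReal_mul, ← sum_mul_wave,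
    Finset.mul_sum]
  exact Finset.sum_congr rfl fun j _ => by rw [linForce_wave hN]; ring

lemma firstMode_wave (hN : 4 ≤ N) (w : ℂ) :
    firstMode N (wave N w) = N / 2 * (starRingEnd ℂ) w := by
  have h : ∀ j : ZMod N, (wave N w j : ℂ) * (toCircle j : ℂ)
      = (starRingEnd ℂ) w / 2 + w / 2 * (toCircle (j * 2) : ℂ) := by
    intro j
    have h1 : (starRingEnd ℂ) (toCircle j : ℂ) * (toCircle j : ℂ) = 1 := by
      rw [conj_toCircle, ← toCircle_add, neg_add_cancel, AddChar.map_zero_eq_one, Circle.coe_one]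
    rw [wave, Complex.re_eq_add_conj, map_mul, mul_two, toCircle_add]
    linear_combination (starRingEnd ℂ) w / 2 * h1
  rw [firstMode_apply]
  simp only [h]
  rw [Finset.sum_add_distrib, ← Finset.mul_sum, sum_toCircle_mul, if_neg (two_ne_zero_zmod hN)]
  simp [ZMod.card]
  ring

lemma sum_wave_mul_wave (hN : 4 ≤ N) (v w : ℂ) :
    ∑ j, wave N v j * wave N w j = N / 2 * (w * (starRingEnd ℂ) v).re := by
  rw [sum_mul_wave, firstMode_wave hN, mul_left_comm,
    show (N / 2 : ℂ) = ((N / 2 : ℝ) : ℂ) by push_cast; rfl, Complex.re_ofReal_mul]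

lemma circle_mul_conj (z : Circle) : (z : ℂ) * (starRingEnd ℂ) (z : ℂ) = 1 := by
  rw [Complex.mul_conj, Complex.normSq_eq_norm_sq, Circle.norm_coe]; simp

/-- Once its first mode vanishes, the force is an admissible test configuration for itself. -/
lemma force_eq_zero_of_firstMode {γ : ℝ} {x : Config N} (hx : SolvesComplement N γ x)
    (h : firstMode N (force N γ x) = 0) : force N γ x = 0 := by
  have := hx _ h
  rw [Finset.sum_eq_zero_iff_of_nonneg fun i _ => mul_self_nonneg _] at this
  exact funext fun j => mul_self_eq_zero.1 (this j (Finset.mem_univ j))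

variable {γ r : ℝ}

lemma solvesComplement_of_force_eq_zero {x : Config N} (hx : force N γ x = 0) :
    SolvesComplement N γ x := fun g _ => by simp [hx]

/-- The component of the force along the infinitesimal rotation of the phase. -/
def angularForce (N : ℕ) [NeZero N] (γ r : ℝ) (z : Circle) : ℝ :=
  ((z : ℂ) * firstMode N (force N γ (branch N γ r z))).im

/-- The linear part is radial: it multiplies the critical component N r z̄ by a real number, which
becomes real after multiplication by z. -/
lemma angularForce_eq_sum_cube (hN : 4 ≤ N) (hγ : 3 / 4 * gammaOne N ≤ γ) (hr : 0 ≤ r)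
    (hr1 : r ≤ 1 / 8) (z : Circle) :
    angularForce N γ r z
      = ∑ j, ((z * toCircle j : Circle) : ℂ).im * branch N γ r z j ^ 3 := by
  have h1 : force N γ (branch N γ r z)
      = (fun j => branch N γ r z j ^ 3) + linForce N γ (branch N γ r z) := rfl
  rw [angularForce, h1, map_add, firstMode_linForce hN, firstMode_branch hN hγ hr hr1]
  have h2 : (z : ℂ) * (firstMode N (fun j => branch N γ r z j ^ 3) +
      ((γ / gammaOne N - 1 : ℝ) : ℂ) * (N * r * (starRingEnd ℂ) (z : ℂ)))
      = (z : ℂ) * firstMode N (fun j => branch N γ r z j ^ 3)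
        + (((γ / gammaOne N - 1) * (N * r) : ℝ) : ℂ) := by
    push_cast
    linear_combination ((γ / gammaOne N - 1) * (N * r) : ℂ) * circle_mul_conj z
  rw [h2, Complex.add_im, Complex.ofReal_im, add_zero, firstMode_apply, Finset.mul_sum,
    Complex.im_sum]
  refine Finset.sum_congr rfl fun j _ => ?_
  rw [mul_left_comm, Complex.im_ofReal_mul, Circle.coe_mul]
  ring

/-- Contribution of one mode to the angular force. -/
def angularWeight (N : ℕ) (z : Circle) (k : ℤ) : ℝ :=
  N / 2 * ((if ((k + 1 : ℤ) : ZMod N) = 0 then ((z : ℂ) ^ (k + 1)).im else 0)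
    - (if ((k - 1 : ℤ) : ZMod N) = 0 then ((z : ℂ) ^ (k - 1)).im else 0))

lemma sum_im_mul_circleEval (z : Circle) (p : ℝ[T;T⁻¹]) :
    (∑ j : ZMod N, (((z * toCircle j : Circle) : ℂ).im : ℂ) * circleEval (z * toCircle j) p).re
      = ∑ k ∈ p.coeff.support, p.coeff k * angularWeight N z k := by
  have h : ∀ w : Circle, ((w : ℂ).im : ℂ)
      = -Complex.I / 2 * ((w : ℂ) ^ (1 : ℤ) - (w : ℂ) ^ (-1 : ℤ)) := by
    intro w
    rw [zpow_one, zpow_neg_one, ← Circle.coe_inv, Circle.coe_inv_eq_conj, Complex.sub_conj]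
    push_cast
    linear_combination ((w : ℂ).im : ℂ) * Complex.I_mul_I
  simp only [h, mul_assoc, sub_mul, mul_sub, ← Finset.mul_sum, Finset.sum_sub_distrib]
  rw [sum_toCircle_mul_circleEval, sum_toCircle_mul_circleEval, ← mul_sub,
    ← Finset.sum_sub_distrib, Finset.mul_sum, Complex.re_sum]
  refine Finset.sum_congr rfl fun k _ => ?_
  rw [← mul_sub, mul_left_comm, Complex.re_ofReal_mul, angularWeight, ← sub_eq_add_neg]
  congr 1
  have h1 : ∀ c : ℂ, (-Complex.I / 2 * (N * c)).re = N / 2 * c.im := by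
    intro c
    simp [Complex.mul_re, Complex.mul_im]
    ring
  split_ifs
  · rw [← mul_sub, h1, Complex.sub_im]
  · rw [sub_zero, h1, sub_zero]
  · rw [zero_sub, ← mul_neg, h1, Complex.neg_im, zero_sub]
  · simp

lemma hasSum_angularForce (hN : 4 ≤ N) (hγ : 3 / 4 * gammaOne N ≤ γ) (hr : 0 ≤ r)
    (hr1 : r ≤ 1 / 8) (z : Circle) :
    HasSum (fun d => (∑ k ∈ (cubeCoeff (branchCoeff N γ) d).coeff.support,
      (cubeCoeff (branchCoeff N γ) d).coeff k * angularWeight N z k) * r ^ d)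
      (angularForce N γ r z) := by
  have h := Complex.hasSum_re (hasSum_sum_branch_cube hN hγ hr hr1 z
    (fun j => (((z * toCircle j : Circle) : ℂ).im : ℂ)))
  have h1 : (∑ j, (((z * toCircle j : Circle) : ℂ).im : ℂ) * (branch N γ r z j : ℂ) ^ 3).re
      = angularForce N γ r z := by
    rw [angularForce_eq_sum_cube hN hγ hr hr1, ← Complex.ofReal_re (∑ j, _)]
    push_cast
    rfl
  rw [h1] at h
  simp only [← Complex.ofReal_pow, Complex.re_mul_ofReal, sum_im_mul_circleEval] at h
  exact h

lemma abs_im_pow_le (z : Circle) (m : ℕ) : |((z : ℂ) ^ m).im| ≤ m * |(z : ℂ).im| := by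
  induction m with
  | zero => simp
  | succ m ih =>
    have h1 : |((z : ℂ) ^ m).re| ≤ 1 := (Complex.abs_re_le_norm _).trans (by
      rw [norm_pow, Circle.norm_coe, one_pow])
    have h2 : |(z : ℂ).re| ≤ 1 := (Complex.abs_re_le_norm _).trans (by rw [Circle.norm_coe])
    rw [pow_succ, Complex.mul_im]
    refine (abs_add_le _ _).trans ?_
    rw [abs_mul, abs_mul]
    push_cast
    nlinarith [abs_nonneg ((z : ℂ).im), abs_nonneg ((z : ℂ) ^ m).im]

lemma abs_im_zpow_le (z : Circle) (m : ℤ) : |((z : ℂ) ^ m).im| ≤ |(m : ℝ)| * |(z : ℂ).im| := by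
  rcases m.eq_nat_or_neg with ⟨n, rfl | rfl⟩
  · simpa using abs_im_pow_le z n
  · have := abs_im_pow_le z n
    rw [zpow_neg, ← inv_zpow, ← Circle.coe_inv, Circle.coe_inv_eq_conj, zpow_natCast, ← map_pow,
      Complex.conj_im, abs_neg]
    simpa using this

/-- With m = Na this is |Im ζᵃ| ≤ |a| |Im ζ| for ζ = zᴺ. -/
lemma abs_im_zpow_le_of_cast_eq_zero (z : Circle) {m : ℤ} (hm : (m : ZMod N) = 0) :
    N * |((z : ℂ) ^ m).im| ≤ |(m : ℝ)| * |((z : ℂ) ^ N).im| := by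
  obtain ⟨a, rfl⟩ := (ZMod.intCast_zmod_eq_zero_iff_dvd m N).1 hm
  rw [zpow_mul, zpow_natCast, ← Circle.coe_pow]
  have := mul_le_mul_of_nonneg_left (abs_im_zpow_le (z ^ N) a) (Nat.cast_nonneg (α := ℝ) N)
  push_cast at this ⊢
  rw [abs_mul, Nat.abs_cast]
  linarith

/-- Every aliased exponent k ± 1 is a multiple of N, so each contribution carries the factor |Im
zᴺ|. This factor in the error is what locates the zeros of the angular force exactly. The case k = 0
is never aliased, whence |k ± 1| ≤ 2|k|. -/
lemma abs_angularWeight_le (hN : 4 ≤ N) (z : Circle) (k : ℤ) :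
    |angularWeight N z k| ≤ 2 * |(k : ℝ)| * |((z : ℂ) ^ N).im| := by
  have hne : ∀ k : ℤ, ∀ e : ℤ, |e| = 1 → ((k + e : ℤ) : ZMod N) = 0 → 1 ≤ |(k : ℝ)| := by
    intro k e he h
    have h0 : k ≠ 0 := by
      rintro rfl
      rw [zero_add, ZMod.intCast_zmod_eq_zero_iff_dvd] at h
      have := Int.le_of_dvd (by rw [he]; norm_num) ((dvd_abs _ _).2 h)
      omega
    have := Int.one_le_abs h0
    exact_mod_cast this
  have key : ∀ e : ℤ, |e| = 1 →
      N / 2 * |(if ((k + e : ℤ) : ZMod N) = 0 then ((z : ℂ) ^ (k + e)).im else 0)|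
        ≤ |(k : ℝ)| * |((z : ℂ) ^ N).im| := by
    intro e he
    split_ifs with h
    · have h1 := abs_im_zpow_le_of_cast_eq_zero z h
      have h2 := hne k e he h
      have h3 : |((k + e : ℤ) : ℝ)| ≤ 2 * |(k : ℝ)| := by
        have he' : |(e : ℝ)| = 1 := by exact_mod_cast he
        push_cast
        exact (abs_add_le _ _).trans (by linarith)
      nlinarith [mul_le_mul_of_nonneg_right h3 (abs_nonneg ((z : ℂ) ^ N).im)]
    · rw [abs_zero, mul_zero]; positivity
  rw [angularWeight, abs_mul, abs_of_nonneg (by positivity : (0 : ℝ) ≤ N / 2)]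
  refine (mul_le_mul_of_nonneg_left (abs_sub _ _) (by positivity)).trans ?_
  have h1 := key 1 rfl
  have h2 := key (-1) rfl
  rw [← sub_eq_add_neg] at h2
  rw [mul_add]
  linarith

/-- The only multiple of N that k ± 1 can then reach is 0, and z⁰ is real. -/
lemma angularWeight_eq_zero (z : Circle) {k : ℤ} (hk : |k| < N - 1) :
    angularWeight N z k = 0 := by
  have h0 : ∀ m : ℤ, |m| < N → (m : ZMod N) = 0 → m = 0 := fun m hm h =>
    Int.eq_zero_of_abs_lt_dvd ((ZMod.intCast_zmod_eq_zero_iff_dvd m N).1 h) hm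
  have key : ∀ m : ℤ, |m| < N → (if (m : ZMod N) = 0 then ((z : ℂ) ^ m).im else 0) = 0 := by
    intro m hm
    split_ifs with h
    · rw [h0 m hm h]; simp
    · rfl
  rw [angularWeight, key, key]
  · simp
  · have := abs_sub k 1; rw [abs_one] at this; omega
  · have := abs_add_le k 1; rw [abs_one] at this; omega

lemma angularWeight_top (hN : 4 ≤ N) (z : Circle) :
    angularWeight N z (N - 1) = N / 2 * ((z : ℂ) ^ N).im := by
  have h : ((N - 1 - 1 : ℤ) : ZMod N) ≠ 0 := by
    push_cast
    rw [ZMod.natCast_self]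
    intro h
    exact two_ne_zero_zmod hN (by linear_combination -h)
  rw [angularWeight, if_neg h, if_pos (by push_cast; simp), sub_add_cancel, zpow_natCast, sub_zero]

lemma angularWeight_neg (z : Circle) (k : ℤ) :
    angularWeight N z (-k) = angularWeight N z k := by
  have h : ∀ m : ℤ, ((z : ℂ) ^ (-m)).im = -((z : ℂ) ^ m).im := by
    intro m
    rw [zpow_neg, ← inv_zpow, ← Circle.coe_inv, Circle.coe_inv_eq_conj, ← map_zpow₀,
      Complex.conj_im]
  have h1 : ∀ m : ℤ, (if ((-m : ℤ) : ZMod N) = 0 then ((z : ℂ) ^ (-m)).im else 0)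
      = -(if (m : ZMod N) = 0 then ((z : ℂ) ^ m).im else 0) := by
    intro m
    by_cases hm : (m : ZMod N) = 0
    · rw [if_pos hm, if_pos (by rw [Int.cast_neg, hm, neg_zero]), h]
    · rw [if_neg hm, if_neg (by rwa [Int.cast_neg, neg_eq_zero]), neg_zero]
  rw [angularWeight, angularWeight, show -k + 1 = -(k - 1) by ring,
    show -k - 1 = -(k + 1) by ring, h1, h1]
  ring

/-- The leading coefficient of the angular force. -/
def angularCoeff (N : ℕ) [NeZero N] (γ : ℝ) : ℝ :=
  (cubeCoeff (branchCoeff N γ) (N - 1)).coeff ((N - 1 : ℕ) : ℤ)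

lemma invert_cubeCoeff_branchCoeff (γ : ℝ) (d : ℕ) :
    invert (cubeCoeff (branchCoeff N γ) d) = cubeCoeff (branchCoeff N γ) d := by
  have := map_cubeCoeff (invert (R := ℝ) : ℝ[T;T⁻¹] →+* ℝ[T;T⁻¹]) (branchCoeff N γ) d
  simp only [RingHom.coe_coe, invert_branchCoeff] at this
  exact this

lemma angular_sum_lt (z : Circle) {d : ℕ} (hd : d < N - 1) :
    ∑ k ∈ (cubeCoeff (branchCoeff N γ) d).coeff.support,
      (cubeCoeff (branchCoeff N γ) d).coeff k * angularWeight N z k = 0 := by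
  refine Finset.sum_eq_zero fun k hk => ?_
  rw [angularWeight_eq_zero, mul_zero]
  by_contra hlt
  refine (Finsupp.mem_support_iff.1 hk) (cubeCoeff_branchCoeff_degLE γ d k ?_)
  omega

lemma angular_sum_top (hN : 4 ≤ N) (z : Circle) :
    ∑ k ∈ (cubeCoeff (branchCoeff N γ) (N - 1)).coeff.support,
      (cubeCoeff (branchCoeff N γ) (N - 1)).coeff k * angularWeight N z k
      = N * angularCoeff N γ * ((z : ℂ) ^ N).im := by
  set p := cubeCoeff (branchCoeff N γ) (N - 1) with hp
  have hsub : ∑ k ∈ p.coeff.support, p.coeff k * angularWeight N z k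
      = ∑ k ∈ ({((N - 1 : ℕ) : ℤ), -((N - 1 : ℕ) : ℤ)} : Finset ℤ),
          p.coeff k * angularWeight N z k := by
    refine Finset.sum_congr_of_eq_on_inter (fun k hk hk2 => ?_) (fun k _ hk2 => ?_)
      fun _ _ _ => rfl
    · rw [angularWeight_eq_zero, mul_zero]
      simp only [Finset.mem_insert, Finset.mem_singleton, not_or] at hk2
      by_contra hlt
      refine (Finsupp.mem_support_iff.1 hk) (cubeCoeff_branchCoeff_degLE γ _ k ?_)
      rcases abs_cases k with h | h <;> omega
    · rw [Finsupp.notMem_support_iff.1 hk2, zero_mul]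
  have hneg : p.coeff (-((N - 1 : ℕ) : ℤ)) = p.coeff ((N - 1 : ℕ) : ℤ) := by
    rw [← invert_apply, hp, invert_cubeCoeff_branchCoeff]
  rw [hsub, Finset.sum_pair (by omega), angularWeight_neg, hneg,
    show (((N - 1 : ℕ) : ℤ)) = (N : ℤ) - 1 by omega, angularWeight_top hN]
  have h3 : p.coeff ((N : ℤ) - 1) = angularCoeff N γ := by
    rw [angularCoeff, show (((N - 1 : ℕ) : ℤ)) = (N : ℤ) - 1 by omega]
  rw [h3]
  ring

lemma abs_angular_sum_le (hN : 4 ≤ N) (z : Circle) (d : ℕ) :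
    |∑ k ∈ (cubeCoeff (branchCoeff N γ) d).coeff.support,
      (cubeCoeff (branchCoeff N γ) d).coeff k * angularWeight N z k|
      ≤ 2 * d * coeffNorm (cubeCoeff (branchCoeff N γ) d) * |((z : ℂ) ^ N).im| := by
  refine (Finset.abs_sum_le_sum_abs _ _).trans ?_
  rw [coeffNorm, Finset.mul_sum, Finset.sum_mul]
  refine Finset.sum_le_sum fun k hk => ?_
  have h1 : |(k : ℝ)| ≤ d := by
    have : |k| ≤ d := by
      by_contra hlt
      exact (Finsupp.mem_support_iff.1 hk) (cubeCoeff_branchCoeff_degLE γ d k (not_le.1 hlt))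
    exact_mod_cast this
  rw [abs_mul]
  calc _ ≤ |(cubeCoeff (branchCoeff N γ) d).coeff k| * (2 * |(k : ℝ)| * |((z : ℂ) ^ N).im|) := by
        gcongr; exact abs_angularWeight_le hN z k
    _ ≤ |(cubeCoeff (branchCoeff N γ) d).coeff k| * (2 * d * |((z : ℂ) ^ N).im|) := by gcongr
    _ = _ := by ring

/-- A polynomial of degree d has exponents at most d, so nothing appears below degree N − 1, and
there only the exponents ±(N − 1) count. The tail is compared with the convergent series at radius
1/8. -/
lemma abs_angularForce_sub_le (hN : 4 ≤ N) (hγ : 3 / 4 * gammaOne N ≤ γ) (hr : 0 ≤ r)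
    (hr1 : r ≤ 1 / 16) (z : Circle) :
    |angularForce N γ r z - N * angularCoeff N γ * r ^ (N - 1) * ((z : ℂ) ^ N).im|
      ≤ (16 * r) ^ N * |((z : ℂ) ^ N).im| := by
  set f : ℕ → ℝ := fun d => (∑ k ∈ (cubeCoeff (branchCoeff N γ) d).coeff.support,
      (cubeCoeff (branchCoeff N γ) d).coeff k * angularWeight N z k) * r ^ d with hf
  have h := hasSum_angularForce hN hγ hr (by linarith) z
  have h1 := h.sub (hasSum_ite_eq (N - 1) (f (N - 1)))
  have htop : f (N - 1) = N * angularCoeff N γ * r ^ (N - 1) * ((z : ℂ) ^ N).im := by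
    simp only [hf]; rw [angular_sum_top hN]; ring
  rw [htop] at h1
  have hs := summable_coeffNorm_cube hN hγ (by norm_num : (0 : ℝ) ≤ 1 / 8) le_rfl
  have hb := tsum_coeffNorm_cube_le hN hγ (by norm_num : (0 : ℝ) ≤ 1 / 8) le_rfl
  have hs2 := hs.hasSum.mul_left (2 * (16 * r) ^ N * |((z : ℂ) ^ N).im|)
  have h2 := h1.norm_le_of_bounded hs2 fun d => ?_
  · rw [Real.norm_eq_abs] at h2
    refine h2.trans ?_
    calc _ ≤ 2 * (16 * r) ^ N * |((z : ℂ) ^ N).im| * (4 * (1 / 8)) ^ 3 := by gcongr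
      _ = 1 / 4 * ((16 * r) ^ N * |((z : ℂ) ^ N).im|) := by ring
      _ ≤ _ := by
        have : 0 ≤ (16 * r) ^ N * |((z : ℂ) ^ N).im| := by positivity
        linarith
  · have hnn : 0 ≤ 2 * (16 * r) ^ N * |((z : ℂ) ^ N).im| *
        (coeffNorm (cubeCoeff (branchCoeff N γ) d) * (1 / 8) ^ d) := by
      have := coeffNorm_nonneg (cubeCoeff (branchCoeff N γ) d)
      positivity
    rcases lt_trichotomy d (N - 1) with hd | hd | hd
    · rw [angular_sum_lt z hd, if_neg hd.ne]
      simpa using hnn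
    · rw [if_pos hd, ← htop, hd]
      rw [sub_self, norm_zero]
      exact hd ▸ hnn
    · rw [if_neg hd.ne', sub_zero, Real.norm_eq_abs, abs_mul, abs_of_nonneg (pow_nonneg hr d)]
      -- The factor d from the weights costs 2ᵈ, and 2r = 16r · (1/8). As 16r ≤ 1, its d-th power is
      -- at most its N-th power for d ≥ N.
      have h3 : (d : ℝ) * r ^ d ≤ (16 * r) ^ N * (1 / 8) ^ d := by
        have h4 : (d : ℝ) ≤ 2 ^ d := by exact_mod_cast Nat.lt_two_pow_self.le
        have h5 : (16 * r) ^ d ≤ (16 * r) ^ N :=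
          pow_le_pow_of_le_one (by positivity) (by linarith) (by omega)
        calc (d : ℝ) * r ^ d ≤ 2 ^ d * r ^ d := by gcongr
          _ = (16 * r) ^ d * (1 / 8) ^ d := by
            rw [← mul_pow, ← mul_pow]; ring_nf
          _ ≤ _ := by gcongr
      have h6 := coeffNorm_nonneg (cubeCoeff (branchCoeff N γ) d)
      calc _ ≤ (2 * d * coeffNorm (cubeCoeff (branchCoeff N γ) d) * |((z : ℂ) ^ N).im|) * r ^ d :=
            mul_le_mul_of_nonneg_right (abs_angular_sum_le hN z d) (pow_nonneg hr d)
        _ = 2 * coeffNorm (cubeCoeff (branchCoeff N γ) d) * |((z : ℂ) ^ N).im| * (d * r ^ d) := by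
            ring
        _ ≤ 2 * coeffNorm (cubeCoeff (branchCoeff N γ) d) * |((z : ℂ) ^ N).im|
            * ((16 * r) ^ N * (1 / 8) ^ d) := by gcongr
        _ = _ := by ring

end

/-! ### Sign of the leading angular coefficient. -/

section
set_option linter.unusedSectionVars false
variable {N : ℕ} [NeZero N] {γ : ℝ}

/-- The top exponent of a product arises only from top exponents, so the diagonal coefficients obey
a closed scalar recursion. -/
lemma coeff_cubeCoeff_top (γ : ℝ) (d : ℕ) :
    (cubeCoeff (branchCoeff N γ) d).coeff (d : ℤ)
      = cubeCoeff (fun i => (branchCoeff N γ i).coeff (i : ℤ)) d := by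
  have hdeg : ∀ m, DegLE (∑ q ∈ antidiagonal m, branchCoeff N γ q.1 * branchCoeff N γ q.2) m :=
    fun m => DegLE.sum fun q hq => by
      have := (branchCoeff_degLE (N := N) γ q.1).mul (branchCoeff_degLE (N := N) γ q.2)
      rwa [Finset.HasAntidiagonal.mem_antidiagonal.1 hq] at this
  rw [cubeCoeff, cubeCoeff, AddMonoidAlgebra.coeff_sum, Finsupp.finsetSum_apply]
  refine Finset.sum_congr rfl fun p hp => ?_
  have h1 := (hdeg p.1).coeff_mul_top (branchCoeff_degLE (N := N) γ p.2)
  rw [Finset.HasAntidiagonal.mem_antidiagonal.1 hp] at h1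
  rw [h1, AddMonoidAlgebra.coeff_sum, Finsupp.finsetSum_apply]
  congr 1
  refine Finset.sum_congr rfl fun q hq => ?_
  have h2 := (branchCoeff_degLE (N := N) γ q.1).coeff_mul_top (branchCoeff_degLE (N := N) γ q.2)
  rwa [Finset.HasAntidiagonal.mem_antidiagonal.1 hq] at h2

/-- A sequence supported on odd indices with signs alternating along them. -/
def AlternatingAt (b : ℝ) (a : ℕ → ℝ) (d : ℕ) : Prop :=
  (Even d → a d = 0) ∧ ∀ i, d = 2 * i + 1 → b ^ i ≤ (-1) ^ i * a d

lemma cubeCoeff_eq_zero_of_alternating {b : ℝ} {a : ℕ → ℝ} {d : ℕ} (ha0 : a 0 = 0)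
    (h : ∀ e < d, AlternatingAt b a e) (hd : Even d) : cubeCoeff a d = 0 := by
  rw [← sum_fin_eq_cubeCoeff ha0]
  refine Finset.sum_eq_zero fun i _ => Finset.sum_eq_zero fun j _ => Finset.sum_eq_zero fun l _ => ?_
  split_ifs with hs
  · by_cases hi : Even (i : ℕ)
    · rw [(h i i.2).1 hi, zero_mul, zero_mul]
    by_cases hj : Even (j : ℕ)
    · rw [(h j j.2).1 hj, mul_zero, zero_mul]
    · rw [(h l l.2).1, mul_zero]
      rw [← hs] at hd
      rw [Nat.not_even_iff] at hi hj
      rw [Nat.even_iff] at hd ⊢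
      omega
  · rfl

/-- Three odd indices 2i′+1, 2j′+1, 2l′+1 with sum 2m+3 have i′+j′+l′ = m, so all terms share the
sign (−1)ᵐ and cannot cancel. The term with indices 1, 1, 2m+1 already gives the bound. -/
lemma le_cubeCoeff_of_alternating {b : ℝ} (hb : 0 ≤ b) {a : ℕ → ℝ} {m : ℕ} (ha0 : a 0 = 0)
    (ha1 : a 1 = 1) (h : ∀ e < 2 * m + 3, AlternatingAt b a e) :
    b ^ m ≤ (-1) ^ m * cubeCoeff a (2 * m + 3) := by
  rw [← sum_fin_eq_cubeCoeff ha0]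
  simp only [Finset.mul_sum]
  have hnn : ∀ i j l : Fin (2 * m + 3), 0 ≤ (-1) ^ m *
      (if (i : ℕ) + j + l = 2 * m + 3 then a i * a j * a l else 0) := by
    intro i j l
    split_ifs with hs
    · rcases Nat.even_or_odd' (i : ℕ) with ⟨i', hi | hi⟩
      · rw [(h i i.2).1 (by rw [hi]; simp)]; simp
      rcases Nat.even_or_odd' (j : ℕ) with ⟨j', hj | hj⟩
      · rw [(h j j.2).1 (by rw [hj]; simp)]; simp
      rcases Nat.even_or_odd' (l : ℕ) with ⟨l', hl | hl⟩
      · rw [(h l l.2).1 (by rw [hl]; simp)]; simp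
      have e : m = i' + j' + l' := by omega
      have h1 := (pow_nonneg hb i').trans ((h i i.2).2 i' hi)
      have h2 := (pow_nonneg hb j').trans ((h j j.2).2 j' hj)
      have h3 := (pow_nonneg hb l').trans ((h l l.2).2 l' hl)
      have h4 := mul_nonneg (mul_nonneg h1 h2) h3
      have e2 : (-1 : ℝ) ^ m = (-1) ^ i' * (-1) ^ j' * (-1) ^ l' := by rw [e, pow_add, pow_add]
      rw [e2]
      refine h4.trans_eq ?_
      ring
    · simp
  let i1 : Fin (2 * m + 3) := ⟨1, by omega⟩
  let l1 : Fin (2 * m + 3) := ⟨2 * m + 1, by omega⟩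
  have hterm : b ^ m ≤ (-1) ^ m *
      (if (i1 : ℕ) + i1 + l1 = 2 * m + 3 then a i1 * a i1 * a l1 else 0) := by
    rw [if_pos (by simp only [i1, l1]; omega)]
    have := (h (2 * m + 1) (by omega)).2 m rfl
    simpa [i1, l1, ha1] using this
  refine hterm.trans ?_
  refine (Finset.single_le_sum (f := fun l => (-1) ^ m *
    (if (i1 : ℕ) + i1 + (l : Fin (2 * m + 3)) = 2 * m + 3 then a i1 * a i1 * a l else 0))
    (fun l _ => hnn i1 i1 l) (Finset.mem_univ l1)).trans ?_
  refine (Finset.single_le_sum (f := fun j => ∑ l : Fin (2 * m + 3), (-1) ^ m *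
    (if (i1 : ℕ) + (j : Fin (2 * m + 3)) + l = 2 * m + 3 then a i1 * a j * a l else 0))
    (fun j _ => Finset.sum_nonneg fun l _ => hnn i1 j l) (Finset.mem_univ i1)).trans ?_
  exact Finset.single_le_sum (f := fun i => ∑ j : Fin (2 * m + 3), ∑ l : Fin (2 * m + 3), (-1) ^ m *
    (if ((i : Fin (2 * m + 3)) : ℕ) + j + l = 2 * m + 3 then a i * a j * a l else 0))
    (fun i _ => Finset.sum_nonneg fun j _ => Finset.sum_nonneg fun l _ => hnn i j l)
    (Finset.mem_univ i1)

lemma dispersion_le (hN : 4 ≤ N) (hγ : 3 / 4 * gammaOne N ≤ γ) (hγ1 : γ ≤ gammaOne N) (k : ℤ) :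
    dispersion N γ k ≤ 2 * gammaOne N := by
  have h1 : -1 ≤ (toCircle (k : ZMod N) : ℂ).re :=
    neg_le_of_abs_le ((Complex.abs_re_le_norm _).trans (norm_toCircle _).le)
  have h2 := one_le_gammaOne hN
  rw [dispersion]
  nlinarith

lemma not_resonant_of_lt {d : ℕ} (h1 : 1 < d) (h2 : d < N - 1) :
    ¬ Resonant N (d : ℤ) ∧ (((d : ℤ)) : ZMod N) ≠ 0 := by
  have key : ∀ m : ℕ, 0 < m → m < N → ((m : ℕ) : ZMod N) ≠ 0 := by
    intro m hm hm2 h0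
    rw [ZMod.natCast_eq_zero_iff] at h0
    have := Nat.le_of_dvd hm h0
    omega
  rw [Resonant, Int.cast_natCast]
  refine ⟨?_, key d (by omega) (by omega)⟩
  rintro (h | h)
  · apply key (d - 1) (by omega) (by omega)
    rw [Nat.cast_sub h1.le, h]; simp
  · apply key (d + 1) (by omega) (by omega)
    push_cast; rw [h]; simp

/-- Exponents strictly between 1 and N − 1 are neither resonant nor zero, so the dispersion lies in
[1/2, 2γ₁]. Dividing by it with a minus sign flips the sign at each odd step and costs at most a
factor 2γ₁. -/
lemma alternating_branchCoeff (hN : 4 ≤ N) (hγ : 3 / 4 * gammaOne N ≤ γ)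
    (hγ1 : γ ≤ gammaOne N) (d : ℕ) (hd : d < N - 1) :
    AlternatingAt (1 / (2 * gammaOne N)) (fun i => (branchCoeff N γ i).coeff (i : ℤ)) d := by
  have hg := one_le_gammaOne hN
  set a : ℕ → ℝ := fun i => (branchCoeff N γ i).coeff (i : ℤ) with ha
  have ha0 : a 0 = 0 := by simp only [ha]; rw [branchCoeff_zero]; rfl
  have ha1 : a 1 = 1 := by
    simp only [ha]
    rw [branchCoeff_one, AddMonoidAlgebra.coeff_add, Finsupp.add_apply, T_apply, T_apply]
    simp
  have hb : (0 : ℝ) ≤ 1 / (2 * gammaOne N) := by positivity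
  induction d using Nat.strong_induction_on with
  | _ d ih =>
    have ih' : ∀ e < d, AlternatingAt (1 / (2 * gammaOne N)) a e :=
      fun e he => ih e he (by omega)
    by_cases hd0 : d = 0
    · subst hd0
      exact ⟨fun _ => ha0, fun i hi => by omega⟩
    by_cases hd1 : d = 1
    · subst hd1
      refine ⟨fun h => by simp at h, fun i hi => ?_⟩
      obtain rfl : i = 0 := by omega
      simp [ha1]
    obtain ⟨hres, hz⟩ := not_resonant_of_lt (N := N) (d := d) (by omega) hd
    have had : a d = -((dispersion N γ d)⁻¹ * cubeCoeff a d) := by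
      simp only [ha]
      rw [branchCoeff_eq, if_neg hd1, zero_sub, AddMonoidAlgebra.coeff_neg, Finsupp.neg_apply,
        diag_coeff, resolvent, if_neg hres, coeff_cubeCoeff_top]
    have hdisp := half_le_dispersion hN hγ hres hz
    have hdisp2 := dispersion_le hN hγ hγ1 (d : ℤ)
    refine ⟨fun he => ?_, fun i hi => ?_⟩
    · rw [had, cubeCoeff_eq_zero_of_alternating ha0 ih' he, mul_zero, neg_zero]
    · obtain ⟨m, rfl⟩ : ∃ m, i = m + 1 := ⟨i - 1, by omega⟩
      have hd3 : d = 2 * m + 3 := by omega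
      have h1 := le_cubeCoeff_of_alternating hb ha0 ha1 (m := m) (hd3 ▸ ih')
      rw [← hd3] at h1
      have h2 : 1 / (2 * gammaOne N) ≤ (dispersion N γ d)⁻¹ := by
        rw [one_div]; exact inv_anti₀ (by linarith) hdisp2
      rw [had, pow_succ, pow_succ]
      calc (1 / (2 * gammaOne N)) ^ m * (1 / (2 * gammaOne N))
          ≤ ((-1) ^ m * cubeCoeff a d) * (dispersion N γ d)⁻¹ :=
            mul_le_mul h1 h2 hb ((pow_nonneg hb m).trans h1)
        _ = _ := by ring

/-- Evenness of N is essential: N − 1 = 2n + 3 is odd, and the cube is supported on odd degrees. -/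
lemma angularCoeff_bound {n : ℕ} (hn : N = 2 * n + 4) (hγ : 3 / 4 * gammaOne N ≤ γ)
    (hγ1 : γ ≤ gammaOne N) :
    (1 / (2 * gammaOne N)) ^ n ≤ (-1) ^ n * angularCoeff N γ := by
  have hN : 4 ≤ N := by omega
  have hg := one_le_gammaOne hN
  rw [angularCoeff, coeff_cubeCoeff_top, show N - 1 = 2 * n + 3 by omega]
  refine le_cubeCoeff_of_alternating (by positivity) ?_ ?_ fun e he =>
    alternating_branchCoeff hN hγ hγ1 e (by omega)
  · simp only [branchCoeff_zero]; rfl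
  · simp only [branchCoeff_one]
    rw [AddMonoidAlgebra.coeff_add, Finsupp.add_apply, T_apply, T_apply]
    simp

end

/-! ### Symmetries of the branch, the smallness regime, admissible phases. -/

section
set_option linter.unusedSectionVars false
variable {N : ℕ} [NeZero N] {γ r ρ : ℝ}

lemma branch_mul_toCircle (γ r : ℝ) (z : Circle) (k j : ZMod N) :
    branch N γ r (z * toCircle k) j = branch N γ r z (j + k) := by
  simp only [branch]
  rw [mul_assoc, ← AddChar.map_add_eq_mul, add_comm]

lemma branch_inv_neg (hN : 4 ≤ N) (hγ : 3 / 4 * gammaOne N ≤ γ) (hr : 0 ≤ r)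
    (hr1 : r ≤ 1 / 8) (z : Circle) (j : ZMod N) :
    branch N γ r z⁻¹ (-j) = branch N γ r z j := by
  have h1 := hasSum_branch hN hγ hr hr1 z⁻¹ (-j)
  have h2 := hasSum_branch hN hγ hr hr1 z j
  have h3 : ∀ d, circleEval (z⁻¹ * toCircle (-j)) (branchCoeff N γ d)
      = circleEval (z * toCircle j) (branchCoeff N γ d) := by
    intro d
    rw [AddChar.map_neg_eq_inv, ← mul_inv, circleEval_inv]
    exact Complex.conj_eq_iff_im.2 (circleEval_im_of_invert (invert_branchCoeff γ d) _)
  simp only [h3] at h1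
  exact_mod_cast h1.unique h2

lemma branch_zero (hN : 4 ≤ N) (hγ : 3 / 4 * gammaOne N ≤ γ) (z : Circle) :
    branch N γ 0 z = 0 := by
  funext j
  have := abs_branch_le hN hγ le_rfl (by norm_num) z j
  rw [mul_zero] at this
  exact abs_nonpos_iff.1 this

lemma norm_firstMode_le {x : Config N} {e : ℝ} (hx : ∀ j, |x j| ≤ e) :
    ‖firstMode N x‖ ≤ N * e := by
  rw [firstMode_apply]
  refine (norm_sum_le_of_le _ (f := fun j => (x j : ℂ) * (toCircle j : ℂ)) (n := fun _ => e)
    fun j _ => ?_).trans_eq (by simp [ZMod.card])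
  rw [norm_mul, norm_toCircle, mul_one, Complex.norm_real]
  exact hx j

/-- Amplitude and phase are read off from the polar form of the first mode; uniqueness on the
complement does the rest. -/
lemma exists_eq_branch (hN : 4 ≤ N) (hγ : 3 / 4 * gammaOne N ≤ γ) {x : Config N}
    (hx : SolvesComplement N γ x) (hρ : ρ ≤ 1 / 16) (hxe : ∀ j, |x j| ≤ ρ) :
    ∃ r : ℝ, ∃ z : Circle, 0 ≤ r ∧ r ≤ ρ ∧ x = branch N γ r z := by
  have hN0 : (0 : ℝ) < N := by positivity
  have hr : ‖firstMode N x‖ / N ≤ ρ := by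
    rw [div_le_iff₀ hN0, mul_comm]; exact norm_firstMode_le hxe
  have hr0 : 0 ≤ ‖firstMode N x‖ / N := by positivity
  refine ⟨‖firstMode N x‖ / N, Circle.exp (-(firstMode N x).arg), hr0, hr, ?_⟩
  refine hx.eq_of_firstMode_eq hN hγ (solvesComplement_branch hN hγ hr0 (by linarith) _)
    (fun j => (hxe j).trans (by linarith))
    (fun j => (abs_branch_le hN hγ hr0 (by linarith) _ j).trans (by linarith)) ?_
  rw [firstMode_branch hN hγ hr0 (by linarith), ← Circle.coe_inv_eq_conj, ← Circle.exp_neg,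
    neg_neg, Circle.coe_exp]
  have hN0' : (N : ℂ) ≠ 0 := by exact_mod_cast hN0.ne'
  push_cast
  rw [mul_div_cancel₀ _ hN0', Complex.norm_mul_exp_arg_mul_I]

lemma toCircle_half (hEven : Even N) : (toCircle ((N / 2 : ℕ) : ZMod N) : ℂ) = -1 := by
  have hN0 : (N : ℂ) ≠ 0 := by exact_mod_cast NeZero.ne N
  obtain ⟨m, hm⟩ := hEven
  have h2 : N / 2 = m := by omega
  have h3 : (N : ℂ) = 2 * m := by rw [hm]; push_cast; ring
  have hm0 : (m : ℂ) ≠ 0 := by rintro h; rw [h] at h3; simp at h3; exact hN0 (by exact_mod_cast h3)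
  rw [ZMod.toCircle_natCast, h2, ← Complex.exp_pi_mul_I]
  congr 1
  rw [h3]
  field_simp

lemma solvesComplement_neg {x : Config N} (hx : SolvesComplement N γ x) :
    SolvesComplement N γ (-x) := by
  intro g hg
  have h : ∀ j, g j * force N γ (-x) j = -(g j * force N γ x j) := by
    intro j
    simp only [force, linForce_neg, Pi.neg_apply]
    ring
  simp only [h]
  rw [Finset.sum_neg_distrib, hx g hg, neg_zero]

/-- Both sides solve the complement equations, the force being odd, and they have the same first
mode since translation by N/2 multiplies the phase by −1. -/
lemma branch_half (hN : 4 ≤ N) (hEven : Even N) (hγ : 3 / 4 * gammaOne N ≤ γ) (hr : 0 ≤ r)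
    (hr1 : r ≤ 1 / 16) (z : Circle) :
    branch N γ r (z * toCircle ((N / 2 : ℕ) : ZMod N)) = -branch N γ r z := by
  have hr2 : r ≤ 1 / 8 := by linarith
  refine (solvesComplement_branch hN hγ hr hr2 _).eq_of_firstMode_eq hN hγ
    (solvesComplement_neg (solvesComplement_branch hN hγ hr hr2 z))
    (fun j => (abs_branch_le hN hγ hr hr2 _ j).trans (by linarith)) (fun j => ?_) ?_
  · rw [Pi.neg_apply, abs_neg]
    exact (abs_branch_le hN hγ hr hr2 _ j).trans (by linarith)
  · rw [map_neg, firstMode_branch hN hγ hr hr2, firstMode_branch hN hγ hr hr2, Circle.coe_mul,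
      toCircle_half hEven]
    simp

/-- Smallness assumptions on the amplitude bound `ρ` and the distance of `γ` to the threshold. -/
structure Regime (N : ℕ) (γ ρ : ℝ) : Prop where
  four_le : 4 ≤ N
  even : Even N
  le_gamma : 3 / 4 * gammaOne N ≤ γ
  lt_gammaOne : γ < gammaOne N
  pos : 0 < ρ
  le_sixteenth : ρ ≤ 1 / 16
  -- This bound serves the radial estimates. The next one makes the angular error at most half of
  -- the leading coefficient, and the last one lets the a priori bound confine non-synchronised
  -- stationary points to size ρ.
  sq_le : 10000 * N * ρ ^ 2 ≤ 1
  pow_le : 2 * (16 ^ N * ρ) ≤ N * (1 / (2 * gammaOne N)) ^ (N / 2 - 2)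
  eta_le : (4 + 8 * N ^ 3) * (1 - γ / gammaOne N) ≤ ρ ^ 2

lemma Regime.eta_pos (h : Regime N γ ρ) : 0 < 1 - γ / gammaOne N := by
  have := one_le_gammaOne h.four_le
  rw [sub_pos, div_lt_one (by linarith)]
  exact h.lt_gammaOne

/-- `(-1) ^ (N / 2 - 2)`, the sign of the leading coefficient of the angular force. -/
def angularSign (N : ℕ) : ℝ := (-1) ^ (N / 2 - 2)

lemma angularSign_sq (N : ℕ) : angularSign N * angularSign N = 1 := by
  rw [angularSign, ← mul_pow]; simp

lemma Regime.angularCoeff_bound (h : Regime N γ ρ) :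
    2 * (16 ^ N * ρ) ≤ angularSign N * (N * angularCoeff N γ) := by
  obtain ⟨m, hm⟩ := h.even
  have h4 := h.four_le
  have h1 := CoupledChain.angularCoeff_bound (N := N) (n := N / 2 - 2) (by omega) h.le_gamma
    h.lt_gammaOne.le
  have h2 := mul_le_mul_of_nonneg_left h1 (Nat.cast_nonneg (α := ℝ) N)
  have := h.pow_le
  rw [angularSign]
  linarith

/-- The angular force has the sign of its leading term. -/
lemma Regime.angularForce_bound (h : Regime N γ ρ) (hr : 0 ≤ r) (hr1 : r ≤ ρ) (z : Circle) :
    |angularSign N * angularForce N γ r z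
      - angularSign N * (N * angularCoeff N γ) * r ^ (N - 1) * ((z : ℂ) ^ N).im|
      ≤ 16 ^ N * ρ * r ^ (N - 1) * |((z : ℂ) ^ N).im| := by
  have h1 := abs_angularForce_sub_le h.four_le h.le_gamma hr (hr1.trans h.le_sixteenth) z
  have h2 : |angularSign N| = 1 := by rw [angularSign, abs_pow]; simp
  have h3 : angularSign N * angularForce N γ r z
      - angularSign N * (N * angularCoeff N γ) * r ^ (N - 1) * ((z : ℂ) ^ N).im
      = angularSign N * (angularForce N γ r z
        - N * angularCoeff N γ * r ^ (N - 1) * ((z : ℂ) ^ N).im) := by ring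
  rw [h3, abs_mul, h2, one_mul]
  refine h1.trans ?_
  have h4 : (16 * r) ^ N = 16 ^ N * r * r ^ (N - 1) := by
    have h5 := h.four_le
    rw [mul_pow, mul_assoc, ← pow_succ', Nat.sub_add_cancel (by omega)]
  rw [h4]
  gcongr

/-- Leading term and error share the factor r^(N−1) |Im zᴺ|, and the leading coefficient is at least
twice that of the error. -/
lemma Regime.im_pow_eq_zero (h : Regime N γ ρ) (hr : 0 < r) (hr1 : r ≤ ρ) {z : Circle}
    (hz : angularForce N γ r z = 0) : ((z : ℂ) ^ N).im = 0 := by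
  by_contra hne
  have h1 := h.angularForce_bound hr.le hr1 z
  have h2 := h.angularCoeff_bound
  have h3 : 0 < |((z : ℂ) ^ N).im| := abs_pos.2 hne
  have h4 : 0 < r ^ (N - 1) := by positivity
  have h5 : 0 < 16 ^ N * ρ := by have := h.pos; positivity
  rw [hz, mul_zero, zero_sub, abs_neg, abs_mul, abs_mul, abs_of_pos h4,
    abs_of_pos (by linarith : 0 < angularSign N * (N * angularCoeff N γ))] at h1
  have h6 := le_of_mul_le_mul_right h1 h3
  have h7 := le_of_mul_le_mul_right h6 h4
  linarith

lemma Regime.angularForce_eq_zero (h : Regime N γ ρ) (hr : 0 ≤ r) (hr1 : r ≤ ρ) {z : Circle}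
    (hz : ((z : ℂ) ^ N).im = 0) : angularForce N γ r z = 0 := by
  have h1 := abs_angularForce_sub_le h.four_le h.le_gamma hr (hr1.trans h.le_sixteenth) z
  rw [hz] at h1
  simpa using h1

/-- The component of the force along the infinitesimal change of the amplitude. -/
def radialForce (N : ℕ) [NeZero N] (γ r : ℝ) (z : Circle) : ℝ :=
  ((z : ℂ) * firstMode N (force N γ (branch N γ r z))).re

lemma force_branch_eq_zero_iff (hN : 4 ≤ N) (hγ : 3 / 4 * gammaOne N ≤ γ) (hr : 0 ≤ r)
    (hr1 : r ≤ 1 / 8) (z : Circle) :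
    force N γ (branch N γ r z) = 0 ↔ radialForce N γ r z = 0 ∧ angularForce N γ r z = 0 := by
  constructor
  · intro h
    simp [radialForce, angularForce, h]
  · rintro ⟨h1, h2⟩
    refine force_eq_zero_of_firstMode (solvesComplement_branch hN hγ hr hr1 z) ?_
    have : (z : ℂ) * firstMode N (force N γ (branch N γ r z)) = 0 := Complex.ext h1 h2
    exact (mul_eq_zero.1 this).resolve_left (Circle.coe_ne_zero z)

/-- A stationary point is synchronized or lies on the bifurcating branch. -/
lemma Regime.stationary_cases (h : Regime N γ ρ) {x : Config N} (hx : force N γ x = 0) :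
    x = 0 ∨ x = syncPlus N ∨ x = -syncPlus N ∨
      ∃ r : ℝ, ∃ z : Circle, 0 < r ∧ r ≤ ρ ∧ ((z : ℂ) ^ N).im = 0 ∧ x = branch N γ r z := by
  by_cases h0 : x = 0
  · exact Or.inl h0
  by_cases h1 : x = syncPlus N
  · exact Or.inr (Or.inl h1)
  by_cases h2 : x = -syncPlus N
  · exact Or.inr (Or.inr (Or.inl h2))
  have hg := one_le_gammaOne h.four_le
  have hx2 : ∀ j, |x j| ≤ ρ := fun j => by
    refine abs_le_of_sq_le_sq ?_ h.pos.le
    refine (sq_le_of_force_eq_zero h.four_le (by linarith [h.le_gamma]) h.lt_gammaOne.le hx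
      h0 h1 h2 j).trans h.eta_le
  obtain ⟨r, z, hr, hr1, rfl⟩ := exists_eq_branch h.four_le h.le_gamma
    (solvesComplement_of_force_eq_zero hx) h.le_sixteenth hx2
  have hr0 : 0 < r := by
    refine lt_of_le_of_ne hr fun hr0 => h0 ?_
    rw [← hr0, branch_zero h.four_le h.le_gamma]
  have hr2 : r ≤ 1 / 8 := by linarith [h.le_sixteenth]
  exact Or.inr (Or.inr (Or.inr ⟨r, z, hr0, hr1, h.im_pow_eq_zero hr0 hr1
    ((force_branch_eq_zero_iff h.four_le h.le_gamma hr hr2 z).1 hx).2, rfl⟩))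

end

/-! ### The radial equation: existence and uniqueness of the amplitude. -/

section
set_option linter.unusedSectionVars false
variable {N : ℕ} [NeZero N] {γ r s ρ : ℝ}

lemma wave_ofReal_mul (a : ℝ) (w : ℂ) (j : ZMod N) : wave N (a * w) j = a * wave N w j := by
  rw [wave, mul_assoc, Complex.re_ofReal_mul, wave]

lemma abs_wave_circle_le (z : Circle) (j : ZMod N) : |wave N z j| ≤ 1 := by
  refine (Complex.abs_re_le_norm _).trans ?_
  rw [norm_mul, norm_toCircle, Circle.norm_coe, mul_one]

lemma sum_wave_sq (hN : 4 ≤ N) (z : Circle) : ∑ j, wave N z j ^ 2 = N / 2 := by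
  have := sum_wave_mul_wave hN (z : ℂ) z
  rw [circle_mul_conj, Complex.one_re, mul_one] at this
  simpa only [pow_two] using this

/-- Cauchy–Schwarz suffices here and is uniform in z, also for N = 4, where the sum depends on the
phase. -/
lemma le_sum_wave_pow_four (hN : 4 ≤ N) (z : Circle) : (N : ℝ) / 4 ≤ ∑ j, wave N z j ^ 4 := by
  have hN0 : (0 : ℝ) < N := by positivity
  have h := sq_sum_le_card_mul_sum_sq (s := Finset.univ) (f := fun j => wave N z j ^ 2)
  rw [sum_wave_sq hN, Finset.card_univ, ZMod.card] at h
  have h2 : ∑ j, (wave N z j ^ 2) ^ 2 = ∑ j, wave N z j ^ 4 :=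
    Finset.sum_congr rfl fun j _ => by ring
  rw [h2] at h
  refine le_of_mul_le_mul_left (le_trans (le_of_eq ?_) h) hN0
  ring

lemma sum_mul_linForce_wave (hN : 4 ≤ N) (γ : ℝ) (w : ℂ) {g : Config N}
    (hg : firstMode N g = 0) : ∑ j, g j * linForce N γ (wave N w) j = 0 := by
  have : ∀ j, g j * linForce N γ (wave N w) j = (γ / gammaOne N - 1) * (g j * wave N w j) := by
    intro j; rw [linForce_wave hN]; ring
  simp only [this]
  rw [← Finset.mul_sum, sum_mul_wave, hg]
  simp

lemma abs_le_of_sum_sq_le {f : ZMod N → ℝ} {c : ℝ} (hc : 0 ≤ c) (hN : 4 ≤ N)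
    (h : ∑ j, f j ^ 2 ≤ N * c ^ 2) (j : ZMod N) : |f j| ≤ N * c := by
  have hN1 : (1 : ℝ) ≤ N := by exact_mod_cast (by omega : 1 ≤ N)
  refine abs_le_of_sq_le_sq ?_ (by positivity)
  have h1 := Finset.single_le_sum (f := fun j => f j ^ 2) (fun i _ => sq_nonneg _)
    (Finset.mem_univ j)
  refine (h1.trans h).trans ?_
  rw [mul_pow]
  nlinarith [sq_nonneg c]

lemma solvesComplement_zero : SolvesComplement N γ 0 :=
  solvesComplement_of_force_eq_zero (by funext j; simp [force, linForce])

/-- Comparison with the zero solution: the wave absorbs the critical part, and the remainder is at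
most twice the cube in ℓ², that is 2(4r)³√N. -/
lemma abs_branch_sub_wave_le (hN : 4 ≤ N) (hγ : 3 / 4 * gammaOne N ≤ γ) (hr : 0 ≤ r)
    (hr1 : r ≤ 1 / 8) (z : Circle) (j : ZMod N) :
    |branch N γ r z j - 2 * r * wave N z j| ≤ N * (128 * r ^ 3) := by
  have h := (solvesComplement_branch hN hγ hr hr1 z).sub_bound hN hγ solvesComplement_zero
    (a := wave N ((2 * r : ℝ) * z)) (fun g hg => sum_mul_linForce_wave hN γ _ hg) (by
      rw [sub_zero, map_sub, firstMode_branch hN hγ hr hr1, firstMode_wave hN, map_mul,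
        Complex.conj_ofReal]
      push_cast; ring)
  simp only [wave_ofReal_mul, Pi.zero_apply, sub_zero] at h
  refine abs_le_of_sum_sq_le (f := fun j => branch N γ r z j - 2 * r * wave N z j)
    (by positivity) hN (h.trans ?_) j
  have h2 : ∑ j, (branch N γ r z j ^ 3 - 0 ^ 3) ^ 2 ≤ ∑ _j : ZMod N, (4 * r) ^ 6 := by
    refine Finset.sum_le_sum fun j _ => ?_
    have h3 := pow_le_pow_left₀ (abs_nonneg _) (abs_branch_le hN hγ hr hr1 z j) 6
    rw [← abs_pow] at h3
    calc _ = branch N γ r z j ^ 6 := by ring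
      _ ≤ _ := (le_abs_self _).trans h3
  rw [Finset.sum_const, Finset.card_univ, ZMod.card, nsmul_eq_mul] at h2
  calc _ ≤ 4 * (N * (4 * r) ^ 6) := by linarith
    _ = _ := by ring

/-- The remainder is bounded by 9216 s⁴ times the squared difference D itself. As this factor is at
most 1/4, D can be absorbed, giving the first bound, which is then inserted to give the second. -/
lemma sum_branch_sub_sq_le (hN : 4 ≤ N) (hγ : 3 / 4 * gammaOne N ≤ γ) (hr : 0 ≤ r)
    (hrs : r ≤ s) (hs : s ≤ 1 / 16) (z : Circle) :
    ∑ j, (branch N γ s z j - branch N γ r z j) ^ 2 ≤ 16 * N * (s - r) ^ 2 ∧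
    ∑ j, (branch N γ s z j - branch N γ r z j - 2 * (s - r) * wave N z j) ^ 2
      ≤ N * (384 * s ^ 2 * (s - r)) ^ 2 := by
  have hs0 : 0 ≤ s := hr.trans hrs
  have h := (solvesComplement_branch hN hγ hs0 (by linarith) z).sub_bound hN hγ
    (solvesComplement_branch hN hγ hr (by linarith) z)
    (a := wave N ((2 * (s - r) : ℝ) * z)) (fun g hg => sum_mul_linForce_wave hN γ _ hg) (by
      rw [map_sub, map_sub, firstMode_branch hN hγ hr (by linarith),
        firstMode_branch hN hγ hs0 (by linarith), firstMode_wave hN, map_mul,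
        Complex.conj_ofReal]
      push_cast; ring)
  simp only [wave_ofReal_mul] at h
  set D : ZMod N → ℝ := fun j => branch N γ s z j - branch N γ r z j with hD
  set a : ZMod N → ℝ := fun j => 2 * (s - r) * wave N z j with ha
  have h2 : ∑ j, (branch N γ s z j ^ 3 - branch N γ r z j ^ 3) ^ 2
      ≤ (3 * (4 * s) ^ 2) ^ 2 * ∑ j, D j ^ 2 := by
    rw [Finset.mul_sum]
    refine Finset.sum_le_sum fun j _ => sq_cube_sub_cube_le
      (abs_branch_le hN hγ hs0 (by linarith) z j)
      ((abs_branch_le hN hγ hr (by linarith) z j).trans (by linarith))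
  have hD0 : 0 ≤ ∑ j, D j ^ 2 := Finset.sum_nonneg fun j _ => sq_nonneg _
  have h3 : ∑ j, (D j - a j) ^ 2 ≤ 9216 * s ^ 4 * ∑ j, D j ^ 2 := by
    calc _ ≤ 4 * ((3 * (4 * s) ^ 2) ^ 2 * ∑ j, D j ^ 2) := by linarith
      _ = _ := by ring
  have hs4 : 9216 * s ^ 4 ≤ 1 / 4 := by
    have : s ^ 4 ≤ (1 / 16) ^ 4 := pow_le_pow_left₀ hs0 hs 4
    norm_num at this ⊢
    linarith
  have ha2 : ∑ j, a j ^ 2 = 2 * N * (s - r) ^ 2 := by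
    have : ∀ j, a j ^ 2 = 4 * (s - r) ^ 2 * wave N z j ^ 2 := fun j => by simp only [ha]; ring
    simp only [this]
    rw [← Finset.mul_sum, sum_wave_sq hN]
    ring
  have h4 : ∑ j, D j ^ 2 ≤ 2 * ∑ j, (D j - a j) ^ 2 + 2 * ∑ j, a j ^ 2 := by
    rw [Finset.mul_sum, Finset.mul_sum, ← Finset.sum_add_distrib]
    exact Finset.sum_le_sum fun j _ => by nlinarith [sq_nonneg (D j - 2 * a j)]
  have h5 : ∑ j, D j ^ 2 ≤ 16 * N * (s - r) ^ 2 := by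
    nlinarith [mul_le_mul_of_nonneg_right hs4 hD0]
  refine ⟨h5, h3.trans ?_⟩
  calc 9216 * s ^ 4 * ∑ j, D j ^ 2 ≤ 9216 * s ^ 4 * (16 * N * (s - r) ^ 2) := by gcongr
    _ = _ := by ring

lemma continuousOn_branch (hN : 4 ≤ N) (hγ : 3 / 4 * gammaOne N ≤ γ) (z : Circle) (j : ZMod N) :
    ContinuousOn (fun r => branch N γ r z j) (Set.Icc 0 (1 / 16)) := by
  have key : ∀ r s : ℝ, 0 ≤ r → r ≤ s → s ≤ 1 / 16 →
      |branch N γ s z j - branch N γ r z j| ≤ N * (4 * |s - r|) := by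
    intro r s hr hrs hs
    refine abs_le_of_sum_sq_le (f := fun j => branch N γ s z j - branch N γ r z j)
      (by positivity) hN ?_ j
    refine (sum_branch_sub_sq_le hN hγ hr hrs hs z).1.trans_eq ?_
    rw [mul_pow, sq_abs]; ring
  have hlip : LipschitzOnWith (N * 4) (fun r => branch N γ r z j) (Set.Icc 0 (1 / 16)) := by
    refine LipschitzOnWith.of_dist_le_mul fun r hr s hs => ?_
    rw [Real.dist_eq, Real.dist_eq]
    push_cast
    rcases le_total r s with hrs | hrs
    · have := key r s hr.1 hrs hs.2
      rw [abs_sub_comm, abs_sub_comm r s]; linarith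
    · have := key s r hs.1 hrs hr.2
      linarith
  exact hlip.continuousOn

lemma radialForce_eq (hN : 4 ≤ N) (hγ : 3 / 4 * gammaOne N ≤ γ) (hr : 0 ≤ r)
    (hr1 : r ≤ 1 / 8) (z : Circle) :
    radialForce N γ r z
      = ∑ j, branch N γ r z j ^ 3 * wave N z j - (1 - γ / gammaOne N) * (N * r) := by
  have h1 : force N γ (branch N γ r z)
      = (fun j => branch N γ r z j ^ 3) + linForce N γ (branch N γ r z) := rfl
  rw [radialForce, h1, map_add, mul_add, Complex.add_re, ← sum_mul_wave, firstMode_linForce hN,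
    firstMode_branch hN hγ hr hr1]
  have h2 : (z : ℂ) * (((γ / gammaOne N - 1 : ℝ) : ℂ) * (N * r * (starRingEnd ℂ) (z : ℂ)))
      = (((γ / gammaOne N - 1) * (N * r) : ℝ) : ℂ) := by
    push_cast
    linear_combination ((γ / gammaOne N - 1) * (N * r) : ℂ) * circle_mul_conj z
  rw [h2, Complex.ofReal_re]
  ring

lemma abs_cube_mul_sub_le {x c e : ℝ} (hr : 0 ≤ r) (hc : |c| ≤ 1) (hx : |x| ≤ 4 * r)
    (he : |x - 2 * r * c| ≤ e) : |x ^ 3 * c - 8 * r ^ 3 * c ^ 4| ≤ 28 * r ^ 2 * e := by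
  have h0 : 0 ≤ e := (abs_nonneg _).trans he
  have h1 : x ^ 3 * c - 8 * r ^ 3 * c ^ 4
      = (x - 2 * r * c) * ((x ^ 2 + x * (2 * r * c) + (2 * r * c) ^ 2) * c) := by ring
  have hb : |2 * r * c| ≤ 2 * r := by
    rw [abs_mul, abs_of_nonneg (by positivity : 0 ≤ 2 * r)]
    exact mul_le_of_le_one_right (by positivity) hc
  have h2 : |x ^ 2 + x * (2 * r * c) + (2 * r * c) ^ 2| ≤ 28 * r ^ 2 := by
    refine (abs_add_three _ _ _).trans ?_
    rw [abs_mul, abs_pow, abs_pow]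
    calc _ ≤ (4 * r) ^ 2 + (4 * r) * (2 * r) + (2 * r) ^ 2 := by gcongr
      _ = _ := by ring
  rw [h1, abs_mul, abs_mul]
  calc _ ≤ e * (28 * r ^ 2 * 1) := by gcongr
    _ = _ := by ring

lemma abs_sum_cube_mul_wave_sub_le (hN : 4 ≤ N) (hγ : 3 / 4 * gammaOne N ≤ γ) (hr : 0 ≤ r)
    (hr1 : r ≤ 1 / 8) (z : Circle) :
    |∑ j, branch N γ r z j ^ 3 * wave N z j - 8 * r ^ 3 * ∑ j, wave N z j ^ 4|
      ≤ 3584 * N ^ 2 * r ^ 5 := by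
  rw [Finset.mul_sum, ← Finset.sum_sub_distrib]
  refine (Finset.abs_sum_le_sum_abs _ _).trans ((Finset.sum_le_sum fun j _ =>
    abs_cube_mul_sub_le hr (abs_wave_circle_le z j) (abs_branch_le hN hγ hr hr1 z j)
      (abs_branch_sub_wave_le hN hγ hr hr1 z j)).trans_eq ?_)
  rw [Finset.sum_const, Finset.card_univ, ZMod.card, nsmul_eq_mul]
  ring

lemma Regime.le_sum_cube_mul_wave (h : Regime N γ ρ) (hr : 0 ≤ r) (hr1 : r ≤ ρ) (z : Circle) :
    N * r ^ 3 ≤ ∑ j, branch N γ r z j ^ 3 * wave N z j := by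
  have hr2 : r ≤ 1 / 8 := by linarith [h.le_sixteenth]
  have h1 := (abs_le.1 (abs_sum_cube_mul_wave_sub_le h.four_le h.le_gamma hr hr2 z)).1
  have h2 := le_sum_wave_pow_four h.four_le z
  have hr3 : 0 ≤ r ^ 3 := by positivity
  have h3 := mul_le_mul_of_nonneg_left h2 (by positivity : 0 ≤ 8 * r ^ 3)
  have h4 : r ^ 2 ≤ ρ ^ 2 := pow_le_pow_left₀ hr hr1 2
  have h5 : 10000 * N * r ^ 2 ≤ 1 :=
    (mul_le_mul_of_nonneg_left h4 (by positivity)).trans h.sq_le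
  have h6 := mul_le_mul_of_nonneg_right h5 (by positivity : 0 ≤ N * r ^ 3)
  nlinarith

lemma sum_cube_mul_wave_le (hN : 4 ≤ N) (hγ : 3 / 4 * gammaOne N ≤ γ) (hr : 0 ≤ r)
    (hr1 : r ≤ 1 / 8) (z : Circle) :
    ∑ j, branch N γ r z j ^ 3 * wave N z j ≤ 64 * N * r ^ 3 := by
  refine (Finset.sum_le_sum fun j _ => (le_abs_self _).trans (?_ : _ ≤ (4 * r) ^ 3 * 1)).trans_eq ?_
  · rw [abs_mul, abs_pow]
    gcongr
    · exact abs_branch_le hN hγ hr hr1 z j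
    · exact abs_wave_circle_le z j
  · rw [Finset.sum_const, Finset.card_univ, ZMod.card, nsmul_eq_mul]
    ring

/-- The cubic part lies between N r³ and 64 N r³ and competes with ηNr. With b² = 2η the radial
force is therefore nonpositive at b/16 and nonnegative at b. -/
lemma Regime.exists_radialForce_eq_zero (h : Regime N γ ρ) (z : Circle) :
    ∃ r, 0 < r ∧ r ≤ ρ ∧ radialForce N γ r z = 0 := by
  have hη := h.eta_pos
  set η := 1 - γ / gammaOne N with hηdef
  have hN0 : (0 : ℝ) < N := by have := h.four_le; positivity
  have hb : Real.sqrt (2 * η) ≤ ρ := by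
    refine Real.sqrt_le_iff.2 ⟨h.pos.le, ?_⟩
    have h1 := h.eta_le
    have h2 : 0 ≤ 8 * (N : ℝ) ^ 3 * η := by positivity
    nlinarith
  set b := Real.sqrt (2 * η) with hbdef
  have hb2 : b ^ 2 = 2 * η := Real.sq_sqrt (by positivity)
  have hb0 : 0 < b := Real.sqrt_pos.2 (by positivity)
  have hρ := h.le_sixteenth
  have hcont : ContinuousOn (fun r => radialForce N γ r z) (Set.Icc (b / 16) b) := by
    have hsub : Set.Icc (b / 16) b ⊆ Set.Icc 0 (1 / 16) :=
      Set.Icc_subset_Icc (by positivity) (by linarith)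
    refine ContinuousOn.congr (f := fun r => ∑ j, branch N γ r z j ^ 3 * wave N z j - η * (N * r))
      ?_ fun r hr => ?_
    · refine ContinuousOn.sub (continuousOn_finsetSum _ fun j _ => ?_) (by fun_prop)
      exact (((continuousOn_branch h.four_le h.le_gamma z j).mono hsub).pow 3).mul_const _
    · have := hsub hr
      exact radialForce_eq h.four_le h.le_gamma this.1 (by linarith [this.2]) z
  have ha : radialForce N γ (b / 16) z ≤ 0 := by
    rw [radialForce_eq h.four_le h.le_gamma (by positivity) (by linarith)]
    have h1 := sum_cube_mul_wave_le h.four_le h.le_gamma (r := b / 16) (by positivity)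
      (by linarith) z
    have h2 : 64 * N * (b / 16) ^ 3 = (1 / 4 * b ^ 2) * (N * (b / 16)) := by ring
    rw [h2, hb2] at h1
    have h3 : 0 < η * (N * (b / 16)) := by positivity
    nlinarith
  have hbb : 0 ≤ radialForce N γ b z := by
    rw [radialForce_eq h.four_le h.le_gamma hb0.le (by linarith)]
    have h1 := h.le_sum_cube_mul_wave hb0.le hb z
    have h2 : N * b ^ 3 = b ^ 2 * (N * b) := by ring
    rw [h2, hb2] at h1
    have h3 : 0 < η * (N * b) := by positivity
    linarith
  obtain ⟨r, hr, hr0⟩ := intermediate_value_Icc (by linarith) hcont ⟨ha, hbb⟩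
  exact ⟨r, by linarith [hr.1], hr.2.trans hb, hr0⟩

lemma Regime.exists_stationary (h : Regime N γ ρ) {z : Circle} (hz : ((z : ℂ) ^ N).im = 0) :
    ∃ r, 0 < r ∧ r ≤ ρ ∧ force N γ (branch N γ r z) = 0 := by
  obtain ⟨r, hr, hr1, hr2⟩ := h.exists_radialForce_eq_zero z
  refine ⟨r, hr, hr1, ?_⟩
  rw [force_branch_eq_zero_iff h.four_le h.le_gamma hr.le (by linarith [h.le_sixteenth])]
  exact ⟨hr2, h.angularForce_eq_zero hr.le hr1 hz⟩

/-- Each equation is paired with the other solution; the symmetric linear part cancels. -/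
lemma sum_mul_mul_sq_sub_sq_eq_zero {x y : Config N} (hx : force N γ x = 0)
    (hy : force N γ y = 0) : ∑ j, x j * y j * (y j ^ 2 - x j ^ 2) = 0 := by
  have h := sum_linForce_mul_comm γ x y
  have h1 : ∀ j, linForce N γ x j = -x j ^ 3 := fun j => by
    have := congrFun hx j
    simp only [force, Pi.zero_apply] at this
    linarith
  have h2 : ∀ j, linForce N γ y j = -y j ^ 3 := fun j => by
    have := congrFun hy j
    simp only [force, Pi.zero_apply] at this
    linarith
  simp only [h1, h2] at h
  have h3 : ∑ j, x j * y j * (y j ^ 2 - x j ^ 2)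
      = ∑ j, -x j ^ 3 * y j - ∑ j, x j * -y j ^ 3 := by
    rw [← Finset.sum_sub_distrib]
    exact Finset.sum_congr rfl fun j _ => by ring
  rw [h3, h, sub_self]

/-- The loss 7/4 is harmless: in the application a = 2c, where c is the wave, and the mean of a⁴
over the lattice is at least 4. -/
lemma prod_four_perturb {a e₁ e₂ e₃ e₄ ε : ℝ} (ha : |a| ≤ 2) (hε : ε ≤ 1 / 20)
    (h₁ : |e₁| ≤ ε) (h₂ : |e₂| ≤ ε) (h₃ : |e₃| ≤ ε) (h₄ : |e₄| ≤ ε) :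
    a ^ 4 - 7 / 4 ≤ (a + e₁) * (a + e₂) * (a + e₃) * (a + e₄) := by
  have hε0 : 0 ≤ ε := (abs_nonneg _).trans h₁
  have h : ∀ e : ℝ, |e| ≤ ε → |a + e| ≤ 41 / 20 := fun e he =>
    (abs_add_le _ _).trans (by linarith)
  have h1 : (a + e₁) * (a + e₂) * (a + e₃) * (a + e₄) - a ^ 4
      = e₁ * ((a + e₂) * (a + e₃) * (a + e₄)) + a * e₂ * ((a + e₃) * (a + e₄))
        + a * a * e₃ * (a + e₄) + a * a * a * e₄ := by ring
  have b1 : |e₁ * ((a + e₂) * (a + e₃) * (a + e₄))|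
      ≤ 1 / 20 * (41 / 20 * (41 / 20) * (41 / 20)) := by
    simp only [abs_mul]
    have := h e₂ h₂; have := h e₃ h₃; have := h e₄ h₄; have := h₁.trans hε
    gcongr
  have b2 : |a * e₂ * ((a + e₃) * (a + e₄))| ≤ 2 * (1 / 20) * (41 / 20 * (41 / 20)) := by
    simp only [abs_mul]
    have := h e₃ h₃; have := h e₄ h₄; have := h₂.trans hε
    gcongr
  have b3 : |a * a * e₃ * (a + e₄)| ≤ 2 * 2 * (1 / 20) * (41 / 20) := by
    simp only [abs_mul]
    have := h e₄ h₄; have := h₃.trans hε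
    gcongr
  have b4 : |a * a * a * e₄| ≤ 2 * 2 * 2 * (1 / 20) := by
    simp only [abs_mul]
    have := h₄.trans hε
    gcongr
  have := (abs_le.1 b1).1
  have := (abs_le.1 b2).1
  have := (abs_le.1 b3).1
  have := (abs_le.1 b4).1
  linarith

/-- For two solutions x, y on one ray, Σ xy(y − x)(y + x) = 0. But each factor is its amplitude
times 2c up to a small relative error, so the sum is close to rs(s − r)(s + r) · 16 Σ c⁴ > 0. -/
lemma Regime.radius_unique_aux (h : Regime N γ ρ) {z : Circle} (hr : 0 < r) (hrs : r < s)
    (hs : s ≤ ρ) (hfr : force N γ (branch N γ r z) = 0)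
    (hfs : force N γ (branch N γ s z) = 0) : False := by
  have hN := h.four_le
  have hγ := h.le_gamma
  have hρ := h.le_sixteenth
  have hN0 : (0 : ℝ) < N := by positivity
  have hs0 : 0 < s := hr.trans hrs
  have hsr : 0 < s - r := sub_pos.2 hrs
  set c := wave N z with hc
  set ε : ℝ := 400 * N * ρ ^ 2 with hε
  have hε1 : ε ≤ 1 / 20 := by have := h.sq_le; rw [hε]; linarith
  have hsq : ∀ t : ℝ, 0 ≤ t → t ≤ ρ → t ^ 2 ≤ ρ ^ 2 := fun t h0 h1 => pow_le_pow_left₀ h0 h1 2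
  have hrel : ∀ t : ℝ, 0 < t → t ≤ ρ → ∀ j,
      ∃ e, |e| ≤ ε ∧ branch N γ t z j = t * (2 * c j + e) := by
    intro t ht htρ j
    refine ⟨branch N γ t z j / t - 2 * c j, ?_, by field_simp; ring⟩
    have h1 := abs_branch_sub_wave_le hN hγ ht.le (by linarith) z j
    have h2 : branch N γ t z j / t - 2 * c j = (branch N γ t z j - 2 * t * c j) / t := by
      field_simp
    rw [h2, abs_div, abs_of_pos ht, div_le_iff₀ ht]
    refine h1.trans ?_
    have h3 : t ^ 3 = t ^ 2 * t := by ring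
    have h4 := mul_le_mul_of_nonneg_right (hsq t ht.le htρ) (by positivity : 0 ≤ N * t)
    rw [h3, hε]
    have h5 : 0 ≤ N * ρ ^ 2 * t := by positivity
    nlinarith
  have hdiff : ∀ j, ∃ e, |e| ≤ ε ∧
      branch N γ s z j - branch N γ r z j = (s - r) * (2 * c j + e) := by
    intro j
    refine ⟨(branch N γ s z j - branch N γ r z j) / (s - r) - 2 * c j, ?_, by field_simp; ring⟩
    have h1 := abs_le_of_sum_sq_le (f := fun j => branch N γ s z j - branch N γ r z j
      - 2 * (s - r) * wave N z j) (by positivity) hN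
      (sum_branch_sub_sq_le hN hγ hr.le hrs.le (hs.trans hρ) z).2 j
    have h2 : (branch N γ s z j - branch N γ r z j) / (s - r) - 2 * c j
        = (branch N γ s z j - branch N γ r z j - 2 * (s - r) * c j) / (s - r) := by
      field_simp
    rw [h2, abs_div, abs_of_pos hsr, div_le_iff₀ hsr]
    refine h1.trans ?_
    have h4 := mul_le_mul_of_nonneg_right (hsq s hs0.le hs) (by positivity : 0 ≤ N * (s - r))
    rw [hε]
    have h5 : 0 ≤ N * ρ ^ 2 * (s - r) := by positivity
    nlinarith
  have hsum : ∀ j, ∃ e, |e| ≤ ε ∧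
      branch N γ s z j + branch N γ r z j = (s + r) * (2 * c j + e) := by
    intro j
    obtain ⟨e1, he1, h1⟩ := hrel s hs0 hs j
    obtain ⟨e2, he2, h2⟩ := hrel r hr (hrs.le.trans hs) j
    refine ⟨(s * e1 + r * e2) / (s + r), ?_, by rw [h1, h2]; field_simp; ring⟩
    rw [abs_div, abs_of_pos (by linarith : 0 < s + r), div_le_iff₀ (by linarith)]
    refine (abs_add_le _ _).trans ?_
    rw [abs_mul, abs_mul, abs_of_pos hs0, abs_of_pos hr]
    nlinarith
  have hpair := sum_mul_mul_sq_sub_sq_eq_zero hfr hfs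
  have hle : ∑ j, r * s * (s - r) * (s + r) * (16 * c j ^ 4 - 7 / 4)
      ≤ ∑ j, branch N γ r z j * branch N γ s z j
        * (branch N γ s z j ^ 2 - branch N γ r z j ^ 2) := by
    refine Finset.sum_le_sum fun j _ => ?_
    obtain ⟨e1, he1, h1⟩ := hrel r hr (hrs.le.trans hs) j
    obtain ⟨e2, he2, h2⟩ := hrel s hs0 hs j
    obtain ⟨e3, he3, h3⟩ := hdiff j
    obtain ⟨e4, he4, h4⟩ := hsum j
    have h5 : branch N γ s z j ^ 2 - branch N γ r z j ^ 2
        = ((s - r) * (2 * c j + e3)) * ((s + r) * (2 * c j + e4)) := by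
      rw [← h3, ← h4]; ring
    rw [h5, h1, h2]
    have hcj : |2 * c j| ≤ 2 := by
      rw [abs_mul, abs_two]
      have := abs_wave_circle_le z j
      linarith
    have h6 := prod_four_perturb hcj hε1 he1 he2 he3 he4
    have h7 : 0 ≤ r * s * (s - r) * (s + r) := by positivity
    calc _ = r * s * (s - r) * (s + r) * ((2 * c j) ^ 4 - 7 / 4) := by ring
      _ ≤ _ := mul_le_mul_of_nonneg_left h6 h7
      _ = _ := by ring
  rw [hpair, ← Finset.mul_sum, Finset.sum_sub_distrib, ← Finset.mul_sum, Finset.sum_const,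
    Finset.card_univ, ZMod.card, nsmul_eq_mul] at hle
  have h8 := le_sum_wave_pow_four hN z
  have h9 : 0 < r * s * (s - r) * (s + r) := by positivity
  have h10 : 0 < 16 * ∑ j, c j ^ 4 - N * (7 / 4) := by
    rw [hc]; linarith
  have := mul_pos h9 h10
  linarith

lemma Regime.radius_unique (h : Regime N γ ρ) {z : Circle} (hr : 0 < r) (hr1 : r ≤ ρ)
    (hs0 : 0 < s) (hs : s ≤ ρ) (hfr : force N γ (branch N γ r z) = 0)
    (hfs : force N γ (branch N γ s z) = 0) : r = s := by
  rcases lt_trichotomy r s with hlt | heq | hlt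
  · exact (h.radius_unique_aux hr hlt hs hfr hfs).elim
  · exact heq
  · exact (h.radius_unique_aux hs0 hlt hr1 hfs hfr).elim

end

/-! ### Dependence on the phase and the slope of the angular force. -/

section
set_option linter.unusedSectionVars false
variable {N : ℕ} [NeZero N] {γ r s ρ : ℝ}

lemma hasDerivAt_circle_exp_zpow (w : Circle) (k : ℤ) (θ : ℝ) :
    HasDerivAt (fun θ : ℝ => ((w * Circle.exp θ : Circle) : ℂ) ^ k)
      (((w * Circle.exp θ : Circle) : ℂ) ^ k * (k * Complex.I)) θ := by
  have h1 : ∀ θ : ℝ, ((w * Circle.exp θ : Circle) : ℂ) ^ k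
      = (w : ℂ) ^ k * Complex.exp ((θ : ℂ) * (k * Complex.I)) := by
    intro θ
    rw [Circle.coe_mul, mul_zpow, Circle.coe_exp, ← Complex.exp_int_mul]
    ring_nf
  simp only [h1]
  have h2 := (Complex.ofRealCLM.hasDerivAt (x := θ)).mul_const (k * Complex.I)
  have h3 := (h2.cexp).const_mul ((w : ℂ) ^ k)
  simp only [Complex.ofRealCLM_apply, Complex.ofReal_one, one_mul] at h3
  rw [mul_assoc]
  exact h3

lemma hasDerivAt_circleEval (w : Circle) (p : ℝ[T;T⁻¹]) (θ : ℝ) :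
    HasDerivAt (fun θ : ℝ => circleEval (w * Circle.exp θ) p)
      (∑ k ∈ p.coeff.support, p.coeff k *
        (((w * Circle.exp θ : Circle) : ℂ) ^ k * (k * Complex.I))) θ := by
  simp only [circleEval_eq_sum (subset_refl p.coeff.support)]
  exact HasDerivAt.fun_sum fun k _ => (hasDerivAt_circle_exp_zpow w k θ).const_mul _

lemma norm_deriv_circleEval_le {p : ℝ[T;T⁻¹]} {d : ℕ} (hp : DegLE p d) (w : Circle) :
    ‖∑ k ∈ p.coeff.support, (p.coeff k : ℂ) * ((w : ℂ) ^ k * (k * Complex.I))‖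
      ≤ d * coeffNorm p := by
  rw [coeffNorm, Finset.mul_sum]
  refine norm_sum_le_of_le _ fun k hk => ?_
  have h1 : |(k : ℝ)| ≤ d := by
    by_contra! hlt
    exact Finsupp.mem_support_iff.1 hk (hp k (by exact_mod_cast hlt))
  rw [norm_mul, norm_mul, norm_mul, norm_zpow, Circle.norm_coe, one_zpow, one_mul,
    Complex.norm_I, mul_one, Complex.norm_real, Real.norm_eq_abs, Complex.norm_intCast, mul_comm]
  exact mul_le_mul_of_nonneg_right h1 (abs_nonneg _)

/-- Differentiating degree d costs a factor d ≤ 2ᵈ, so the majorant is the series at radius 2r;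
hence r ≤ 1/16 in place of 1/8. -/
lemma differentiable_branch (hN : 4 ≤ N) (hγ : 3 / 4 * gammaOne N ≤ γ) (hr : 0 ≤ r)
    (hr1 : r ≤ 1 / 16) (z : Circle) (j : ZMod N) :
    Differentiable ℝ fun θ : ℝ => branch N γ r (z * Circle.exp θ) j := by
  have hu := summable_coeffNorm hN hγ (r := 2 * r) (by linarith) (by linarith)
  have h := differentiable_tsum' hu
    (g := fun d θ => circleEval (z * toCircle j * Circle.exp θ) (branchCoeff N γ d) * (r : ℂ) ^ d)
    (fun d θ => (hasDerivAt_circleEval (z * toCircle j) (branchCoeff N γ d) θ).mul_const _)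
    (fun d θ => by
      rw [norm_mul, norm_pow, Complex.norm_real, Real.norm_of_nonneg hr, mul_pow]
      refine (mul_le_mul_of_nonneg_right
        (norm_deriv_circleEval_le (branchCoeff_degLE γ d) _) (pow_nonneg hr d)).trans ?_
      have h2 : (d : ℝ) ≤ 2 ^ d := by exact_mod_cast d.lt_two_pow_self.le
      have := mul_le_mul_of_nonneg_right h2
        (mul_nonneg (coeffNorm_nonneg (branchCoeff N γ d)) (pow_nonneg hr d))
      linarith)
  have h2 : Differentiable ℝ fun θ : ℝ => (∑' d, circleEval (z * toCircle j * Circle.exp θ)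
      (branchCoeff N γ d) * (r : ℂ) ^ d).re := Complex.reCLM.differentiable.comp h
  simpa only [branch, mul_right_comm] using h2

/-- The derivative of the branch with respect to the phase. -/
def phaseVelocity (N : ℕ) [NeZero N] (γ r : ℝ) (z : Circle) : Config N :=
  fun j => deriv (fun θ : ℝ => branch N γ r (z * Circle.exp θ) j) 0

lemma hasDerivAt_branch (hN : 4 ≤ N) (hγ : 3 / 4 * gammaOne N ≤ γ) (hr : 0 ≤ r)
    (hr1 : r ≤ 1 / 16) (z : Circle) (j : ZMod N) :
    HasDerivAt (fun θ : ℝ => branch N γ r (z * Circle.exp θ) j) (phaseVelocity N γ r z j) 0 :=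
  (differentiable_branch hN hγ hr hr1 z j 0).hasDerivAt

lemma hasDerivAt_firstMode {X : ℝ → Config N} {v : Config N} {θ : ℝ}
    (h : ∀ j, HasDerivAt (fun θ => X θ j) (v j) θ) :
    HasDerivAt (fun θ => firstMode N (X θ)) (firstMode N v) θ := by
  simp only [firstMode_apply]
  exact HasDerivAt.fun_sum fun j _ => (h j).ofReal_comp.mul_const _

lemma firstMode_phaseVelocity (hN : 4 ≤ N) (hγ : 3 / 4 * gammaOne N ≤ γ) (hr : 0 ≤ r)
    (hr1 : r ≤ 1 / 16) (z : Circle) :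
    firstMode N (phaseVelocity N γ r z) = -(N * r * Complex.I * (starRingEnd ℂ) (z : ℂ)) := by
  have h1 := hasDerivAt_firstMode (hasDerivAt_branch hN hγ hr hr1 z)
  have h2 := ((hasDerivAt_circle_exp_zpow z (-1) 0)).const_mul (N * r : ℂ)
  have h3 : ∀ θ : ℝ, ((z * Circle.exp θ : Circle) : ℂ) ^ (-1 : ℤ)
      = (starRingEnd ℂ) ((z * Circle.exp θ : Circle) : ℂ) := fun θ => by
    rw [zpow_neg_one, ← Circle.coe_inv, Circle.coe_inv_eq_conj]
  simp only [firstMode_branch hN hγ hr (by linarith : r ≤ 1 / 8)] at h1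
  simp only [h3] at h2
  rw [h1.unique h2, Circle.exp_zero, mul_one]
  push_cast
  ring

lemma hasDerivAt_force {X : ℝ → Config N} {v : Config N} {θ : ℝ}
    (h : ∀ j, HasDerivAt (fun θ => X θ j) (v j) θ) (j : ZMod N) :
    HasDerivAt (fun θ => force N γ (X θ) j) (hessOp N γ (X θ) v j) θ := by
  have := ((h j).fun_pow 3).add ((h j).neg.sub
    ((((h (j + 1)).add (h (j - 1))).sub ((h j).const_mul 2)).const_mul (γ / 2)))
  convert! this using 1

lemma hasDerivAt_force_branch (hN : 4 ≤ N) (hγ : 3 / 4 * gammaOne N ≤ γ) (hr : 0 ≤ r)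
    (hr1 : r ≤ 1 / 16) (z : Circle) (j : ZMod N) :
    HasDerivAt (fun θ : ℝ => force N γ (branch N γ r (z * Circle.exp θ)) j)
      (hessOp N γ (branch N γ r z) (phaseVelocity N γ r z) j) 0 := by
  have := hasDerivAt_force (γ := γ) (hasDerivAt_branch hN hγ hr hr1 z) j
  simpa only [Circle.exp_zero, mul_one] using this

/-- Derivative of the complement equations, which hold for every phase. -/
lemma sum_mul_hessOp_phaseVelocity (hN : 4 ≤ N) (hγ : 3 / 4 * gammaOne N ≤ γ) (hr : 0 ≤ r)
    (hr1 : r ≤ 1 / 16) (z : Circle) {g : Config N} (hg : firstMode N g = 0) :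
    ∑ j, g j * hessOp N γ (branch N γ r z) (phaseVelocity N γ r z) j = 0 := by
  have h := HasDerivAt.fun_sum (u := Finset.univ) fun (j : ZMod N) _ =>
    (hasDerivAt_force_branch hN hγ hr hr1 z j).const_mul (g j)
  simp only [fun θ : ℝ => solvesComplement_branch hN hγ hr (by linarith : r ≤ 1 / 8)
    (z * Circle.exp θ) g hg] at h
  exact h.unique (hasDerivAt_const 0 0)

/-- The derivative of the angular force with respect to the phase at a stationary point. -/
def angularSlope (N : ℕ) [NeZero N] (γ r : ℝ) (z : Circle) : ℝ :=
  ((z : ℂ) * firstMode N (hessOp N γ (branch N γ r z) (phaseVelocity N γ r z))).im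

lemma hasDerivAt_angularForce (hN : 4 ≤ N) (hγ : 3 / 4 * gammaOne N ≤ γ) (hr : 0 ≤ r)
    (hr1 : r ≤ 1 / 16) {z : Circle} (hz : force N γ (branch N γ r z) = 0) :
    HasDerivAt (fun θ : ℝ => angularForce N γ r (z * Circle.exp θ)) (angularSlope N γ r z) 0 := by
  have h1 := hasDerivAt_firstMode (hasDerivAt_force_branch hN hγ hr hr1 z)
  have h2 := hasDerivAt_circle_exp_zpow z 1 0
  have h3 := Complex.imCLM.hasFDerivAt.comp_hasDerivAt (0 : ℝ) (h2.mul h1)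
  simp only [zpow_one, Circle.exp_zero, mul_one, hz, map_zero, mul_zero, zero_add] at h3
  exact h3

/-- Removing from the phase velocity its critical part, a wave with amplitude 2r·iz, leaves an
admissible test configuration. So only the pairing with that wave survives, and it is −2r times the
slope. -/
lemma hessForm_phaseVelocity (hN : 4 ≤ N) (hγ : 3 / 4 * gammaOne N ≤ γ) (hr : 0 ≤ r)
    (hr1 : r ≤ 1 / 16) (z : Circle) :
    hessForm N γ (branch N γ r z) (phaseVelocity N γ r z) = -(2 * r * angularSlope N γ r z) := by
  set v := phaseVelocity N γ r z with hv
  set f := hessOp N γ (branch N γ r z) v with hf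
  have h1 := sum_mul_hessOp_phaseVelocity hN hγ hr hr1 z
    (g := v - wave N ((2 * r : ℝ) * (Complex.I * z))) (by
      rw [map_sub, firstMode_phaseVelocity hN hγ hr hr1, firstMode_wave hN, map_mul, map_mul,
        Complex.conj_I, Complex.conj_ofReal]
      push_cast; ring)
  simp only [Pi.sub_apply, sub_mul, Finset.sum_sub_distrib] at h1
  have h2 := sum_mul_wave f ((2 * r : ℝ) * (Complex.I * z))
  rw [mul_assoc, Complex.re_ofReal_mul, mul_assoc Complex.I, Complex.I_mul_re] at h2
  rw [hessForm, sub_eq_zero.1 h1, Finset.sum_congr rfl fun j _ => mul_comm _ _, h2, angularSlope]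
  ring

/-- Passes the error bound for the angular force to its slope at a zero of Im zᴺ, without
differentiating the series of the error. -/
lemma abs_deriv_le_of_abs_le {f g : ℝ → ℝ} {f' g' : ℝ} (hf : HasDerivAt f f' 0)
    (hg : HasDerivAt g g' 0) (h0 : g 0 = 0) (h : ∀ t, |f t| ≤ |g t|) : |f'| ≤ |g'| := by
  have hf0 : f 0 = 0 := by have := h 0; rw [h0, abs_zero] at this; exact abs_nonpos_iff.1 this
  refine le_of_tendsto_of_tendsto hf.tendsto_slope_zero.abs hg.tendsto_slope_zero.abs
    (Eventually.of_forall fun t => ?_)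
  simp only [zero_add, hf0, h0, sub_zero, smul_eq_mul, abs_mul]
  exact mul_le_mul_of_nonneg_left (h t) (abs_nonneg _)

lemma re_pow_sq_eq_one {z : Circle} (hz : ((z : ℂ) ^ N).im = 0) : ((z : ℂ) ^ N).re ^ 2 = 1 := by
  have h : ‖(z : ℂ) ^ N‖ ^ 2 = 1 := by rw [norm_pow, Circle.norm_coe, one_pow, one_pow]
  rw [← Complex.normSq_eq_norm_sq, Complex.normSq_apply, hz] at h
  linarith

/-- The slope of Im zᴺ is N Re zᴺ = ±N, and the leading term still dominates after differentiation.
-/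
lemma Regime.angularSlope_pos (h : Regime N γ ρ) (hr : 0 < r) (hr1 : r ≤ ρ) {z : Circle}
    (hz : ((z : ℂ) ^ N).im = 0) (hf : force N γ (branch N γ r z) = 0) :
    0 < angularSign N * ((z : ℂ) ^ N).re * angularSlope N γ r z := by
  have hr2 := hr1.trans h.le_sixteenth
  have hN0 : (0 : ℝ) < N := by have := h.four_le; positivity
  have hA := (hasDerivAt_angularForce h.four_le h.le_gamma hr.le hr2 hf).const_mul (angularSign N)
  have hI : HasDerivAt (fun θ : ℝ => (((z * Circle.exp θ : Circle) : ℂ) ^ N).im)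
      (N * ((z : ℂ) ^ N).re) 0 := by
    have h1 := Complex.imCLM.hasFDerivAt.comp_hasDerivAt (0 : ℝ)
      (hasDerivAt_circle_exp_zpow z N 0)
    simp only [Circle.exp_zero, mul_one, zpow_natCast] at h1
    convert! h1 using 1
    simp [Complex.mul_im, hz]
    ring
  set K := angularSign N * (N * angularCoeff N γ) with hK
  have h2 := h.angularCoeff_bound
  have h5 : 0 < 16 ^ N * ρ := by have := h.pos; positivity
  have hrN : 0 < r ^ (N - 1) := by positivity
  have hle := abs_deriv_le_of_abs_le (hA.sub (hI.const_mul (K * r ^ (N - 1))))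
    (hI.const_mul (16 ^ N * ρ * r ^ (N - 1))) (by simp [hz]) (fun θ => by
      rw [abs_mul, abs_of_pos (by positivity : 0 < 16 ^ N * ρ * r ^ (N - 1))]
      exact h.angularForce_bound hr.le hr1 (z * Circle.exp θ))
  set c := ((z : ℂ) ^ N).re with hc
  have hc2 : c ^ 2 = 1 := re_pow_sq_eq_one hz
  have hc1 : |c| = 1 := by
    rw [← Real.sqrt_sq_eq_abs, hc2, Real.sqrt_one]
  have h6 : |c * (angularSign N * angularSlope N γ r z) - K * r ^ (N - 1) * N|
      ≤ 16 ^ N * ρ * r ^ (N - 1) * N := by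
    have e1 : c * (angularSign N * angularSlope N γ r z) - K * r ^ (N - 1) * N
        = c * (angularSign N * angularSlope N γ r z - K * r ^ (N - 1) * (N * c)) := by
      linear_combination K * r ^ (N - 1) * N * hc2
    rw [e1, abs_mul, hc1, one_mul]
    refine hle.trans_eq ?_
    rw [abs_mul, abs_mul (N : ℝ), hc1, mul_one, abs_of_pos (by positivity), abs_of_pos hN0]
  have h7 := (abs_le.1 h6).1
  have h8 : 0 < (K - 16 ^ N * ρ) * (r ^ (N - 1) * N) :=
    mul_pos (by linarith) (by positivity)
  nlinarith

end

/-! ### Signature of the Hessian at the stationary points. -/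

section
set_option linter.unusedSectionVars false
variable {N : ℕ} [NeZero N] {γ r s ρ : ℝ}

lemma exists_toCircle_eq {w : Circle} (hw : (w : ℂ) ^ N = 1) : ∃ k : ℕ, k < N ∧
    w = toCircle ((k : ℕ) : ZMod N) := by
  obtain ⟨k, hk, h⟩ := (Complex.isPrimitiveRoot_exp N (NeZero.ne N)).eq_pow_of_pow_eq_one hw
  refine ⟨k, hk, Circle.ext ?_⟩
  rw [← h, ZMod.toCircle_natCast, ← Complex.exp_nat_mul]
  congr 1
  ring

lemma branch_add_half (hN : 4 ≤ N) (hEven : Even N) (hγ : 3 / 4 * gammaOne N ≤ γ) (hr : 0 ≤ r)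
    (hr1 : r ≤ 1 / 16) (z : Circle) (j : ZMod N) :
    branch N γ r z (j + ((N / 2 : ℕ) : ZMod N)) = -branch N γ r z j := by
  rw [← branch_mul_toCircle, branch_half hN hEven hγ hr hr1, Pi.neg_apply]

lemma sum_branch (hN : 4 ≤ N) (hEven : Even N) (hγ : 3 / 4 * gammaOne N ≤ γ) (hr : 0 ≤ r)
    (hr1 : r ≤ 1 / 16) (z : Circle) : ∑ j, branch N γ r z j = 0 := by
  have h := Equiv.sum_comp (Equiv.addRight ((N / 2 : ℕ) : ZMod N)) (branch N γ r z)
  simp only [Equiv.coe_addRight, branch_add_half hN hEven hγ hr hr1, Finset.sum_neg_distrib] at h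
  linarith

lemma sum_phaseVelocity (hN : 4 ≤ N) (hEven : Even N) (hγ : 3 / 4 * gammaOne N ≤ γ) (hr : 0 ≤ r)
    (hr1 : r ≤ 1 / 16) (z : Circle) : ∑ j, phaseVelocity N γ r z j = 0 := by
  have h := HasDerivAt.fun_sum (u := Finset.univ) fun (j : ZMod N) _ =>
    hasDerivAt_branch hN hγ hr hr1 z j
  simp only [sum_branch hN hEven hγ hr hr1] at h
  exact h.unique (hasDerivAt_const 0 0)

/-- As z² is an N-th root of unity, conjugating z amounts to a lattice translation, so a lattice
reflection fixes the branch at z and reverses θ around it. -/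
lemma exists_branch_reflection (hN : 4 ≤ N) (hγ : 3 / 4 * gammaOne N ≤ γ) (hr : 0 ≤ r)
    (hr1 : r ≤ 1 / 8) {z : Circle} (hz : ((z : ℂ) ^ N).im = 0) :
    ∃ m : ZMod N, ∀ (θ : ℝ) (j : ZMod N),
      branch N γ r (z * Circle.exp (-θ)) (m - j) = branch N γ r (z * Circle.exp θ) j := by
  have h1 : ((z ^ 2 : Circle) : ℂ) ^ N = 1 := by
    rw [Circle.coe_pow, ← pow_mul, mul_comm, pow_mul]
    refine Complex.ext ?_ ?_
    · have := re_pow_sq_eq_one hz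
      rw [pow_two, Complex.mul_re, hz, Complex.one_re]
      linarith
    · simp [pow_two, hz]
  obtain ⟨k, -, hk⟩ := exists_toCircle_eq h1
  refine ⟨-(k : ZMod N), fun θ j => ?_⟩
  rw [← branch_inv_neg hN hγ hr hr1 (z * Circle.exp θ) j, neg_sub_left, neg_add, ← branch_mul_toCircle,
    AddChar.map_neg_eq_inv, ← hk, Circle.exp_neg]
  congr 1
  rw [mul_inv, pow_two, mul_inv, mul_right_comm, mul_inv_cancel_left, mul_comm]

/-- By the reflection Σ x⁴ is even in the phase around z, so its derivative vanishes there. -/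
lemma sum_cube_mul_phaseVelocity (hN : 4 ≤ N) (hγ : 3 / 4 * gammaOne N ≤ γ)
    (hr : 0 ≤ r) (hr1 : r ≤ 1 / 16) {z : Circle} (hz : ((z : ℂ) ^ N).im = 0) :
    ∑ j, branch N γ r z j ^ 3 * phaseVelocity N γ r z j = 0 := by
  obtain ⟨m, hm⟩ := exists_branch_reflection hN hγ hr (by linarith) hz
  have h := HasDerivAt.fun_sum (u := Finset.univ) fun (j : ZMod N) _ =>
    (hasDerivAt_branch hN hγ hr hr1 z j).fun_pow 4
  have heven : ∀ θ : ℝ, ∑ j, branch N γ r (z * Circle.exp (-θ)) j ^ 4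
      = ∑ j, branch N γ r (z * Circle.exp θ) j ^ 4 := by
    intro θ
    simp only [← hm θ]
    exact (Equiv.sum_comp (Equiv.subLeft m) fun j => branch N γ r (z * Circle.exp (-θ)) j ^ 4).symm
  have h2 := HasDerivAt.comp (0 : ℝ) (h₂ := fun θ : ℝ => ∑ j, branch N γ r (z * Circle.exp θ) j ^ 4)
    (h := Neg.neg) (by rw [neg_zero]; exact h) (hasDerivAt_neg (0 : ℝ))
  simp only [Function.comp_def, heven] at h2
  have h3 := h.unique h2
  simp only [Circle.exp_zero, mul_one] at h3
  have h4 : ∑ j, ((4 : ℕ) : ℝ) * branch N γ r z j ^ (4 - 1) * phaseVelocity N γ r z j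
      = 4 * ∑ j, branch N γ r z j ^ 3 * phaseVelocity N γ r z j := by
    rw [Finset.mul_sum]
    exact Finset.sum_congr rfl fun j _ => by push_cast; ring
  rw [h4] at h3
  linarith

lemma hessOp_add (x v w : Config N) :
    hessOp N γ x (v + w) = hessOp N γ x v + hessOp N γ x w := by
  funext j; simp only [hessOp, linForce_add, Pi.add_apply]; ring

lemma hessOp_smul (x : Config N) (a : ℝ) (v : Config N) :
    hessOp N γ x (a • v) = a • hessOp N γ x v := by
  funext j; simp only [hessOp, linForce_smul, Pi.smul_apply, smul_eq_mul]; ring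

lemma hessForm_smul (x : Config N) (a : ℝ) (v : Config N) :
    hessForm N γ x (a • v) = a ^ 2 * hessForm N γ x v := by
  simp only [hessForm, hessOp_smul, Pi.smul_apply, smul_eq_mul, Finset.mul_sum]
  exact Finset.sum_congr rfl fun j _ => by ring

lemma hessForm_add (x v w : Config N) :
    hessForm N γ x (v + w)
      = hessForm N γ x v + hessForm N γ x w + 2 * ∑ j, v j * hessOp N γ x w j := by
  have h := sum_hessOp_mul_comm γ x v w
  simp only [hessForm, hessOp_add, Pi.add_apply, add_mul, mul_add, Finset.sum_add_distrib]
  have h2 : ∑ j, w j * hessOp N γ x v j = ∑ j, hessOp N γ x v j * w j :=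
    Finset.sum_congr rfl fun j _ => mul_comm _ _
  rw [h2, h]
  ring

lemma hessOp_self {x : Config N} (hx : force N γ x = 0) (j : ZMod N) :
    hessOp N γ x x j = 2 * x j ^ 3 := by
  have := congrFun hx j
  simp only [force, Pi.zero_apply] at this
  simp only [hessOp]
  linear_combination this

lemma hessForm_self {x : Config N} (hx : force N γ x = 0) :
    hessForm N γ x x = 2 * ∑ j, x j ^ 4 := by
  rw [hessForm, Finset.mul_sum]
  exact Finset.sum_congr rfl fun j _ => by rw [hessOp_self hx]; ring

lemma hessForm_const_neg {x : Config N} (hx : ∀ j, |x j| ≤ 1 / 2) :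
    hessForm N γ x (fun _ => 1) < 0 := by
  have : ∀ j, 1 * hessOp N γ x (fun _ => 1) j ≤ -(1 / 4) := by
    intro j
    have h1 := sq_le_sq' (by linarith [(abs_le.1 (hx j)).1]) (abs_le.1 (hx j)).2
    simp only [hessOp, linForce_const]
    linarith
  refine (Finset.sum_le_sum fun j _ => this j).trans_lt ?_
  have hN0 : (0 : ℝ) < N := by exact_mod_cast Nat.pos_of_ne_zero (NeZero.ne N)
  rw [Finset.sum_const, Finset.card_univ, ZMod.card, nsmul_eq_mul]
  linarith

lemma half_sum_sq_le_hessForm (hN : 4 ≤ N) (hγ : 3 / 4 * gammaOne N ≤ γ) (x : Config N)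
    {u : Config N} (hu : ∑ j, u j = 0) (hu1 : firstMode N u = 0) :
    1 / 2 * ∑ j, u j ^ 2 ≤ hessForm N γ x u := by
  refine (half_sum_sq_le hN hγ hu hu1).trans (Finset.sum_le_sum fun j _ => ?_)
  simp only [hessOp]
  nlinarith [sq_nonneg (x j * u j)]

lemma sum_sq_pos {u : Config N} (hu : u ≠ 0) : 0 < ∑ j, u j ^ 2 := by
  obtain ⟨j, hj⟩ := Function.ne_iff.1 hu
  exact Finset.sum_pos' (fun i _ => sq_nonneg _) ⟨j, Finset.mem_univ j, sq_pos_of_ne_zero hj⟩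

/-- At a stationary point the Hessian maps x to 2x³, so the cross term is 4a Σ x³u. Completing the
square absorbs it into half of each diagonal term, using 4x² ≤ 1/4. -/
lemma le_hessForm_sub {x u : Config N} (hx : force N γ x = 0) (hxe : ∀ j, |x j| ≤ 1 / 4) (a : ℝ)
    (hu : 1 / 2 * ∑ j, u j ^ 2 ≤ hessForm N γ x u) :
    a ^ 2 * ∑ j, x j ^ 4 + 1 / 4 * ∑ j, u j ^ 2 ≤ hessForm N γ x (a • x + u) := by
  have h1 : ∑ j, (a • x) j * hessOp N γ x u j = ∑ j, 2 * a * x j ^ 3 * u j := by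
    rw [← sum_hessOp_mul_comm, hessOp_smul]
    refine Finset.sum_congr rfl fun j _ => ?_
    rw [Pi.smul_apply, hessOp_self hx, smul_eq_mul]; ring
  have h2 : -(1 / 4 * ∑ j, u j ^ 2) - a ^ 2 * ∑ j, x j ^ 4
      ≤ 2 * ∑ j, 2 * a * x j ^ 3 * u j := by
    rw [Finset.mul_sum, Finset.mul_sum, Finset.mul_sum, ← Finset.sum_neg_distrib,
      ← Finset.sum_sub_distrib]
    refine Finset.sum_le_sum fun j _ => ?_
    have h3 := sq_le_sq' (by linarith [(abs_le.1 (hxe j)).1]) (abs_le.1 (hxe j)).2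
    nlinarith [sq_nonneg (a * x j ^ 2 + 2 * x j * u j), mul_le_mul_of_nonneg_right h3 (sq_nonneg (u j))]
  rw [hessForm_add, hessForm_smul, hessForm_self hx, h1]
  linarith

/-- Positivity of the Hessian on vanishing mean, up to the phase direction. -/
lemma Regime.hessForm_pos (h : Regime N γ ρ) (hr : 0 < r) (hr1 : r ≤ ρ) {z : Circle}
    (hz : ((z : ℂ) ^ N).im = 0) (hf : force N γ (branch N γ r z) = 0) {w : Config N}
    (hw0 : w ≠ 0) (hw : ∑ j, w j = 0)
    (hb : 0 < hessForm N γ (branch N γ r z) (phaseVelocity N γ r z) ∨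
      ((z : ℂ) * firstMode N w).im = 0) :
    0 < hessForm N γ (branch N γ r z) w := by
  have hN := h.four_le
  have hγ := h.le_gamma
  have hr2 := hr1.trans h.le_sixteenth
  have hN0 : (0 : ℝ) < N := by positivity
  set x := branch N γ r z with hx
  set v := phaseVelocity N γ r z with hv
  have hxe : ∀ j, |x j| ≤ 1 / 4 := fun j =>
    (abs_branch_le hN hγ hr.le (by linarith) z j).trans (by linarith)
  set q := (z : ℂ) * firstMode N w with hq
  set a := q.re / (N * r) with ha
  set b := -q.im / (N * r) with hbdef
  set u := w - a • x - b • v with hu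
  have hu1 : firstMode N u = 0 := by
    have hx1 : firstMode N x = _ := firstMode_branch hN hγ hr.le (by linarith) z
    have hv1 : firstMode N v = _ := firstMode_phaseVelocity hN hγ hr.le hr2 z
    have hNr : (N * r : ℂ) ≠ 0 := by exact_mod_cast (by positivity : (N : ℝ) * r ≠ 0)
    have e1 : (a : ℂ) * (N * r) = q.re := by
      rw [ha]; push_cast; exact div_mul_cancel₀ _ hNr
    have e2 : (b : ℂ) * (N * r) = -q.im := by
      rw [hbdef]; push_cast; exact div_mul_cancel₀ _ hNr
    have e3 : firstMode N w = (starRingEnd ℂ) (z : ℂ) * q := by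
      rw [hq, ← mul_assoc, mul_comm ((starRingEnd ℂ) _), circle_mul_conj, one_mul]
    rw [hu, map_sub, map_sub, map_smul, map_smul, hx1, hv1, Complex.real_smul, Complex.real_smul,
      e3]
    nth_rewrite 1 [← Complex.re_add_im q]
    linear_combination (-(starRingEnd ℂ) (z : ℂ)) * e1
      + Complex.I * (starRingEnd ℂ) (z : ℂ) * e2
  have hu0 : ∑ j, u j = 0 := by
    have h1 := sum_branch hN h.even hγ hr.le hr2 z
    have h2 := sum_phaseVelocity hN h.even hγ hr.le hr2 z
    simp only [hu, hx, hv, Pi.sub_apply, Pi.smul_apply, smul_eq_mul, Finset.sum_sub_distrib,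
      ← Finset.mul_sum, h1, h2, hw]
    ring
  have hdecomp : w = b • v + (a • x + u) := by rw [hu]; abel
  -- The phase direction is Hessian-orthogonal to x by the evenness of Σ x⁴, and to `u` by the
  -- differentiated complement equations.
  have hcross : ∑ j, v j * hessOp N γ x (a • x + u) j = 0 := by
    have h1 := sum_cube_mul_phaseVelocity hN hγ hr.le hr2 hz
    have h2 : ∑ j, u j * hessOp N γ x v j = 0 := sum_mul_hessOp_phaseVelocity hN hγ hr.le hr2 z hu1
    have h3 : ∀ j, v j * hessOp N γ x (a • x + u) j
        = 2 * a * (x j ^ 3 * v j) + v j * hessOp N γ x u j := by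
      intro j
      rw [hessOp_add, hessOp_smul, Pi.add_apply, Pi.smul_apply, hessOp_self hf, smul_eq_mul]
      ring
    simp only [h3, Finset.sum_add_distrib, ← Finset.mul_sum]
    rw [← sum_hessOp_mul_comm, Finset.sum_congr rfl fun j _ => mul_comm (hessOp N γ x v j) (u j),
      h2, h1]
    ring
  have hcross2 : ∑ j, (b • v) j * hessOp N γ x (a • x + u) j = 0 := by
    simp only [Pi.smul_apply, smul_eq_mul, mul_assoc]
    rw [← Finset.mul_sum, hcross, mul_zero]
  have hlow := le_hessForm_sub hf hxe a (half_sum_sq_le_hessForm hN hγ x hu0 hu1)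
  have hx4 : 0 < ∑ j, x j ^ 4 := by
    have hxne : x ≠ 0 := by
      intro h0
      have hx1 : firstMode N x = _ := firstMode_branch hN hγ hr.le (by linarith) z
      rw [h0, map_zero] at hx1
      have : (N * r : ℂ) ≠ 0 := by exact_mod_cast (by positivity : (N : ℝ) * r ≠ 0)
      exact (mul_ne_zero this ((map_ne_zero _).2 (Circle.coe_ne_zero z))) hx1.symm
    have := sum_sq_pos (N := N) (u := fun j => x j ^ 2) (fun h0 => hxne (funext fun j =>
      pow_eq_zero_iff (two_ne_zero) |>.1 (congrFun h0 j)))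
    simpa only [← pow_mul] using this
  have hu2 : 0 ≤ ∑ j, u j ^ 2 := Finset.sum_nonneg fun _ _ => sq_nonneg _
  have hform : hessForm N γ x w = b ^ 2 * hessForm N γ x v + hessForm N γ x (a • x + u) := by
    conv_lhs => rw [hdecomp]
    rw [hessForm_add, hessForm_smul, hcross2]; ring
  have hbv : 0 ≤ b ^ 2 * hessForm N γ x v := by
    rcases hb with hb | hb
    · positivity
    · rw [hbdef, hb]; simp
  have ha2 : 0 ≤ a ^ 2 * ∑ j, x j ^ 4 := by positivity
  rw [hform]
  by_contra hcon
  have hu3 : ∑ j, u j ^ 2 = 0 := by linarith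
  have hu4 : u = 0 := by
    by_contra hne
    exact (sum_sq_pos hne).ne' hu3
  have ha3 : a = 0 := by
    have : a ^ 2 * ∑ j, x j ^ 4 = 0 := by linarith
    simpa using (mul_eq_zero.1 this).resolve_right hx4.ne'
  have hb3 : b = 0 := by
    rcases hb with hb | hb
    · have : b ^ 2 * hessForm N γ x v = 0 := by linarith
      simpa using (mul_eq_zero.1 this).resolve_right hb.ne'
    · rw [hbdef, hb]; simp
  rw [hu4, ha3, hb3] at hdecomp
  exact hw0 (by simpa using hdecomp)

/-- Negativity makes `f` injective, and the kernel of `g` has dimension at least N − k, so no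
dimension of a subspace has to be computed by hand. -/
lemma hessian_index {E F : Type*} [AddCommGroup E] [Module ℝ E] [FiniteDimensional ℝ E]
    [AddCommGroup F] [Module ℝ F] [FiniteDimensional ℝ F] {x : Config N} {k : ℕ}
    (f : E →ₗ[ℝ] Config N) (g : Config N →ₗ[ℝ] F) (hE : Module.finrank ℝ E = k)
    (hF : Module.finrank ℝ F = k) (hf : ∀ e, e ≠ 0 → hessForm N γ x (f e) < 0)
    (hg : ∀ w, w ≠ 0 → g w = 0 → 0 < hessForm N γ x w) :
    numNeg N γ x = k ∧ numNeg N γ x + numPos N γ x = N := by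
  refine hessian_index_of_subspaces (LinearMap.range f) (LinearMap.ker g) ?_ ?_ ?_
    fun w hw hw0 => hg w hw0 (LinearMap.mem_ker.1 hw)
  · rw [LinearMap.finrank_range_of_inj, hE]
    rw [← LinearMap.ker_eq_bot, LinearMap.ker_eq_bot']
    intro e he
    by_contra hne
    have := hf e hne
    rw [he] at this
    simp [hessForm] at this
  · have h1 := g.finrank_range_add_finrank_ker
    have h2 := (LinearMap.range g).finrank_le
    rw [Module.finrank_fintype_fun_eq_card, ZMod.card] at h1
    omega
  · rintro _ ⟨e, rfl⟩ he
    exact hf e fun h0 => he (by rw [h0, map_zero])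

/-- The total of a configuration. -/
def totalMap (N : ℕ) [NeZero N] : Config N →ₗ[ℝ] ℝ := ∑ j, LinearMap.proj j

lemma totalMap_apply (w : Config N) : totalMap N w = ∑ j, w j := by
  simp [totalMap]

lemma hessForm_zero_wave (hN : 4 ≤ N) (a : ℝ) (w : ℂ) :
    hessForm N γ 0 ((fun _ => a) + wave N w)
      = -(N * a ^ 2) - (1 - γ / gammaOne N) * (N / 2 * Complex.normSq w) := by
  have h1 : ∑ j : ZMod N, a * wave N w j = 0 := by
    rw [sum_mul_wave (fun _ => a), firstMode_const hN]; simp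
  rw [← Finset.mul_sum] at h1
  have h2 := sum_wave_mul_wave hN w w
  rw [Complex.mul_conj, Complex.ofReal_re] at h2
  have h3 : ∀ j, ((fun _ => a) + wave N w : Config N) j *
      hessOp N γ 0 ((fun _ => a) + wave N w) j
      = -a ^ 2 + (γ / gammaOne N - 2) * (a * wave N w j)
        + (γ / gammaOne N - 1) * (wave N w j * wave N w j) := by
    intro j
    simp only [hessOp, linForce_add, Pi.add_apply, linForce_const, linForce_wave hN, Pi.zero_apply]
    ring
  simp only [hessForm, h3]
  rw [Finset.sum_add_distrib, Finset.sum_add_distrib, ← Finset.mul_sum,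
    ← Finset.mul_sum, ← Finset.mul_sum, h1, h2, Finset.sum_const, Finset.card_univ, ZMod.card, nsmul_eq_mul]
  ring

end

section
set_option linter.unusedSectionVars false
variable {N : ℕ} [NeZero N] {γ r s ρ : ℝ}

/-- The waves, as a linear map. -/
def waveMap (N : ℕ) [NeZero N] : ℂ →ₗ[ℝ] Config N where
  toFun := wave N
  map_add' v w := by funext j; simp only [wave, add_mul, Complex.add_re, Pi.add_apply]
  map_smul' a w := by
    funext j
    rw [Complex.real_smul, wave_ofReal_mul, RingHom.id_apply, Pi.smul_apply, smul_eq_mul]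

lemma index_zero (hN : 4 ≤ N) (hγ : 3 / 4 * gammaOne N ≤ γ) (hγ1 : γ < gammaOne N) :
    numNeg N γ 0 = 3 ∧ numNeg N γ 0 + numPos N γ 0 = N := by
  have hη : 0 < 1 - γ / gammaOne N := by
    have := one_le_gammaOne hN
    rw [sub_pos, div_lt_one (by linarith)]
    exact hγ1
  have hN0 : (0 : ℝ) < N := by positivity
  refine hessian_index (E := ℝ × ℂ) (F := ℝ × ℂ)
    ((LinearMap.pi fun _ => LinearMap.id).coprod (waveMap N)) ((totalMap N).prod (firstMode N))
    (by simp) (by simp) (fun e he => ?_) fun w hw0 hw => ?_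
  · have h1 : ((LinearMap.pi fun _ => LinearMap.id).coprod (waveMap N)) e
        = (fun _ => e.1 : Config N) + wave N e.2 := rfl
    rw [h1, hessForm_zero_wave hN]
    have h2 : 0 ≤ (1 - γ / gammaOne N) * (N / 2 * Complex.normSq e.2) := by
      have := Complex.normSq_nonneg e.2
      positivity
    by_cases he1 : e.1 = 0
    · have he2 : e.2 ≠ 0 := fun h => he (Prod.ext he1 h)
      have := Complex.normSq_pos.2 he2
      have h3 : 0 < (1 - γ / gammaOne N) * (N / 2 * Complex.normSq e.2) := by positivity
      nlinarith [sq_nonneg e.1]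
    · have h3 : 0 < N * e.1 ^ 2 := by positivity
      linarith
  · have h1 := Prod.ext_iff.1 hw
    simp only [LinearMap.prod_apply, Function.prod_apply, totalMap_apply, Prod.fst_zero,
      Prod.snd_zero] at h1
    have := half_sum_sq_le_hessForm hN hγ 0 h1.1 h1.2
    linarith [sum_sq_pos hw0]

lemma index_of_sq_eq_one (hγ : 0 ≤ γ) {x : Config N} (hx : ∀ j, x j ^ 2 = 1) :
    numNeg N γ x = 0 ∧ numNeg N γ x + numPos N γ x = N := by
  refine hessian_index (E := Fin 0 → ℝ) (F := Fin 0 → ℝ) 0 0 (by simp) (by simp)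
    (fun e he => (he (Subsingleton.elim _ _)).elim) fun w hw0 _ => ?_
  have h1 : hessForm N γ x w = 3 * ∑ j, w j ^ 2 + ∑ j, linForce N γ w j * w j := by
    rw [hessForm, Finset.mul_sum, ← Finset.sum_add_distrib]
    exact Finset.sum_congr rfl fun j _ => by rw [hessOp, hx]; ring
  have h2 := sum_linForce_mul γ w w
  have h3 : 0 ≤ γ / 2 * ∑ j, (w (j + 1) - w j) * (w (j + 1) - w j) :=
    mul_nonneg (by linarith) (Finset.sum_nonneg fun j _ => mul_self_nonneg _)
  have h4 : ∑ j, w j * w j = ∑ j, w j ^ 2 := Finset.sum_congr rfl fun j _ => by ring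
  have := sum_sq_pos hw0
  rw [h1, h2, h4]
  linarith

lemma Regime.abs_branch_le_half (h : Regime N γ ρ) (hr : 0 < r) (hr1 : r ≤ ρ) (z : Circle)
    (j : ZMod N) : |branch N γ r z j| ≤ 1 / 2 := by
  have := h.le_sixteenth
  exact (abs_branch_le h.four_le h.le_gamma hr.le (by linarith) z j).trans (by linarith)

lemma Regime.index_one (h : Regime N γ ρ) (hr : 0 < r) (hr1 : r ≤ ρ) {z : Circle}
    (hz : ((z : ℂ) ^ N).im = 0) (hz1 : angularSign N * ((z : ℂ) ^ N).re = -1)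
    (hf : force N γ (branch N γ r z) = 0) :
    numNeg N γ (branch N γ r z) = 1 ∧
      numNeg N γ (branch N γ r z) + numPos N γ (branch N γ r z) = N := by
  have hr2 := hr1.trans h.le_sixteenth
  have hv : 0 < hessForm N γ (branch N γ r z) (phaseVelocity N γ r z) := by
    have h1 := h.angularSlope_pos hr hr1 hz hf
    rw [hz1] at h1
    rw [hessForm_phaseVelocity h.four_le h.le_gamma hr.le hr2]
    nlinarith
  refine hessian_index (LinearMap.toSpanSingleton ℝ _ (fun _ => 1)) (totalMap N) (by simp)
    (by simp) (fun e he => ?_) fun w hw0 hw => ?_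
  · rw [LinearMap.toSpanSingleton_apply, hessForm_smul]
    exact mul_neg_of_pos_of_neg (by positivity)
      (hessForm_const_neg (h.abs_branch_le_half hr hr1 z))
  · rw [totalMap_apply] at hw
    exact h.hessForm_pos hr hr1 hz hf hw0 hw (Or.inl hv)

lemma Regime.index_two (h : Regime N γ ρ) (hr : 0 < r) (hr1 : r ≤ ρ) {z : Circle}
    (hz : ((z : ℂ) ^ N).im = 0) (hz1 : angularSign N * ((z : ℂ) ^ N).re = 1)
    (hf : force N γ (branch N γ r z) = 0) :
    numNeg N γ (branch N γ r z) = 2 ∧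
      numNeg N γ (branch N γ r z) + numPos N γ (branch N γ r z) = N := by
  have hr2 := hr1.trans h.le_sixteenth
  set x := branch N γ r z with hx
  set v := phaseVelocity N γ r z with hvdef
  have hv : hessForm N γ x v < 0 := by
    have h1 := h.angularSlope_pos hr hr1 hz hf
    rw [hz1] at h1
    rw [hessForm_phaseVelocity h.four_le h.le_gamma hr.le hr2]
    nlinarith
  have h1 := hessForm_const_neg (γ := γ) (h.abs_branch_le_half hr hr1 z)
  -- Constants have no first mode, hence are Hessian-orthogonal to the phase velocity; two negative
  -- directions then span a negative plane.
  have h1v : ∑ j, 1 * hessOp N γ x v j = 0 :=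
    sum_mul_hessOp_phaseVelocity h.four_le h.le_gamma hr.le hr2 z (firstMode_const h.four_le 1)
  refine hessian_index (E := ℝ × ℝ) (F := ℝ × ℝ)
    ((LinearMap.toSpanSingleton ℝ _ (fun _ => 1)).coprod (LinearMap.toSpanSingleton ℝ _ v))
    ((totalMap N).prod (Complex.imLm ∘ₗ LinearMap.mulLeft ℝ (z : ℂ) ∘ₗ firstMode N))
    (by simp) (by simp) (fun e he => ?_) fun w hw0 hw => ?_
  · rw [LinearMap.coprod_apply, LinearMap.toSpanSingleton_apply, LinearMap.toSpanSingleton_apply,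
      hessForm_add, hessForm_smul, hessForm_smul, hessOp_smul]
    have h2 : ∑ j, (e.1 • (fun _ => 1 : Config N)) j * (e.2 • hessOp N γ x v) j = 0 := by
      have h3 : ∀ j, (e.1 • (fun _ => 1 : Config N)) j * (e.2 • hessOp N γ x v) j
          = e.1 * e.2 * (1 * hessOp N γ x v j) := fun j => by
        simp only [Pi.smul_apply, smul_eq_mul]; ring
      simp only [h3]
      rw [← Finset.mul_sum, h1v, mul_zero]
    rw [h2]
    by_cases he1 : e.1 = 0
    · have he2 : e.2 ≠ 0 := fun h => he (Prod.ext he1 h)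
      have : 0 < e.2 ^ 2 := by positivity
      nlinarith [sq_nonneg e.1]
    · have : 0 < e.1 ^ 2 := by positivity
      nlinarith [sq_nonneg e.2]
  · have h2 := Prod.ext_iff.1 hw
    simp only [LinearMap.prod_apply, Function.prod_apply, totalMap_apply, Prod.fst_zero,
      Prod.snd_zero] at h2
    exact h.hessForm_pos hr hr1 hz hf hw0 h2.1 (Or.inr h2.2)

end

/-! ### Values of the potential. -/

section
set_option linter.unusedSectionVars false
variable {N : ℕ} [NeZero N] {γ r s ρ : ℝ}

/-- Pairing the equation with x shows that the quadratic part of the potential equals −½ Σ x⁴. -/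
lemma potential_of_force_eq_zero {x : Config N} (hx : force N γ x = 0) :
    potential N γ x = -(1 / 4) * ∑ j, x j ^ 4 := by
  have h1 := sum_linForce_mul γ x x
  have h2 : ∀ j, linForce N γ x j * x j = -x j ^ 4 := fun j => by
    have := congrFun hx j
    simp only [force, Pi.zero_apply] at this
    linear_combination x j * this
  have h3 : ∑ j, (x (j + 1) - x j) * (x (j + 1) - x j) = ∑ j, (x (j + 1) - x j) ^ 2 :=
    Finset.sum_congr rfl fun j _ => by ring
  have h4 : ∑ j, x j * x j = ∑ j, x j ^ 2 := Finset.sum_congr rfl fun j _ => by ring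
  simp only [h2] at h1
  rw [h3, h4, Finset.sum_neg_distrib] at h1
  simp only [potential, localPotential, Finset.sum_sub_distrib, ← Finset.sum_div]
  linarith

lemma sum_re_circle_mul (w : ℂ) {b : ZMod N} (hb : b ≠ 0) :
    ∑ j : ZMod N, (w * toCircle (j * b)).re = 0 := by
  rw [← Complex.re_sum, ← Finset.mul_sum, sum_toCircle_mul, if_neg hb, mul_zero, Complex.zero_re]

/-- The second and fourth harmonics average to zero. The fourth does not when N = 4, which is why
that case is separate. -/
lemma sum_wave_pow_four (h2 : (2 : ZMod N) ≠ 0) (h4 : (4 : ZMod N) ≠ 0) (z : Circle) :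
    ∑ j, wave N z j ^ 4 = 3 / 8 * N := by
  have hsq : ∀ w : Circle, (w : ℂ).re ^ 2 = 1 / 2 * (1 + ((w : ℂ) ^ 2).re) := by
    intro w
    have := circle_mul_conj w
    rw [Complex.mul_conj, ← Complex.ofReal_one, Complex.ofReal_inj, Complex.normSq_apply] at this
    rw [pow_two (w : ℂ), Complex.mul_re]
    linarith
  have h : ∀ j, wave N z j ^ 4 = 3 / 8 + 1 / 2 * ((z : ℂ) ^ 2 * toCircle (j * 2)).re
      + 1 / 8 * ((z : ℂ) ^ 4 * toCircle (j * 4)).re := by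
    intro j
    have e1 := hsq (z * toCircle j)
    have e2 := hsq ((z * toCircle j) ^ 2)
    have e3 := toCircle_zsmul j 2
    have e4 := toCircle_zsmul j 4
    norm_cast at e3 e4
    rw [Circle.coe_pow, Circle.coe_mul, ← pow_mul, mul_pow, mul_pow] at e2
    rw [Circle.coe_mul, mul_pow] at e1
    push_cast at e3 e4 e1 e2
    rw [e3] at e1 e2
    rw [e4] at e2
    rw [wave]
    have e5 : ((z : ℂ) * toCircle j).re ^ 4 = (((z : ℂ) * toCircle j).re ^ 2) ^ 2 := by ring
    rw [e5, e1]
    linear_combination 1 / 4 * e2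
  simp only [h, Finset.sum_add_distrib, ← Finset.mul_sum, sum_re_circle_mul _ h2,
    sum_re_circle_mul _ h4, Finset.sum_const, Finset.card_univ, ZMod.card, nsmul_eq_mul]
  ring

lemma abs_pow_four_sub_le {x c e : ℝ} (hr : 0 ≤ r) (hc : |c| ≤ 1) (hx : |x| ≤ 4 * r)
    (he : |x - 2 * r * c| ≤ e) : |x ^ 4 - 16 * r ^ 4 * c ^ 4| ≤ 120 * r ^ 3 * e := by
  have h0 : 0 ≤ e := (abs_nonneg _).trans he
  have h1 : x ^ 4 - 16 * r ^ 4 * c ^ 4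
      = (x - 2 * r * c) * ((x + 2 * r * c) * (x ^ 2 + (2 * r * c) ^ 2)) := by ring
  have hb : |2 * r * c| ≤ 2 * r := by
    rw [abs_mul, abs_of_nonneg (by positivity : 0 ≤ 2 * r)]
    exact mul_le_of_le_one_right (by positivity) hc
  have h2 : |x + 2 * r * c| ≤ 6 * r := (abs_add_le _ _).trans (by linarith)
  have h3 : |x ^ 2 + (2 * r * c) ^ 2| ≤ 20 * r ^ 2 := by
    refine (abs_add_le _ _).trans ?_
    rw [abs_pow, abs_pow]
    calc _ ≤ (4 * r) ^ 2 + (2 * r) ^ 2 := by gcongr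
      _ = _ := by ring
  rw [h1, abs_mul, abs_mul]
  calc _ ≤ e * ((6 * r) * (20 * r ^ 2)) := by gcongr
    _ = _ := by ring

/-- The radial equation gives η = 3r² + O(r⁴), and Σ x⁴ = 6N r⁴ + O(r⁶), so V/N = −(3/2) r⁴ + … =
−η²/6 + …; the bound r² ≤ η turns the errors into powers of η. The constant covers 3840 + 3584 ·
4/6. -/
lemma Regime.abs_potential_add_le (h : Regime N γ ρ) (hN6 : 6 ≤ N) (hr : 0 < r) (hr1 : r ≤ ρ)
    {z : Circle} (hf : force N γ (branch N γ r z) = 0) :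
    |potential N γ (branch N γ r z) / N + 1 / 6 * (1 - γ / gammaOne N) ^ 2|
      ≤ 7000 * N * (1 - γ / gammaOne N) ^ 3 := by
  have hN := h.four_le
  have hγ := h.le_gamma
  have hr2 : r ≤ 1 / 8 := by linarith [h.le_sixteenth]
  have hN0 : (0 : ℝ) < N := by positivity
  have hη := h.eta_pos
  have h4 : (4 : ZMod N) ≠ 0 := by
    intro h4
    have : ((4 : ℕ) : ZMod N) = 0 := by exact_mod_cast h4
    rw [ZMod.natCast_eq_zero_iff] at this
    have := Nat.le_of_dvd (by norm_num) this
    omega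
  have hw := sum_wave_pow_four (two_ne_zero_zmod hN) h4 z
  have hrad := ((force_branch_eq_zero_iff hN hγ hr.le hr2 z).1 hf).1
  rw [radialForce_eq hN hγ hr.le hr2] at hrad
  have hlow := h.le_sum_cube_mul_wave hr.le hr1 z
  have hcube := abs_sum_cube_mul_wave_sub_le hN hγ hr.le hr2 z
  rw [sub_eq_zero.1 hrad] at hlow hcube
  rw [hw] at hcube
  set η := 1 - γ / gammaOne N with hηdef
  have hr2η : r ^ 2 ≤ η := by
    refine le_of_mul_le_mul_right ?_ (by positivity : 0 < N * r)
    linarith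
  have hη3 : |η - 3 * r ^ 2| ≤ 3584 * N * r ^ 4 := by
    refine le_of_mul_le_mul_right ?_ (by positivity : 0 < N * r)
    have e1 : |η - 3 * r ^ 2| * (N * r) = |η * (N * r) - 8 * r ^ 3 * (3 / 8 * N)| := by
      rw [← abs_of_pos (by positivity : 0 < N * r), ← abs_mul, abs_of_pos (by positivity : 0 < N * r)]
      congr 1
      ring
    rw [e1]
    linarith
  have hfour : |∑ j, branch N γ r z j ^ 4 - 6 * N * r ^ 4| ≤ 15360 * N ^ 2 * r ^ 6 := by
    have e1 : ∑ j, branch N γ r z j ^ 4 - 6 * N * r ^ 4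
        = ∑ j, (branch N γ r z j ^ 4 - 16 * r ^ 4 * wave N z j ^ 4) := by
      rw [Finset.sum_sub_distrib, ← Finset.mul_sum, hw]; ring
    rw [e1]
    refine (Finset.abs_sum_le_sum_abs _ _).trans ((Finset.sum_le_sum fun j _ =>
      abs_pow_four_sub_le hr.le (abs_wave_circle_le z j) (abs_branch_le hN hγ hr.le hr2 z j)
        (abs_branch_sub_wave_le hN hγ hr.le hr2 z j)).trans_eq ?_)
    rw [Finset.sum_const, Finset.card_univ, ZMod.card, nsmul_eq_mul]
    ring
  have hr4 : r ^ 4 ≤ η ^ 2 := by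
    have := pow_le_pow_left₀ (by positivity) hr2η 2
    linarith [this, (by ring : (r ^ 2) ^ 2 = r ^ 4)]
  have hr6 : r ^ 6 ≤ η ^ 3 := by
    have := pow_le_pow_left₀ (by positivity) hr2η 3
    linarith [this, (by ring : (r ^ 2) ^ 3 = r ^ 6)]
  have hsq : |η ^ 2 - 9 * r ^ 4| ≤ 3584 * N * η ^ 2 * (4 * η) := by
    have e1 : η ^ 2 - 9 * r ^ 4 = (η - 3 * r ^ 2) * (η + 3 * r ^ 2) := by ring
    rw [e1, abs_mul, abs_of_pos (by positivity : 0 < η + 3 * r ^ 2)]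
    have e2 : η + 3 * r ^ 2 ≤ 4 * η := by linarith
    calc _ ≤ 3584 * N * r ^ 4 * (4 * η) := by gcongr
      _ ≤ _ := by gcongr
  rw [potential_of_force_eq_zero hf]
  have e1 : -(1 / 4) * ∑ j, branch N γ r z j ^ 4 / N + 1 / 6 * η ^ 2
      = -(1 / (4 * N)) * (∑ j, branch N γ r z j ^ 4 - 6 * N * r ^ 4)
        + 1 / 6 * (η ^ 2 - 9 * r ^ 4) := by
    rw [← Finset.sum_div]
    field_simp
    ring
  have e0 : -(1 / 4) * ∑ j, branch N γ r z j ^ 4 / N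
      = -(1 / 4) * (∑ j, branch N γ r z j ^ 4) / N := by
    rw [← Finset.sum_div, mul_div_assoc]
  rw [← e0, e1]
  refine (abs_add_le _ _).trans ?_
  rw [abs_mul, abs_mul, abs_neg, abs_of_pos (by positivity : (0 : ℝ) < 1 / (4 * N)),
    abs_of_pos (by norm_num : (0 : ℝ) < 1 / 6)]
  have e2 : 1 / (4 * N) * |∑ j, branch N γ r z j ^ 4 - 6 * N * r ^ 4| ≤ 3840 * N * η ^ 3 := by
    calc _ ≤ 1 / (4 * N) * (15360 * N ^ 2 * η ^ 3) := by gcongr; exact hfour.trans (by gcongr)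
      _ = _ := by field_simp; ring
  have e3 : 0 ≤ N * η ^ 3 := by positivity
  nlinarith

/-- Translation by 2 changes the sign, so the two neighbours of a site cancel and the equations
decouple: xⱼ = 0 or xⱼ² = 1 − γ. Since z⁴ = −1, the real part of (x₀ + i x₁)⁴ is −16r⁴ < 0, which
excludes a vanishing coordinate. -/
lemma Regime.potential_of_four (h : Regime N γ ρ) (hN4 : N = 4) (hr : 0 < r) (hr1 : r ≤ ρ)
    {z : Circle} (hz : ((z : ℂ) ^ N).im = 0) (hz1 : angularSign N * ((z : ℂ) ^ N).re = -1)
    (hf : force N γ (branch N γ r z) = 0) :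
    potential N γ (branch N γ r z) / N = -(1 / 4) * (1 - γ) ^ 2 := by
  subst hN4
  have hγ := h.le_gamma
  have hr2 := hr1.trans h.le_sixteenth
  set x := branch 4 γ r z with hx
  have hhalf : ∀ j, x (j + 2) = -x j := by
    intro j
    have := branch_add_half h.four_le h.even hγ hr.le hr2 z j
    exact this
  have hcases : ∀ j, x j = 0 ∨ x j ^ 2 = 1 - γ := by
    intro j
    have h1 := congrFun hf j
    have h2 := hhalf (j - 1)
    have h3 : j - 1 + 2 = j + 1 := by ring
    rw [h3] at h2
    simp only [force, linForce, Pi.zero_apply, h2] at h1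
    have h4 : x j * (x j ^ 2 - (1 - γ)) = 0 := by linear_combination h1
    rcases mul_eq_zero.1 h4 with h5 | h5
    · exact Or.inl h5
    · exact Or.inr (by linarith)
  have hI : (toCircle (1 : ZMod 4) : ℂ) = Complex.I := by
    have h1 := ZMod.toCircle_natCast (N := 4) 1
    have e1 : (2 * Real.pi * Complex.I * ((1 : ℕ) : ℂ) / ((4 : ℕ) : ℂ) : ℂ)
        = Real.pi / 2 * Complex.I := by push_cast; ring
    rw [Nat.cast_one] at h1
    rw [h1, e1, Complex.exp_pi_div_two_mul_I]
  have h2 : (toCircle (2 : ZMod 4) : ℂ) = -1 := by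
    rw [show (2 : ZMod 4) = 1 + 1 by norm_num, toCircle_add, hI, Complex.I_mul_I]
  have h3 : (toCircle (3 : ZMod 4) : ℂ) = -Complex.I := by
    rw [show (3 : ZMod 4) = 2 + 1 by norm_num, toCircle_add, hI, h2, neg_one_mul]
  have hx2 : x 2 = -x 0 := hhalf 0
  have hx3 : x 3 = -x 1 := hhalf 1
  have hmode : (x 0 + x 1 * Complex.I : ℂ) = 2 * r * (starRingEnd ℂ) (z : ℂ) := by
    have h5 := firstMode_branch h.four_le hγ hr.le (by linarith) z
    have h6 : firstMode 4 x = x 0 * (toCircle (0 : ZMod 4) : ℂ) + x 1 * (toCircle (1 : ZMod 4) : ℂ)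
        + x 2 * (toCircle (2 : ZMod 4) : ℂ) + x 3 * (toCircle (3 : ZMod 4) : ℂ) := by
      rw [firstMode_apply]
      exact Fin.sum_univ_four fun j : ZMod 4 => (x j : ℂ) * (toCircle j : ℂ)
    rw [h6, hI, h2, h3, AddChar.map_zero_eq_one, hx2, hx3] at h5
    push_cast at h5
    linear_combination h5 / 2
  have hz4 : (z : ℂ) ^ 4 = -1 := by
    refine Complex.ext ?_ ?_
    · have : angularSign 4 = 1 := by simp [angularSign]
      rw [this, one_mul] at hz1
      simpa using hz1
    · simpa using hz
  have hpow := congrArg (fun w : ℂ => (w ^ 4).re) hmode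
  simp only [mul_pow, ← map_pow, hz4, map_neg, map_one] at hpow
  have hpow2 : x 0 ^ 4 - 6 * x 0 ^ 2 * x 1 ^ 2 + x 1 ^ 4 = -(16 * r ^ 4) := by
    have e1 : (x 0 + x 1 * Complex.I : ℂ) ^ 4
        = ((x 0 ^ 4 - 6 * x 0 ^ 2 * x 1 ^ 2 + x 1 ^ 4 : ℝ) : ℂ)
          + ((4 * x 0 ^ 3 * x 1 - 4 * x 0 * x 1 ^ 3 : ℝ) : ℂ) * Complex.I := by
      have hI2 := Complex.I_sq
      push_cast
      linear_combination (6 * (x 0 : ℂ) ^ 2 * x 1 ^ 2 + 4 * x 0 * x 1 ^ 3 * Complex.I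
        + x 1 ^ 4 * (Complex.I ^ 2 - 1)) * hI2
    have e2 : (2 ^ 4 * (r : ℂ) ^ 4 * -1) = ((-(16 * r ^ 4) : ℝ) : ℂ) := by push_cast; ring
    rw [e1, e2, Complex.ofReal_re, Complex.add_re, Complex.ofReal_re, Complex.re_ofReal_mul,
      Complex.I_re, mul_zero, add_zero] at hpow
    exact hpow
  have hr4 : 0 < r ^ 4 := by positivity
  have hx0 : x 0 ^ 2 = 1 - γ := by
    refine (hcases 0).resolve_left fun h0 => ?_
    rw [h0] at hpow2
    nlinarith [sq_nonneg (x 1 ^ 2)]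
  have hx1 : x 1 ^ 2 = 1 - γ := by
    refine (hcases 1).resolve_left fun h0 => ?_
    rw [h0] at hpow2
    nlinarith [sq_nonneg (x 0 ^ 2)]
  rw [potential_of_force_eq_zero hf]
  have hsum : ∑ j, x j ^ 4 = x 0 ^ 4 + x 1 ^ 4 + x 2 ^ 4 + x 3 ^ 4 := Fin.sum_univ_four _
  have e0 : x 0 ^ 4 = (x 0 ^ 2) ^ 2 := by ring
  have e1 : x 1 ^ 4 = (x 1 ^ 2) ^ 2 := by ring
  rw [hsum, hx2, hx3]
  have : -(1 / 4) * (x 0 ^ 4 + x 1 ^ 4 + (-x 0) ^ 4 + (-x 1) ^ 4) / ((4 : ℕ) : ℝ)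
      = -(1 / 8) * ((x 0 ^ 2) ^ 2 + (x 1 ^ 2) ^ 2) := by push_cast; ring
  rw [this, hx0, hx1]
  ring

end

/-! ### Symmetry orbits and lattice translates. -/

section
set_option linter.unusedSectionVars false
variable {N : ℕ} [NeZero N] {γ r s ρ : ℝ}

lemma symR_apply (x : Config N) (j : ZMod N) : symR N x j = x (j + 1) := rfl

lemma symS_apply (x : Config N) (j : ZMod N) : symS N x j = x (1 - j) := rfl

lemma symC_apply (x : Config N) : symC N x = -x := rfl

lemma symR_pow_apply (k : ℕ) (x : Config N) (j : ZMod N) :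
    (symR N ^ k) x j = x (j + (k : ZMod N)) := by
  induction k generalizing j with
  | zero => simp
  | succ k ih =>
    rw [pow_succ', LinearEquiv.mul_apply, symR_apply, ih]
    push_cast
    congr 1
    ring

lemma symR_pow_card (x : Config N) : (symR N ^ N) x = x := by
  funext j
  rw [symR_pow_apply, ZMod.natCast_self, add_zero]

/-- The generators have finite order, so stability under them gives stability under inverses;
stating membership as an equivalence lets the induction pass through inverses. -/
lemma symOrbit_subset {T : Set (Config N)} {x : Config N} (hx : x ∈ T)
    (hR : ∀ y ∈ T, symR N y ∈ T) (hS : ∀ y ∈ T, symS N y ∈ T) (hC : ∀ y ∈ T, symC N y ∈ T) :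
    symOrbit N x ⊆ T := by
  have hRk : ∀ k : ℕ, ∀ y ∈ T, (symR N ^ k) y ∈ T := by
    intro k
    induction k with
    | zero => exact fun y hy => hy
    | succ k ih =>
      intro y hy
      rw [pow_succ', LinearEquiv.mul_apply]
      exact hR _ (ih y hy)
  have key : ∀ g ∈ symGroup N, ∀ y, y ∈ T ↔ g y ∈ T := by
    intro g hg
    induction hg using Subgroup.closure_induction with
    | mem g hg =>
      intro y
      rcases hg with rfl | rfl | rfl
      · refine ⟨hR y, fun h => ?_⟩
        have := hRk (N - 1) _ h
        rwa [← LinearEquiv.mul_apply, ← pow_succ,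
          Nat.sub_add_cancel (Nat.one_le_iff_ne_zero.2 (NeZero.ne N)), symR_pow_card] at this
      · refine ⟨hS y, fun h => ?_⟩
        have h2 : symS N (symS N y) = y := by funext j; simp [symS_apply]
        exact h2 ▸ hS _ h
      · refine ⟨hC y, fun h => ?_⟩
        have h2 : symC N (symC N y) = y := by simp [symC_apply]
        exact h2 ▸ hC _ h
    | one => exact fun y => Iff.rfl
    | mul g h _ _ ihg ihh => exact fun y => (ihh y).trans (ihg _)
    | inv g _ ih =>
      intro y
      have h1 : g (g⁻¹ y) = y := LinearEquiv.apply_symm_apply g y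
      rw [ih (g⁻¹ y), h1]
  rintro _ ⟨⟨g, hg⟩, rfl⟩
  exact (key g hg x).1 hx

lemma mem_symOrbit {g : Config N ≃ₗ[ℝ] Config N} (hg : g ∈ symGroup N) (x : Config N) :
    g x ∈ symOrbit N x := ⟨⟨g, hg⟩, rfl⟩

lemma symOrbit_zero : symOrbit N (0 : Config N) = {0} := by
  refine Set.Subset.antisymm (symOrbit_subset rfl ?_ ?_ ?_)
    (Set.singleton_subset_iff.2 (MulAction.mem_orbit_self _)) <;>
  · rintro _ rfl
    exact map_zero _

lemma symOrbit_syncPlus : symOrbit N (syncPlus N) = {syncPlus N, -syncPlus N} := by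
  refine Set.Subset.antisymm (symOrbit_subset (Or.inl rfl) ?_ ?_ ?_) ?_
  · rintro _ (rfl | rfl)
    exacts [Or.inl rfl, Or.inr rfl]
  · rintro _ (rfl | rfl)
    exacts [Or.inl rfl, Or.inr rfl]
  · rintro _ (rfl | rfl)
    exacts [Or.inr rfl, Or.inl (neg_neg _)]
  · rintro _ (rfl | rfl)
    · exact MulAction.mem_orbit_self _
    · exact mem_symOrbit (g := symC N) (Subgroup.subset_closure (by simp)) (syncPlus N)

lemma symR_pow_branch (k : ℕ) (z : Circle) :
    (symR N ^ k) (branch N γ r z) = branch N γ r (z * toCircle (k : ZMod N)) := by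
  funext j
  rw [symR_pow_apply, branch_mul_toCircle]

lemma cyclicTranslates_branch (z : Circle) :
    cyclicTranslates N (branch N γ r z)
      = Set.range fun j : ZMod N => branch N γ r (z * toCircle j) := by
  ext y
  constructor
  · rintro ⟨k, -, rfl⟩
    exact ⟨k, (symR_pow_branch k z).symm⟩
  · rintro ⟨j, rfl⟩
    refine ⟨j.val, ZMod.val_lt j, ?_⟩
    rw [symR_pow_branch, ZMod.natCast_zmod_val]

lemma ncard_cyclicTranslates_branch (hN : 4 ≤ N) (hγ : 3 / 4 * gammaOne N ≤ γ) (hr : 0 < r)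
    (hr1 : r ≤ 1 / 8) (z : Circle) : (cyclicTranslates N (branch N γ r z)).ncard = N := by
  have hinj : Function.Injective fun j : ZMod N => branch N γ r (z * toCircle j) := by
    intro i j hij
    have h := congrArg (firstMode N) hij
    have hNr : (N * r : ℂ) ≠ 0 := by exact_mod_cast (by positivity : (N : ℝ) * r ≠ 0)
    simp only [firstMode_branch hN hγ hr.le hr1] at h
    have h2 := (starRingEnd ℂ).injective (mul_left_cancel₀ hNr h)
    exact ZMod.injective_toCircle (mul_left_cancel (Circle.ext h2))
  rw [cyclicTranslates_branch, ← Set.image_univ, Set.ncard_image_of_injective _ hinj,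
    Set.ncard_univ, Nat.card_zmod]

/-- On these configurations S acts as a translation, by the reflection symmetry, and C as the
translation by N/2, so the whole group produces only translates. -/
lemma symOrbit_branch (hN : 4 ≤ N) (hEven : Even N) (hγ : 3 / 4 * gammaOne N ≤ γ) (hr : 0 ≤ r)
    (hr1 : r ≤ 1 / 16) {z : Circle} (hz : ((z : ℂ) ^ N).im = 0) :
    symOrbit N (branch N γ r z) = cyclicTranslates N (branch N γ r z) := by
  refine Set.Subset.antisymm ?_ ?_
  · rw [cyclicTranslates_branch]
    refine symOrbit_subset ⟨0, by simp⟩ ?_ ?_ ?_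
    · rintro _ ⟨j, rfl⟩
      refine ⟨j + 1, ?_⟩
      funext i
      simp only [symR_apply, branch_mul_toCircle]
      congr 1
      ring
    · rintro _ ⟨j, rfl⟩
      obtain ⟨m, hm⟩ := exists_branch_reflection hN hγ hr (by linarith) hz
      have hm0 := hm 0
      simp only [neg_zero, Circle.exp_zero, mul_one] at hm0
      refine ⟨m - 1 - j, ?_⟩
      funext i
      simp only [symS_apply, branch_mul_toCircle]
      rw [← hm0]
      congr 1
      ring
    · rintro _ ⟨j, rfl⟩
      refine ⟨j + ((N / 2 : ℕ) : ZMod N), ?_⟩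
      simp only [AddChar.map_add_eq_mul, symC_apply]
      rw [← mul_assoc, branch_half hN hEven hγ hr hr1]
  · rintro _ ⟨k, -, rfl⟩
    exact mem_symOrbit (pow_mem (Subgroup.subset_closure (by simp)) k) _

lemma force_branch_mul_toCircle (z : Circle) (k j : ZMod N) :
    force N γ (branch N γ r (z * toCircle k)) j = force N γ (branch N γ r z) (j + k) := by
  simp only [force, linForce, branch_mul_toCircle]
  rw [add_right_comm, sub_add_eq_add_sub]

lemma force_branch_mul_toCircle_eq_zero_iff (z : Circle) (k : ZMod N) :
    force N γ (branch N γ r (z * toCircle k)) = 0 ↔ force N γ (branch N γ r z) = 0 := by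
  constructor
  · intro h
    funext j
    have := congrFun h (j - k)
    rwa [force_branch_mul_toCircle, sub_add_cancel] at this
  · intro h
    funext j
    rw [force_branch_mul_toCircle, h, Pi.zero_apply, Pi.zero_apply]

lemma toCircle_pow_card (k : ZMod N) : (toCircle k : ℂ) ^ N = 1 := by
  have := toCircle_zsmul k N
  rw [zpow_natCast] at this
  rw [this]
  simp

lemma exists_circle_pow_eq (N : ℕ) [NeZero N] {σ : ℝ} (hσ : σ ^ 2 = 1) :
    ∃ z : Circle, (z : ℂ) ^ N = σ := by
  rcases mul_self_eq_one_iff.1 ((pow_two σ).symm.trans hσ) with rfl | rfl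
  · exact ⟨1, by simp⟩
  · refine ⟨Circle.exp (Real.pi / N), ?_⟩
    have hN : (N : ℂ) ≠ 0 := by exact_mod_cast NeZero.ne N
    rw [Circle.coe_exp, ← Complex.exp_nat_mul]
    push_cast
    rw [← Complex.exp_pi_mul_I]
    congr 1
    field_simp

lemma exists_mul_toCircle_eq {z w : Circle} (h : (w : ℂ) ^ N = (z : ℂ) ^ N) :
    ∃ k : ZMod N, w = z * toCircle k := by
  have h1 : ((z⁻¹ * w : Circle) : ℂ) ^ N = 1 := by
    rw [Circle.coe_mul, Circle.coe_inv, mul_pow, inv_pow, h,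
      inv_mul_cancel₀ (pow_ne_zero _ (Circle.coe_ne_zero z))]
  obtain ⟨k, -, hk⟩ := exists_toCircle_eq h1
  exact ⟨k, by rw [← hk, mul_inv_cancel_left]⟩

lemma force_zero : force N γ 0 = 0 := by
  funext j; simp [force, linForce]

lemma force_neg (x : Config N) : force N γ (-x) = -force N γ x := by
  funext j; simp only [force, linForce_neg, Pi.neg_apply]; ring

lemma force_syncPlus : force N γ (syncPlus N) = 0 := by
  funext j
  have h : linForce N γ (syncPlus N) j = -1 := linForce_const γ 1 j
  simp only [force, h, syncPlus, Pi.zero_apply]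
  norm_num

lemma saddles_eq_of_partition {T₀ T₁ T₂ T₃ : Set (Config N)}
    (hT : stationary N γ = T₀ ∪ T₁ ∪ T₂ ∪ T₃)
    (h₀ : ∀ x ∈ T₀, numNeg N γ x = 0 ∧ numNeg N γ x + numPos N γ x = N)
    (h₁ : ∀ x ∈ T₁, numNeg N γ x = 1 ∧ numNeg N γ x + numPos N γ x = N)
    (h₂ : ∀ x ∈ T₂, numNeg N γ x = 2 ∧ numNeg N γ x + numPos N γ x = N)
    (h₃ : ∀ x ∈ T₃, numNeg N γ x = 3 ∧ numNeg N γ x + numPos N γ x = N) :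
    saddles N γ 0 = T₀ ∧ saddles N γ 1 = T₁ ∧ saddles N γ 2 = T₂ ∧ saddles N γ 3 = T₃ := by
  have hmem : ∀ x, x ∈ stationary N γ ↔ ((x ∈ T₀ ∨ x ∈ T₁) ∨ x ∈ T₂) ∨ x ∈ T₃ := by
    intro x; rw [hT]; rfl
  refine ⟨?_, ?_, ?_, ?_⟩ <;>
  · ext x
    have := hmem x
    have := h₀ x
    have := h₁ x
    have := h₂ x
    have := h₃ x
    simp only [saddles, Set.mem_ofPred_eq]
    constructor
    · rintro ⟨ha, hb, -⟩
      rw [hmem] at ha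
      rcases ha with ((ha | ha) | ha) | ha <;> first | exact ha | (exfalso; grind)
    · intro ha
      grind

end

/-! ### Classification of the stationary points and the final count. -/

section
set_option linter.unusedSectionVars false
variable {N : ℕ} [NeZero N] {γ r s ρ : ℝ}

lemma Regime.sign_cases {z : Circle} (hz : ((z : ℂ) ^ N).im = 0) :
    angularSign N * ((z : ℂ) ^ N).re = -1 ∨ angularSign N * ((z : ℂ) ^ N).re = 1 := by
  have h : (angularSign N * ((z : ℂ) ^ N).re) * (angularSign N * ((z : ℂ) ^ N).re) = 1 := by
    linear_combination re_pow_sq_eq_one hz * (angularSign N * angularSign N) + angularSign_sq N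
  exact (mul_self_eq_one_iff.1 h).symm

lemma exists_circle_sign (N : ℕ) [NeZero N] {σ : ℝ} (hσ : σ ^ 2 = 1) :
    ∃ z : Circle, ((z : ℂ) ^ N).im = 0 ∧ angularSign N * ((z : ℂ) ^ N).re = σ := by
  have hs := angularSign_sq N
  obtain ⟨z, hz⟩ := exists_circle_pow_eq N (σ := angularSign N * σ) (by
    rw [mul_pow, hσ, pow_two, hs, mul_one])
  refine ⟨z, by rw [hz, Complex.ofReal_im], ?_⟩
  rw [hz, Complex.ofReal_re, ← mul_assoc, hs, one_mul]

lemma pow_eq_of_sign_eq {z w : Circle} (hz : ((z : ℂ) ^ N).im = 0) (hw : ((w : ℂ) ^ N).im = 0)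
    (h : angularSign N * ((z : ℂ) ^ N).re = angularSign N * ((w : ℂ) ^ N).re) :
    (z : ℂ) ^ N = (w : ℂ) ^ N :=
  Complex.ext (mul_left_cancel₀ (left_ne_zero_of_mul_eq_one (angularSign_sq N)) h)
    (hz.trans hw.symm)

/-- Phases with equal N-th powers differ by a lattice translation, and after translating back both
points lie on one ray, where the amplitude is unique. -/
lemma Regime.mem_cyclicTranslates (h : Regime N γ ρ) {z w : Circle} (hr : 0 < r) (hr1 : r ≤ ρ)
    (hs : 0 < s) (hs1 : s ≤ ρ) (hf : force N γ (branch N γ r z) = 0)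
    (hg : force N γ (branch N γ s w) = 0) (hpow : (w : ℂ) ^ N = (z : ℂ) ^ N) :
    branch N γ s w ∈ cyclicTranslates N (branch N γ r z) := by
  obtain ⟨k, rfl⟩ := exists_mul_toCircle_eq hpow
  rw [force_branch_mul_toCircle_eq_zero_iff] at hg
  rw [h.radius_unique hs hs1 hr hr1 hg hf, cyclicTranslates_branch]
  exact ⟨k, rfl⟩

lemma Regime.stationary_eq (h : Regime N γ ρ) {z w : Circle} (hz : ((z : ℂ) ^ N).im = 0)
    (hz1 : angularSign N * ((z : ℂ) ^ N).re = -1) (hw : ((w : ℂ) ^ N).im = 0)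
    (hw1 : angularSign N * ((w : ℂ) ^ N).re = 1) (hr : 0 < r) (hr1 : r ≤ ρ)
    (hs : 0 < s) (hs1 : s ≤ ρ) (hf : force N γ (branch N γ r z) = 0)
    (hg : force N γ (branch N γ s w) = 0) :
    stationary N γ = {syncPlus N, -syncPlus N} ∪ cyclicTranslates N (branch N γ r z) ∪
      cyclicTranslates N (branch N γ s w) ∪ {0} := by
  ext x
  rw [mem_stationary_iff]
  constructor
  · intro hx
    rcases h.stationary_cases hx with rfl | rfl | rfl | ⟨t, u, ht, ht1, hu, rfl⟩
    · exact Or.inr rfl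
    · exact Or.inl (Or.inl (Or.inl (Or.inl rfl)))
    · exact Or.inl (Or.inl (Or.inl (Or.inr rfl)))
    · rcases Regime.sign_cases hu with hu1 | hu1
      · exact Or.inl (Or.inl (Or.inr (h.mem_cyclicTranslates hr hr1 ht ht1 hf hx
          (pow_eq_of_sign_eq hu hz (hu1.trans hz1.symm)))))
      · exact Or.inl (Or.inr (h.mem_cyclicTranslates hs hs1 ht ht1 hg hx
          (pow_eq_of_sign_eq hu hw (hu1.trans hw1.symm))))
  · rw [cyclicTranslates_branch, cyclicTranslates_branch]
    rintro ((((rfl | rfl) | ⟨j, rfl⟩) | ⟨j, rfl⟩) | rfl)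
    · exact force_syncPlus
    · rw [force_neg, force_syncPlus, neg_zero]
    · exact (force_branch_mul_toCircle_eq_zero_iff z j).2 hf
    · exact (force_branch_mul_toCircle_eq_zero_iff w j).2 hg
    · exact force_zero

lemma mul_toCircle_pow (z : Circle) (j : ZMod N) :
    ((z * toCircle j : Circle) : ℂ) ^ N = (z : ℂ) ^ N := by
  rw [Circle.coe_mul, mul_pow, toCircle_pow_card, mul_one]

lemma Regime.saddles_eq (h : Regime N γ ρ) {z w : Circle} (hz : ((z : ℂ) ^ N).im = 0)
    (hz1 : angularSign N * ((z : ℂ) ^ N).re = -1) (hw : ((w : ℂ) ^ N).im = 0)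
    (hw1 : angularSign N * ((w : ℂ) ^ N).re = 1) (hr : 0 < r) (hr1 : r ≤ ρ)
    (hs : 0 < s) (hs1 : s ≤ ρ) (hf : force N γ (branch N γ r z) = 0)
    (hg : force N γ (branch N γ s w) = 0) :
    saddles N γ 0 = {syncPlus N, -syncPlus N} ∧
      saddles N γ 1 = cyclicTranslates N (branch N γ r z) ∧
      saddles N γ 2 = cyclicTranslates N (branch N γ s w) ∧ saddles N γ 3 = {0} := by
  refine saddles_eq_of_partition (h.stationary_eq hz hz1 hw hw1 hr hr1 hs hs1 hf hg) ?_ ?_ ?_ ?_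
  · have h1 := one_le_gammaOne h.four_le
    have h2 : 0 ≤ γ := by linarith [h.le_gamma]
    rintro _ (rfl | rfl) <;> refine index_of_sq_eq_one h2 fun j => ?_ <;> simp [syncPlus]
  · rw [cyclicTranslates_branch]
    rintro _ ⟨j, rfl⟩
    exact h.index_one hr hr1 (by rw [mul_toCircle_pow, hz]) (by rw [mul_toCircle_pow, hz1])
      ((force_branch_mul_toCircle_eq_zero_iff z j).2 hf)
  · rw [cyclicTranslates_branch]
    rintro _ ⟨j, rfl⟩
    exact h.index_two hs hs1 (by rw [mul_toCircle_pow, hw]) (by rw [mul_toCircle_pow, hw1])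
      ((force_branch_mul_toCircle_eq_zero_iff w j).2 hg)
  · rintro _ rfl
    exact index_zero h.four_le h.le_gamma h.lt_gammaOne

lemma potential_branch_mul_toCircle {z : Circle} (hf : force N γ (branch N γ r z) = 0) (j : ZMod N) :
    potential N γ (branch N γ r (z * toCircle j)) = potential N γ (branch N γ r z) := by
  rw [potential_of_force_eq_zero hf,
    potential_of_force_eq_zero ((force_branch_mul_toCircle_eq_zero_iff z j).2 hf)]
  simp only [branch_mul_toCircle]
  exact congrArg _ (Equiv.sum_comp (Equiv.addRight j) fun i => branch N γ r z i ^ 4)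

lemma saddles_disjoint {k l : ℕ} (hkl : k ≠ l) : Disjoint (saddles N γ k) (saddles N γ l) :=
  Set.disjoint_left.2 fun _ hk hl => hkl (hk.2.1.symm.trans hl.2.1)

lemma ncard_syncPlus_pair : ({syncPlus N, -syncPlus N} : Set (Config N)).ncard = 2 := by
  refine Set.ncard_pair fun h => ?_
  have := congrFun h 0
  simp only [syncPlus, Pi.neg_apply] at this
  norm_num at this

lemma ncard_saddles_union {n₀ n₁ n₂ n₃ : ℕ} (h₀ : (saddles N γ 0).ncard = n₀ ∧ n₀ ≠ 0)
    (h₁ : (saddles N γ 1).ncard = n₁ ∧ n₁ ≠ 0) (h₂ : (saddles N γ 2).ncard = n₂ ∧ n₂ ≠ 0)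
    (h₃ : (saddles N γ 3).ncard = n₃ ∧ n₃ ≠ 0) :
    (saddles N γ 0 ∪ saddles N γ 1 ∪ saddles N γ 2 ∪ saddles N γ 3).Finite ∧
    (saddles N γ 0 ∪ saddles N γ 1 ∪ saddles N γ 2 ∪ saddles N γ 3).ncard
      = n₀ + n₁ + n₂ + n₃ := by
  have hfin : ∀ {k n : ℕ}, (saddles N γ k).ncard = n ∧ n ≠ 0 → (saddles N γ k).Finite :=
    fun h => Set.finite_of_ncard_ne_zero (h.1.trans_ne h.2)
  have f₀ := hfin h₀
  have f₁ := hfin h₁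
  have f₂ := hfin h₂
  have f₃ := hfin h₃
  refine ⟨((f₀.union f₁).union f₂).union f₃, ?_⟩
  have hd := fun k l (h : k ≠ l) => saddles_disjoint (N := N) (γ := γ) h
  rw [Set.ncard_union_eq _ ((f₀.union f₁).union f₂) f₃, Set.ncard_union_eq _ (f₀.union f₁) f₂,
    Set.ncard_union_eq (hd 0 1 (by norm_num)) f₀ f₁, h₀.1, h₁.1, h₂.1, h₃.1]
  · exact Set.disjoint_union_left.2 ⟨hd 0 2 (by norm_num), hd 1 2 (by norm_num)⟩
  · exact Set.disjoint_union_left.2 ⟨Set.disjoint_union_left.2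
      ⟨hd 0 3 (by norm_num), hd 1 3 (by norm_num)⟩, hd 2 3 (by norm_num)⟩

/-- Just below the threshold, the smallness assumptions hold. -/
lemma exists_regime (hN : 4 ≤ N) (hEven : Even N) :
    ∃ δ ρ : ℝ, 0 < δ ∧ ∀ γ, gammaOne N - δ < γ → γ < gammaOne N → Regime N γ ρ := by
  have hN4 : (4 : ℝ) ≤ N := by exact_mod_cast hN
  have hg := one_le_gammaOne hN
  -- The largest ρ allowed by `pow_le`; the other entry of the minimum below, 1/(100N), gives
  -- `sq_le` and `le_sixteenth`.
  set a : ℝ := N * (1 / (2 * gammaOne N)) ^ (N / 2 - 2) / (2 * 16 ^ N) with ha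
  have ha0 : 0 < a := by positivity
  set ρ : ℝ := min (1 / (100 * N)) a with hρ
  have hρ0 : 0 < ρ := lt_min (by positivity) ha0
  have hρ1 : ρ * (100 * N) ≤ 1 := by
    have := min_le_left (1 / (100 * N : ℝ)) a
    rwa [← hρ, le_div_iff₀ (by positivity)] at this
  have hρa : ρ ≤ a := min_le_right _ _
  set c : ℝ := ρ ^ 2 / (4 + 8 * N ^ 3) with hc
  have hc0 : 0 < c := by positivity
  -- In terms of η this means η < 1/4, that is `le_gamma`, and η < c, that is `eta_le`.
  refine ⟨gammaOne N * min (1 / 4) c, ρ, mul_pos (by linarith) (lt_min (by norm_num) hc0),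
    fun γ h1 h2 => ?_⟩
  have h3 : 1 - γ / gammaOne N ≤ min (1 / 4) c := by
    rw [sub_le_iff_le_add, ← sub_le_iff_le_add', le_div_iff₀ (by linarith)]
    linarith
  refine ⟨hN, hEven, ?_, h2, hρ0, ?_, ?_, ?_, ?_⟩
  · have h4 := h3.trans (min_le_left _ _)
    have h5 : 3 / 4 ≤ γ / gammaOne N := by linarith
    rwa [le_div_iff₀ (by linarith)] at h5
  · nlinarith
  · have : (ρ * (100 * N)) ^ 2 ≤ 1 := pow_le_one₀ (by positivity) hρ1
    nlinarith [sq_nonneg ρ, mul_nonneg (sq_nonneg ρ) (by positivity : (0 : ℝ) ≤ N)]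
  · rw [ha, le_div_iff₀ (by positivity)] at hρa
    linarith
  · have h4 := h3.trans (min_le_right _ _)
    rw [hc, le_div_iff₀ (by positivity)] at h4
    linarith

end

end CoupledChain

end

theorem mainTheorem1 (N : ℕ) [NeZero N] (hN : 4 ≤ N) (hEven : Even N) :
    ∃ δ : ℝ, 0 < δ ∧ ∃ A B : ℝ → CoupledChain.Config N,
      (∀ γ : ℝ, CoupledChain.gammaOne N - δ < γ → γ < CoupledChain.gammaOne N →
        (CoupledChain.stationary N γ).Finite ∧
        (CoupledChain.stationary N γ).ncard = 2 * N + 3 ∧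
        CoupledChain.stationary N γ =
          CoupledChain.saddles N γ 0 ∪ CoupledChain.saddles N γ 1 ∪
            CoupledChain.saddles N γ 2 ∪ CoupledChain.saddles N γ 3 ∧
        CoupledChain.saddles N γ 0 = CoupledChain.symOrbit N (CoupledChain.syncPlus N) ∧
        CoupledChain.symOrbit N (CoupledChain.syncPlus N) =
          {CoupledChain.syncPlus N, -CoupledChain.syncPlus N} ∧
        CoupledChain.saddles N γ 1 = CoupledChain.symOrbit N (A γ) ∧
        CoupledChain.symOrbit N (A γ) = CoupledChain.cyclicTranslates N (A γ) ∧
        (CoupledChain.saddles N γ 1).ncard = N ∧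
        CoupledChain.saddles N γ 2 = CoupledChain.symOrbit N (B γ) ∧
        CoupledChain.symOrbit N (B γ) = CoupledChain.cyclicTranslates N (B γ) ∧
        (CoupledChain.saddles N γ 2).ncard = N ∧
        CoupledChain.saddles N γ 3 = CoupledChain.symOrbit N 0 ∧
        CoupledChain.symOrbit N (0 : CoupledChain.Config N) = {0} ∧
        (∀ x ∈ CoupledChain.saddles N γ 1,
          CoupledChain.potential N γ x = CoupledChain.potential N γ (A γ)) ∧
        (N = 4 → CoupledChain.potential N γ (A γ) / N = -(1 / 4) * (1 - γ) ^ 2)) ∧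
      (6 ≤ N →
        (fun γ : ℝ => CoupledChain.potential N γ (A γ) / N
            - (-(1 / 6) * (1 - γ / CoupledChain.gammaOne N) ^ 2))
          =O[𝓝[<] (CoupledChain.gammaOne N)]
            fun γ : ℝ => (1 - γ / CoupledChain.gammaOne N) ^ 3) := by
  obtain ⟨δ, ρ, hδ, hreg⟩ := CoupledChain.exists_regime hN hEven
  -- The phases of A and B do not depend on γ; only the amplitudes do. The sign −1 belongs to index
  -- 1 and the sign 1 to index 2.
  obtain ⟨z, hz, hz1⟩ := CoupledChain.exists_circle_sign N (σ := -1) (by norm_num)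
  obtain ⟨w, hw, hw1⟩ := CoupledChain.exists_circle_sign N (σ := 1) (by norm_num)
  have hex : ∀ u : Circle, ((u : ℂ) ^ N).im = 0 → ∀ γ : ℝ, ∃ r : ℝ,
      CoupledChain.gammaOne N - δ < γ → γ < CoupledChain.gammaOne N →
      0 < r ∧ r ≤ ρ ∧ CoupledChain.force N γ (CoupledChain.branch N γ r u) = 0 := by
    intro u hu γ
    by_cases h : CoupledChain.gammaOne N - δ < γ ∧ γ < CoupledChain.gammaOne N
    · obtain ⟨r, hr⟩ := (hreg γ h.1 h.2).exists_stationary hu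
      exact ⟨r, fun _ _ => hr⟩
    -- Outside the window the amplitude is a default value. No continuity in γ is needed, since all
    -- estimates are uniform.
    · exact ⟨0, fun h1 h2 => (h ⟨h1, h2⟩).elim⟩
  choose r hr using hex z hz
  choose s hs using hex w hw
  refine ⟨δ, hδ, fun γ => CoupledChain.branch N γ (r γ) z,
    fun γ => CoupledChain.branch N γ (s γ) w, fun γ h1 h2 => ?_, fun hN6 => ?_⟩
  · have h := hreg γ h1 h2
    obtain ⟨hr0, hr1, hf⟩ := hr γ h1 h2
    obtain ⟨hs0, hs1, hg⟩ := hs γ h1 h2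
    have hρ := h.le_sixteenth
    obtain ⟨e0, e1, e2, e3⟩ := h.saddles_eq hz hz1 hw hw1 hr0 hr1 hs0 hs1 hf hg
    have hst := h.stationary_eq hz hz1 hw hw1 hr0 hr1 hs0 hs1 hf hg
    rw [← e0, ← e1, ← e2, ← e3] at hst
    have oA := CoupledChain.symOrbit_branch hN hEven h.le_gamma hr0.le (hr1.trans hρ) hz
    have oB := CoupledChain.symOrbit_branch hN hEven h.le_gamma hs0.le (hs1.trans hρ) hw
    have c0 : (CoupledChain.saddles N γ 0).ncard = 2 := by
      rw [e0, CoupledChain.ncard_syncPlus_pair]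
    have c1 : (CoupledChain.saddles N γ 1).ncard = N := by
      rw [e1, CoupledChain.ncard_cyclicTranslates_branch hN h.le_gamma hr0 (by linarith)]
    have c2 : (CoupledChain.saddles N γ 2).ncard = N := by
      rw [e2, CoupledChain.ncard_cyclicTranslates_branch hN h.le_gamma hs0 (by linarith)]
    have c3 : (CoupledChain.saddles N γ 3).ncard = 1 := by rw [e3, Set.ncard_singleton]
    obtain ⟨hfin, hcard⟩ := CoupledChain.ncard_saddles_union ⟨c0, two_ne_zero⟩
      ⟨c1, NeZero.ne N⟩ ⟨c2, NeZero.ne N⟩ ⟨c3, one_ne_zero⟩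
    rw [← hst] at hfin hcard
    refine ⟨hfin, by rw [hcard]; ring, hst, e0.trans CoupledChain.symOrbit_syncPlus.symm,
      CoupledChain.symOrbit_syncPlus, e1.trans oA.symm, oA, c1, e2.trans oB.symm, oB, c2,
      e3.trans CoupledChain.symOrbit_zero.symm, CoupledChain.symOrbit_zero, fun x hx => ?_,
      fun hN4 => h.potential_of_four hN4 hr0 hr1 hz hz1 hf⟩
    rw [e1, CoupledChain.cyclicTranslates_branch] at hx
    obtain ⟨j, rfl⟩ := hx
    exact CoupledChain.potential_branch_mul_toCircle hf j
  · refine IsBigO.of_bound (7000 * N) ?_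
    filter_upwards [Ioo_mem_nhdsLT (sub_lt_self (CoupledChain.gammaOne N) hδ)] with γ hγ
    have h := hreg γ hγ.1 hγ.2
    obtain ⟨hr0, hr1, hf⟩ := hr γ hγ.1 hγ.2
    have hη := h.eta_pos
    rw [Real.norm_eq_abs, Real.norm_of_nonneg (by positivity), neg_mul, sub_neg_eq_add]
    exact h.abs_potential_add_le hN6 hr0 hr1 hf
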